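/- Let $D,C,m,M\ge 1$ be integers, $p\in(0,1)$ and $\lambda\ge 0$. Let $\alpha,\beta:\mathbb N\to\mathbb R$ be such that $\alpha$ is nondecreasing, $\alpha(d)\to\infty$ and $d/\alpha(d)\to 0$ as $d\to\infty$, and $\beta(d)\ge\alpha(d)$ for all $d$. Let $(X,Y)$ be a random pair in $\mathbb R^D\times\{1,\dots,C\}$ such that the distribution of $X$ has a density with respect to Lebesgue measure, and let $(X_1,Y_1),(X_2,Y_2),\dots$ be i.i.d. copies of $(X,Y)$, which arrive one at a time. \emph{Online random tree.} The tree is a binary tree whose leaves are cells partitioning $\mathbb R^D$; at the start it consists of the root $\mathbb R^D$ (depth $0$) only. Each data point is assigned, independently of everything else, to the estimation stream with probability $p$ and to the structure stream with probability $1-p$. When a leaf is created, a set of $\min(1+\mathrm{Poisson}(\lambda),D)$ distinct candidate dimensions is drawn for it uniformly at random and independently of the past. Each of the first $m$ structure points $x$ arriving in the new leaf creates, for each of its candidate dimensions $i$, the candidate split of the leaf into the candidate children $\{z: z_i\le x_i\}$ and $\{z: z_i>x_i\}$. The lifetime of a cell starts when it is created as a candidate child (at time $0$ for the root) and ends when it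 is split. For each leaf and each candidate child one maintains the class histogram of the estimation points that fall in it during its lifetime, and a structural statistic. The latter takes values in some measurable space, starts from a fixed value, and is updated by a fixed measurable map with each structure point falling in the cell during its lifetime. A candidate split of a leaf of depth $d$ is \emph{allowed} if both of its children have received at least $\alpha(d)$ estimation points. Whenever a structure point arrives in a leaf, the candidate splits and the structural statistics are first updated; then, if some candidate split is allowed, the leaf \emph{may} be split, and it \emph{must} be split if it has received at least $\beta(d)$ estimation points during its lifetime. Whether a voluntary split is made, and which allowed candidate split is made, is decided by an arbitrary fixed measurable rule from the depth, the set of allowed candidate splits, and the structural statistics of the leaf and of its candidate children. The new leaves keep the histograms and statistics that they had as candidate children. Let $A_t(x)$ be the leaf containing $x$ after $t$ data points, $N^e(A_t(x))$ the number of estimation points counted in it during its lifetime, and $\eta_t^k(x)$ the fraction of these whose class is $k$ (read as $0$ if there are none). The tree predicts $\arg\max_k\eta^k_t(x)$. \emph{Forest.} The forest classifier $g_t^{(M)}$ is the majority vote of $M$ such trees, all built from the same data with the same parameters and decision rule. The random choices (root dimensions, stream assignments, candidate dimensions) of each single tree have the law described above and are independent of the data; those of different trees may depend on each other in an arbitrary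 way. All ties in $\arg\max$ and in the vote are broken in favour of the smaller class. Then the online random forest classifier is consistent: for a classifier $g$ let $L(g)=\mathbb P(g(X)\ne Y)$, where $(X,Y)$ is a test point independent of the data and of all random choices, and let $L^*=L(g^*)$ be the Bayes risk, where $g^*(x)=\arg\max_k\mathbb P(Y=k\mid X=x)$. Then for every $t$ the random variable $L(g_t^{(M)})$ is integrable, and $$\mathbb E\,L(g_t^{(M)})\longrightarrow L^*\qquad (t\to\infty).$$ -/

import Mathlib

open MeasureTheory ProbabilityTheory Filter Topology
open scoped NNReal ENNReal

namespace OnlineForest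

/-- The feature space `ℝ^D`. -/
abbrev Feat (D : ℕ) : Type := EuclideanSpace ℝ (Fin D)

/-! ### Classifiers, posterior probabilities, risk -/

theorem exists_maximizer {C : ℕ} [NeZero C] (f : Fin C → ℝ) :
    (Finset.univ.filter fun k : Fin C => ∀ j, f j ≤ f k).Nonempty := by
  obtain ⟨k, hk⟩ := Finite.exists_max f
  exact ⟨k, by simpa using hk⟩

/-- The class that maximizes `f`; ties are broken in favour of the smaller index. -/
noncomputable def argmax {C : ℕ} [NeZero C] (f : Fin C → ℝ) : Fin C :=
  (Finset.univ.filter fun k : Fin C => ∀ j, f j ≤ f k).min' (exists_maximizer f)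

/-- The class posterior `η^k(x) = P(Y = k | X = x)` when `(X, Y)` has law `P`. -/
noncomputable def posterior {D C : ℕ} [NeZero C] (P : Measure (Feat D × Fin C))
    [IsProbabilityMeasure P] (x : Feat D) (k : Fin C) : ℝ :=
  (P.condKernel x).real {k}

/-- The Bayes classifier `x ↦ argmax_k P(Y = k | X = x)`. -/
noncomputable def bayesClassifier {D C : ℕ} [NeZero C] (P : Measure (Feat D × Fin C))
    [IsProbabilityMeasure P] (x : Feat D) : Fin C :=
  argmax (posterior P x)

/-- The probability of error `P(g(X) ≠ Y)` of a classifier `g` on a fresh test point of law `P`. -/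
noncomputable def risk {D C : ℕ} (P : Measure (Feat D × Fin C)) (g : Feat D → Fin C) : ℝ :=
  P.real {z | g z.1 ≠ z.2}

/-- The Bayes risk `L*`: the probability of error of the Bayes classifier. -/
noncomputable def bayesRisk {D C : ℕ} [NeZero C] (P : Measure (Feat D × Fin C))
    [IsProbabilityMeasure P] : ℝ :=
  risk P (bayesClassifier P)

/-! ### The random choices of one tree -/

/-- The law of the candidate dimensions of a new leaf: a uniformly random set of
`min (1 + Poisson(rate)) D` distinct coordinates. -/
noncomputable def dimsLaw (D : ℕ) (rate : ℝ≥0) : Measure (Finset (Fin D)) :=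
  (poissonMeasure rate).bind fun k =>
    (PMF.uniformOfFinset (Finset.powersetCard (min (1 + k) D) Finset.univ)
      (Finset.powersetCard_nonempty.2 (by simp))).toMeasure

/-- The randomness that one tree uses at one time step: the stream to which the data point is
assigned (`true` for the estimation stream, `false` for the structure stream), and the candidate
dimensions of the left and of the right child, which are used only if a leaf is split
in this step. -/
abbrev Draw (D : ℕ) : Type := Bool × Finset (Fin D) × Finset (Fin D)

/-- The law of the randomness of one time step: a point is an estimation point with
probability `p`, and the draws are independent. -/
noncomputable def drawLaw (D : ℕ) (p : unitInterval) (rate : ℝ≥0) : Measure (Draw D) :=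
  (bernoulliMeasure true false p).prod ((dimsLaw D rate).prod (dimsLaw D rate))

/-! ### Leaves, trees, and the online update -/

/-- Candidate splits of a leaf are indexed by `(i, d)`: the `i`-th structure point that arrived
in the leaf is projected on the coordinate `d`. -/
abbrev Cand (m D : ℕ) : Type := Fin m × Fin D

/-- The structural statistics and the way they are used to choose splits.  Every cell (leaf or
candidate child of a leaf) carries a statistic in a space `𝒮`; it starts at `init` when the cell
is created as a candidate child and is updated with each structure point that falls in the
cell.  When the nonempty set `V` of candidate splits of a leaf is allowed at depth `d`,
`shouldSplit` tells from the statistics of the leaf and of its candidate children whether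
to split the leaf voluntarily, and `best` selects the split in `V` to be made.  The
information gain criterion is one example. -/
structure SplitRule (m D C : ℕ) (𝒮 : Type*) [MeasurableSpace 𝒮] where
  init : 𝒮
  update : 𝒮 → Feat D × Fin C → 𝒮
  measurable_update : Measurable fun q : 𝒮 × (Feat D × Fin C) => update q.1 q.2
  shouldSplit : ℕ → Finset (Cand m D) → 𝒮 × (Cand m D → Bool → 𝒮) → Prop
  measurableSet_shouldSplit : ∀ d V, MeasurableSet {s | shouldSplit d V s}
  best : ℕ → Finset (Cand m D) → 𝒮 × (Cand m D → Bool → 𝒮) → Cand m D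
  best_mem : ∀ d V s, V.Nonempty → best d V s ∈ V
  measurableSet_best : ∀ d V S, MeasurableSet {s | best d V s = S}

/-- The parameters of the tree building algorithm: the thresholds `α`, `β` and the split rule. -/
structure Params (m D C : ℕ) (𝒮 : Type*) [MeasurableSpace 𝒮] where
  α : ℕ → ℝ
  β : ℕ → ℝ
  rule : SplitRule m D C 𝒮

/-- The record kept in a leaf. -/
structure Leaf (m D C : ℕ) (𝒮 : Type*) where
  /-- depth of the leaf (the root has depth `0`) -/
  depth : ℕ
  /-- candidate split dimensions -/
  dims : Finset (Fin D)
  /-- number of candidate points collected so far (at most `m`) -/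
  num : ℕ
  /-- the candidate points; only the entries with index below `num` are meaningful -/
  pt : Fin m → Feat D
  /-- class histogram of the estimation points of the lifetime of the leaf -/
  est : Fin C → ℕ
  /-- class histograms of the estimation points of the candidate children -/
  candEst : Cand m D → Bool → Fin C → ℕ
  /-- structural statistic of the leaf -/
  stat : 𝒮
  /-- structural statistics of the candidate children -/
  candStat : Cand m D → Bool → 𝒮

/-- Online trees.  In `node d θ l r` the points with `x d ≤ θ` go to `l`, the others to `r`. -/
inductive Tree (m D C : ℕ) (𝒮 : Type*) where
  | leaf (L : Leaf m D C 𝒮) : Tree m D C 𝒮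
  | node (d : Fin D) (θ : ℝ) (l r : Tree m D C 𝒮) : Tree m D C 𝒮

section Update

variable {m D C : ℕ} {𝒮 : Type*}

/-- A new leaf: it inherits the estimation histogram and the structural statistic that it
gathered as a candidate child, and has no candidate splits yet. -/
def newLeaf [MeasurableSpace 𝒮] (R : SplitRule m D C 𝒮) (depth : ℕ) (dims : Finset (Fin D)) (est : Fin C → ℕ)
    (stat : 𝒮) : Leaf m D C 𝒮 where
  depth := depth
  dims := dims
  num := 0
  pt := fun _ => 0
  est := est
  candEst := fun _ _ _ => 0
  stat := stat
  candStat := fun _ _ => R.init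

/-- The candidate split `S` of the leaf `L` has been created. -/
def Leaf.IsCand (L : Leaf m D C 𝒮) (S : Cand m D) : Prop :=
  (S.1 : ℕ) < L.num ∧ S.2 ∈ L.dims

/-- The threshold of the candidate split `S`. -/
noncomputable def Leaf.threshold (L : Leaf m D C 𝒮) (S : Cand m D) : ℝ := L.pt S.1 S.2

/-- The point `x` belongs to the child `b` (`false`: left, `true`: right) of a created
candidate split `S`. -/
def Leaf.InChild (L : Leaf m D C 𝒮) (S : Cand m D) (b : Bool) (x : Feat D) : Prop :=
  L.IsCand S ∧ (b = true ↔ L.threshold S < x S.2)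

/-- Number of estimation points of the lifetime of the leaf. -/
def Leaf.numEst (L : Leaf m D C 𝒮) : ℕ := ∑ k, L.est k

/-- Add one point of class `y` to a class histogram. -/
def addLabel (h : Fin C → ℕ) (y : Fin C) : Fin C → ℕ := fun k => if k = y then h k + 1 else h k

open Classical in
/-- An estimation point arrives in the leaf: the class histograms of the leaf and of the candidate
children that contain the point are updated. -/
noncomputable def Leaf.addEstimation (L : Leaf m D C 𝒮) (z : Feat D × Fin C) : Leaf m D C 𝒮 :=
  { L with
    est := addLabel L.est z.2
    candEst := fun S b =>
      if L.InChild S b z.1 then addLabel (L.candEst S b) z.2 else L.candEst S b }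

open Classical in
/-- The first `m` structure points to arrive in the leaf become candidate points. -/
noncomputable def Leaf.addCandidate (L : Leaf m D C 𝒮) (x : Feat D) : Leaf m D C 𝒮 :=
  if L.num < m then
    { L with
      num := L.num + 1
      pt := fun i => if (i : ℕ) = L.num then x else L.pt i }
  else L

open Classical in
/-- The structural statistics of the leaf and of the candidate children that contain the structure
point are updated. -/
noncomputable def Leaf.addStructure [MeasurableSpace 𝒮] (R : SplitRule m D C 𝒮) (L : Leaf m D C 𝒮)
    (z : Feat D × Fin C) : Leaf m D C 𝒮 :=
  { L with
    stat := R.update L.stat z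
    candStat := fun S b =>
      if L.InChild S b z.1 then R.update (L.candStat S b) z else L.candStat S b }

open Classical in
/-- The candidate splits that are allowed: those both of whose children have received at least
`α(depth)` estimation points. -/
noncomputable def Leaf.validSplits [MeasurableSpace 𝒮] (Q : Params m D C 𝒮) (L : Leaf m D C 𝒮) :
    Finset (Cand m D) :=
  Finset.univ.filter fun S =>
    L.IsCand S ∧ ∀ b : Bool, Q.α L.depth ≤ ((∑ k, L.candEst S b k : ℕ) : ℝ)

/-- The leaf is split now: some candidate split is allowed, and either the structural statistics
ask for a split, or the leaf has received at least `β(depth)` estimation points and must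
be split. -/
def Leaf.Splits [MeasurableSpace 𝒮] (Q : Params m D C 𝒮) (L : Leaf m D C 𝒮) : Prop :=
  (L.validSplits Q).Nonempty ∧
    (Q.rule.shouldSplit L.depth (L.validSplits Q) (L.stat, L.candStat) ∨
      Q.β L.depth ≤ (L.numEst : ℝ))

/-- The split that is made if the leaf is split. -/
noncomputable def Leaf.chosen [MeasurableSpace 𝒮] (Q : Params m D C 𝒮) (L : Leaf m D C 𝒮) : Cand m D :=
  Q.rule.best L.depth (L.validSplits Q) (L.stat, L.candStat)

open Classical in
/-- Split the leaf if it has to be split now; `dl`, `dr` are the candidate dimensions of the new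
leaves. -/
noncomputable def Leaf.trySplit [MeasurableSpace 𝒮] (Q : Params m D C 𝒮) (L : Leaf m D C 𝒮)
    (dl dr : Finset (Fin D)) : Tree m D C 𝒮 :=
  if L.Splits Q then
    .node (L.chosen Q).2 (L.threshold (L.chosen Q))
      (.leaf (newLeaf Q.rule (L.depth + 1) dl
        (L.candEst (L.chosen Q) false) (L.candStat (L.chosen Q) false)))
      (.leaf (newLeaf Q.rule (L.depth + 1) dr
        (L.candEst (L.chosen Q) true) (L.candStat (L.chosen Q) true)))
  else .leaf L

/-- What happens in the leaf in which the data point `z` arrives. -/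
noncomputable def Leaf.step [MeasurableSpace 𝒮] (Q : Params m D C 𝒮) (z : Feat D × Fin C) (u : Draw D)
    (L : Leaf m D C 𝒮) : Tree m D C 𝒮 :=
  if u.1 then .leaf (L.addEstimation z)
  else ((L.addCandidate z.1).addStructure Q.rule z).trySplit Q u.2.1 u.2.2

open Classical in
/-- One online step: the data point `z` descends to the leaf that contains it, which is updated. -/
noncomputable def Tree.step [MeasurableSpace 𝒮] (Q : Params m D C 𝒮) (z : Feat D × Fin C) (u : Draw D) :
    Tree m D C 𝒮 → Tree m D C 𝒮
  | .leaf L => L.step Q z u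
  | .node d θ l r => if z.1 d ≤ θ then .node d θ (l.step Q z u) r else .node d θ l (r.step Q z u)

open Classical in
/-- The leaf `A(x)` that contains `x`. -/
noncomputable def Tree.leafAt (x : Feat D) : Tree m D C 𝒮 → Leaf m D C 𝒮
  | .leaf L => L
  | .node d θ l r => if x d ≤ θ then l.leafAt x else r.leafAt x

/-- The tree after the first `t` data points `z 0, …, z (t - 1)`; the root has candidate
dimensions `d₀`, and step `s` uses the random choices `u s`. -/
noncomputable def treeAt [MeasurableSpace 𝒮] (Q : Params m D C 𝒮) (d₀ : Finset (Fin D))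
    (z : ℕ → Feat D × Fin C) (u : ℕ → Draw D) : ℕ → Tree m D C 𝒮
  | 0 => .leaf (newLeaf Q.rule 0 d₀ (fun _ => 0) Q.rule.init)
  | t + 1 => (treeAt Q d₀ z u t).step Q (z t) (u t)

/-- The estimate `η_t^k(x)`: the fraction of class `k` among the estimation points counted in the
leaf containing `x` during its lifetime (`0` if there are none). -/
noncomputable def Tree.posteriorEst (T : Tree m D C 𝒮) (x : Feat D) (k : Fin C) : ℝ :=
  ((T.leafAt x).est k : ℝ) / ((T.leafAt x).numEst : ℝ)

/-- The tree classifier. -/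
noncomputable def Tree.classify [NeZero C] (T : Tree m D C 𝒮) (x : Feat D) : Fin C :=
  argmax (T.posteriorEst x)

/-- The forest classifier: the majority vote over the trees. -/
noncomputable def forestClassify [NeZero C] {M : ℕ} (T : Fin M → Tree m D C 𝒮) (x : Feat D) :
    Fin C :=
  argmax fun k => ((Finset.univ.filter fun j => (T j).classify x = k).card : ℝ)

end Update

end OnlineForest

/-!
# Consistency of online random forests

The excess risk of the forest is bounded by the `L¹`-errors of the class frequencies of its trees as
estimates of the posterior probabilities (`excessRisk_le`): the winner of the vote is the choice
of some tree, so the dependence between the trees plays no role. It remains to bound the error of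
one tree, whose root dimensions, data and random choices have the product law `histLaw`.

The error in a leaf with cell `A` is at most the deviation of its class frequency from
`P(Y = k | X ∈ A)` plus a bias, the deviation of the posterior from its mean over `A`
(`leaf_error_le`). The cells are random and depend on the estimation points through the times of
the splits, and the choice of the splits is adversarial. Both difficulties are met by
additive functionals `Tree.total`, sums over the leaves and inner nodes of a function of the node and
its cell. A point that arrives falls into a cell `A` with probability `P(X ∈ A)` and changes only the
leaf with that cell. Hence an additive functional is a supermartingale as soon as it does not
increase in mean at a single leaf (`lintegral_total_le`, `Leaf.setLIntegral_step_le`). Three such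
functionals carry the proof.

* *Depth.* A candidate child is null, in a cell that is not, with probability zero
  (`ae_allLeaves_not_degenerate`). Almost surely every cell and every candidate child of positive
  mass receives points of both streams infinitely often (`ae_frequently_niceCell`), so that a leaf
  is split eventually (`not_forall_unsplitStep`). Therefore the depth of the leaf at almost every
  point tends to infinity (`tendsto_shallowMass`).
* *Bias.* The impurity of a set `B` in a cell is the mass of the cell times the conditional variance
  of the indicator function of `B`. Splits do not increase it. With a probability bounded below a
  new leaf has `i` as its only candidate dimension and `m` candidate points each of which leaves a
  quarter of the mass on both sides; then every admissible choice decreases the impurity of the half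
  spaces in direction `i` substantially. As the total decrease is bounded
  (`lintegral_total_impurityDrop_le`) and the leaves become deep, the mean impurity of half
  spaces tends to zero (`tendsto_meanImpurity_halfSpace`). The sets with this property form a
  `σ`-algebra (`pureSets`), which consists of all Borel sets (`tendsto_meanImpurity`), and
  approximation by simple functions shows that the bias vanishes (`tendsto_meanBias_posterior`).
* *Estimation.* The exponential weights of the histograms of leaves and candidate children are
  supermartingales during the lifetime of the cells. Adding them over all cells, including those
  still to be created, costs a factor `2 m D` per depth (`lintegral_total_estPot_le`). A leaf of depth
  `d + 1` has received at least `α d` estimation points, so the probability of a deviation at this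
  depth is exponentially small in `α d`, and the sum over the depths converges because
  `d / α d → 0` (`tendsto_tsum_estFactor`).

`tendsto_meanError` puts the three parts together.
-/

namespace OnlineForest

section Measurability

variable {m D C : ℕ} {𝒮 : Type*} [MeasurableSpace 𝒮] {Ω Ω' : Type*} [MeasurableSpace Ω]
  [MeasurableSpace Ω']

/-! ### Measurable families of leaves, trees and cells -/

/-- A random leaf, all of whose entries are measurable. -/
structure MeasLeaf (L : Ω → Leaf m D C 𝒮) : Prop where
  depth : Measurable fun ω => (L ω).depth
  dims : Measurable fun ω => (L ω).dims
  num : Measurable fun ω => (L ω).num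
  pt : ∀ i, Measurable fun ω => (L ω).pt i
  est : ∀ k, Measurable fun ω => (L ω).est k
  candEst : ∀ S b k, Measurable fun ω => (L ω).candEst S b k
  stat : Measurable fun ω => (L ω).stat
  candStat : ∀ S b, Measurable fun ω => (L ω).candStat S b

/-- A random tree that is put together from measurable leaves and measurable nodes by finitely many
case distinctions over measurable events. There is no `σ`-algebra on the trees themselves: only
functions of trees are ever integrated. -/
inductive MeasTree : (Ω → Tree m D C 𝒮) → Prop
  | leaf {L : Ω → Leaf m D C 𝒮} (hL : MeasLeaf L) : MeasTree fun ω => .leaf (L ω)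
  | node {d : Ω → Fin D} {θ : Ω → ℝ} {l r : Ω → Tree m D C 𝒮} (hd : Measurable d)
      (hθ : Measurable θ) (hl : MeasTree l) (hr : MeasTree r) :
      MeasTree fun ω => .node (d ω) (θ ω) (l ω) (r ω)
  | ite {s : Ω → Prop} [DecidablePred s] {f g : Ω → Tree m D C 𝒮} (hs : MeasurableSet {ω | s ω})
      (hf : MeasTree f) (hg : MeasTree g) : MeasTree fun ω => if s ω then f ω else g ω

theorem MeasLeaf.comp {L : Ω → Leaf m D C 𝒮} (hL : MeasLeaf L) {g : Ω' → Ω} (hg : Measurable g) :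
    MeasLeaf fun ω => L (g ω) where
  depth := hL.depth.comp hg
  dims := hL.dims.comp hg
  num := hL.num.comp hg
  pt i := (hL.pt i).comp hg
  est k := (hL.est k).comp hg
  candEst S b k := (hL.candEst S b k).comp hg
  stat := hL.stat.comp hg
  candStat S b := (hL.candStat S b).comp hg

theorem MeasLeaf.ite {s : Ω → Prop} [DecidablePred s] {f g : Ω → Leaf m D C 𝒮}
    (hs : MeasurableSet {ω | s ω}) (hf : MeasLeaf f) (hg : MeasLeaf g) :
    MeasLeaf fun ω => if s ω then f ω else g ω where
  depth := by simp only [apply_ite]; exact Measurable.ite hs hf.depth hg.depth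
  dims := by simp only [apply_ite]; exact Measurable.ite hs hf.dims hg.dims
  num := by simp only [apply_ite]; exact Measurable.ite hs hf.num hg.num
  pt i := by
    simp only [apply_ite Leaf.pt, ite_apply]; exact Measurable.ite hs (hf.pt i) (hg.pt i)
  est k := by
    simp only [apply_ite Leaf.est, ite_apply]; exact Measurable.ite hs (hf.est k) (hg.est k)
  candEst S b k := by
    simp only [apply_ite Leaf.candEst, ite_apply]
    exact Measurable.ite hs (hf.candEst S b k) (hg.candEst S b k)
  stat := by simp only [apply_ite]; exact Measurable.ite hs hf.stat hg.stat
  candStat S b := by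
    simp only [apply_ite Leaf.candStat, ite_apply]
    exact Measurable.ite hs (hf.candStat S b) (hg.candStat S b)

theorem measurable_coord_const (d : Fin D) : Measurable fun x : Feat D => x d :=
  (measurable_pi_apply d).comp (WithLp.measurable_ofLp 2 _)

theorem measurable_coord {x : Ω → Feat D} {d : Ω → Fin D} (hx : Measurable x) (hd : Measurable d) :
    Measurable fun ω => x ω (d ω) := by
  have : Measurable fun q : Feat D × Fin D => q.1 q.2 :=
    measurable_from_prod_countable_left fun d => measurable_coord_const d
  exact this.comp (hx.prodMk hd)

theorem measurable_finset {ι : Type*} [Fintype ι] [DecidableEq ι] {V : Ω → Finset ι}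
    (h : ∀ i, MeasurableSet {ω | i ∈ V ω}) : Measurable V := by
  refine measurable_to_countable' fun W => ?_
  have : V ⁻¹' {W} = ⋂ i, {ω | i ∈ V ω ↔ i ∈ W} := by
    ext ω; simp [Finset.ext_iff]
  rw [this]
  refine MeasurableSet.iInter fun i => ?_
  by_cases hi : i ∈ W
  · exact (h i).congr (by ext; simp [hi])
  · exact (h i).compl.congr (by ext; simp [hi])

theorem MeasLeaf.measurableSet_isCand {L : Ω → Leaf m D C 𝒮} (hL : MeasLeaf L) (S : Cand m D) :
    MeasurableSet {ω | (L ω).IsCand S} := by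
  refine MeasurableSet.inter (measurableSet_lt measurable_const hL.num) ?_
  exact hL.dims (MeasurableSet.of_discrete (s := {V : Finset (Fin D) | S.2 ∈ V}))

theorem MeasLeaf.measurable_threshold {L : Ω → Leaf m D C 𝒮} (hL : MeasLeaf L) (S : Cand m D) :
    Measurable fun ω => (L ω).threshold S :=
  measurable_coord (hL.pt S.1) measurable_const

theorem MeasLeaf.measurableSet_inChild {L : Ω → Leaf m D C 𝒮} (hL : MeasLeaf L) (S : Cand m D)
    (b : Bool) {x : Ω → Feat D} (hx : Measurable x) :
    MeasurableSet {ω | (L ω).InChild S b (x ω)} := by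
  refine (hL.measurableSet_isCand S).inter (s₂ := {ω | b = true ↔ (L ω).threshold S < x ω S.2}) ?_
  have h : MeasurableSet {ω | (L ω).threshold S < x ω S.2} :=
    measurableSet_lt (hL.measurable_threshold S) (measurable_coord hx measurable_const)
  cases b
  · exact h.compl.congr (by ext; simp)
  · exact h.congr (by ext; simp)

theorem measurable_addLabel {h : Ω → Fin C → ℕ} {y : Ω → Fin C}
    (hh : ∀ k, Measurable fun ω => h ω k) (hy : Measurable y) (k : Fin C) :
    Measurable fun ω => addLabel (h ω) (y ω) k :=
  Measurable.ite (measurableSet_eq_fun measurable_const hy) ((hh k).add_const 1) (hh k)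

theorem MeasLeaf.newLeaf (R : SplitRule m D C 𝒮) {depth : Ω → ℕ} {dims : Ω → Finset (Fin D)}
    {est : Ω → Fin C → ℕ} {stat : Ω → 𝒮} (h₁ : Measurable depth) (h₂ : Measurable dims)
    (h₃ : ∀ k, Measurable fun ω => est ω k) (h₄ : Measurable stat) :
    MeasLeaf fun ω => newLeaf R (depth ω) (dims ω) (est ω) (stat ω) where
  depth := h₁
  dims := h₂
  num := measurable_const
  pt _ := measurable_const
  est := h₃
  candEst _ _ _ := measurable_const
  stat := h₄
  candStat _ _ := measurable_const

theorem MeasLeaf.addEstimation {L : Ω → Leaf m D C 𝒮} (hL : MeasLeaf L)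
    {z : Ω → Feat D × Fin C} (hz : Measurable z) :
    MeasLeaf fun ω => (L ω).addEstimation (z ω) where
  depth := hL.depth
  dims := hL.dims
  num := hL.num
  pt := hL.pt
  est k := measurable_addLabel hL.est hz.snd k
  candEst S b k := by
    simp only [Leaf.addEstimation, ite_apply]
    exact Measurable.ite (hL.measurableSet_inChild S b hz.fst)
      (measurable_addLabel (hL.candEst S b) hz.snd k) (hL.candEst S b k)
  stat := hL.stat
  candStat := hL.candStat

theorem MeasLeaf.addCandidate {L : Ω → Leaf m D C 𝒮} (hL : MeasLeaf L)
    {x : Ω → Feat D} (hx : Measurable x) : MeasLeaf fun ω => (L ω).addCandidate (x ω) := by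
  refine MeasLeaf.ite (measurableSet_lt hL.num measurable_const) ?_ hL
  refine ⟨hL.depth, hL.dims, hL.num.add_const 1, fun i => ?_, hL.est, hL.candEst, hL.stat,
    hL.candStat⟩
  exact Measurable.ite (measurableSet_eq_fun measurable_const hL.num) hx (hL.pt i)

theorem MeasLeaf.addStructure (R : SplitRule m D C 𝒮) {L : Ω → Leaf m D C 𝒮} (hL : MeasLeaf L)
    {z : Ω → Feat D × Fin C} (hz : Measurable z) :
    MeasLeaf fun ω => (L ω).addStructure R (z ω) where
  depth := hL.depth
  dims := hL.dims
  num := hL.num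
  pt := hL.pt
  est := hL.est
  candEst := hL.candEst
  stat := R.measurable_update.comp (hL.stat.prodMk hz)
  candStat S b := Measurable.ite (hL.measurableSet_inChild S b hz.fst)
    (R.measurable_update.comp ((hL.candStat S b).prodMk hz)) (hL.candStat S b)

theorem MeasLeaf.measurable_numEst {L : Ω → Leaf m D C 𝒮} (hL : MeasLeaf L) :
    Measurable fun ω => (L ω).numEst :=
  Finset.measurable_sum _ fun k _ => hL.est k

theorem MeasLeaf.measurable_validSplits (Q : Params m D C 𝒮) {L : Ω → Leaf m D C 𝒮}
    (hL : MeasLeaf L) : Measurable fun ω => (L ω).validSplits Q := by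
  refine measurable_finset fun S => ?_
  simp only [Leaf.validSplits, Finset.mem_filter, Finset.mem_univ, true_and]
  refine (hL.measurableSet_isCand S).inter ?_
  refine MeasurableSet.congr (MeasurableSet.iInter (ι := Bool) fun b => ?_)
    (Set.ofPred_forall _).symm
  refine measurableSet_le ((measurable_from_nat (f := Q.α)).comp hL.depth) ?_
  exact (measurable_from_nat (f := fun n : ℕ => (n : ℝ))).comp
    (Finset.measurable_sum _ fun k _ => hL.candEst S b k)

theorem MeasLeaf.measurable_stats {L : Ω → Leaf m D C 𝒮} (hL : MeasLeaf L) :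
    Measurable fun ω => ((L ω).stat, (L ω).candStat) :=
  hL.stat.prodMk (measurable_pi_lambda _ fun S => measurable_pi_lambda _ fun b => hL.candStat S b)

theorem MeasLeaf.measurableSet_splits (Q : Params m D C 𝒮) {L : Ω → Leaf m D C 𝒮}
    (hL : MeasLeaf L) : MeasurableSet {ω | (L ω).Splits Q} := by
  have hV := hL.measurable_validSplits Q
  refine MeasurableSet.inter ?_ (MeasurableSet.union ?_ ?_)
  · exact hV (MeasurableSet.of_discrete (s := {V : Finset (Cand m D) | V.Nonempty}))
  · have : {ω | Q.rule.shouldSplit (L ω).depth ((L ω).validSplits Q) ((L ω).stat, (L ω).candStat)}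
        = ⋃ (d : ℕ) (V : Finset (Cand m D)), ((fun ω => (L ω).depth) ⁻¹' {d}) ∩
          (((fun ω => (L ω).validSplits Q) ⁻¹' {V}) ∩
          {ω | Q.rule.shouldSplit d V ((L ω).stat, (L ω).candStat)}) := by
      ext ω; simp
    change MeasurableSet {ω | Q.rule.shouldSplit (L ω).depth ((L ω).validSplits Q)
      ((L ω).stat, (L ω).candStat)}
    rw [this]
    refine MeasurableSet.iUnion fun d => MeasurableSet.iUnion fun V => ?_
    exact (hL.depth (measurableSet_singleton d)).inter ((hV (measurableSet_singleton V)).inter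
      (hL.measurable_stats (Q.rule.measurableSet_shouldSplit d V)))
  · exact measurableSet_le ((measurable_from_nat (f := Q.β)).comp hL.depth)
      ((measurable_from_nat (f := fun n : ℕ => (n : ℝ))).comp hL.measurable_numEst)

theorem MeasLeaf.measurable_chosen (Q : Params m D C 𝒮) {L : Ω → Leaf m D C 𝒮}
    (hL : MeasLeaf L) : Measurable fun ω => (L ω).chosen Q := by
  have hV := hL.measurable_validSplits Q
  refine measurable_to_countable' fun S => ?_
  have : (fun ω => (L ω).chosen Q) ⁻¹' {S}
      = ⋃ (d : ℕ) (V : Finset (Cand m D)), ((fun ω => (L ω).depth) ⁻¹' {d}) ∩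
        (((fun ω => (L ω).validSplits Q) ⁻¹' {V}) ∩
        {ω | Q.rule.best d V ((L ω).stat, (L ω).candStat) = S}) := by
    ext ω; simp [Leaf.chosen]
  rw [this]
  refine MeasurableSet.iUnion fun d => MeasurableSet.iUnion fun V => ?_
  exact (hL.depth (measurableSet_singleton d)).inter ((hV (measurableSet_singleton V)).inter
    (hL.measurable_stats (Q.rule.measurableSet_best d V S)))

/-- Evaluation of a measurable family at a random index of a countable type. -/
theorem measurable_apply_countable {ι E : Type*} [Countable ι] [MeasurableSpace ι]
    [MeasurableSingletonClass ι] [MeasurableSpace E] {f : ι → Ω → E} {i : Ω → ι}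
    (hf : ∀ i, Measurable (f i)) (hi : Measurable i) : Measurable fun ω => f (i ω) ω :=
  (measurable_from_prod_countable_left (f := fun q : Ω × ι => f q.2 q.1) hf).comp
    (measurable_id.prodMk hi)

theorem MeasLeaf.trySplit (Q : Params m D C 𝒮) {L : Ω → Leaf m D C 𝒮} (hL : MeasLeaf L)
    {dl dr : Ω → Finset (Fin D)} (hdl : Measurable dl) (hdr : Measurable dr) :
    MeasTree fun ω => (L ω).trySplit Q (dl ω) (dr ω) := by
  classical
  have hc := hL.measurable_chosen Q
  refine MeasTree.ite (hL.measurableSet_splits Q) (.node (measurable_snd.comp hc) ?_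
    (.leaf (.newLeaf _ (hL.depth.add_const 1) hdl ?_ ?_))
    (.leaf (.newLeaf _ (hL.depth.add_const 1) hdr ?_ ?_))) (.leaf hL)
  · exact measurable_apply_countable (f := fun S ω => (L ω).threshold S)
      hL.measurable_threshold hc
  · exact fun k => measurable_apply_countable (f := fun S ω => (L ω).candEst S false k)
      (fun S => hL.candEst S false k) hc
  · exact measurable_apply_countable (f := fun S ω => (L ω).candStat S false)
      (fun S => hL.candStat S false) hc
  · exact fun k => measurable_apply_countable (f := fun S ω => (L ω).candEst S true k)
      (fun S => hL.candEst S true k) hc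
  · exact measurable_apply_countable (f := fun S ω => (L ω).candStat S true)
      (fun S => hL.candStat S true) hc

theorem MeasLeaf.step (Q : Params m D C 𝒮) {L : Ω → Leaf m D C 𝒮} (hL : MeasLeaf L)
    {z : Ω → Feat D × Fin C} (hz : Measurable z) {u : Ω → Draw D} (hu : Measurable u) :
    MeasTree fun ω => (L ω).step Q (z ω) (u ω) := by
  refine MeasTree.ite ?_ (.leaf (hL.addEstimation hz))
    (((hL.addCandidate hz.fst).addStructure Q.rule hz).trySplit Q hu.snd.fst hu.snd.snd)
  exact hu.fst (measurableSet_singleton true)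

theorem MeasTree.step (Q : Params m D C 𝒮) {T : Ω → Tree m D C 𝒮} (hT : MeasTree T)
    {z : Ω → Feat D × Fin C} (hz : Measurable z) {u : Ω → Draw D} (hu : Measurable u) :
    MeasTree fun ω => (T ω).step Q (z ω) (u ω) := by
  classical
  induction hT with
  | leaf hL => exact hL.step Q hz hu
  | node hd hθ hl hr ihl ihr =>
    exact MeasTree.ite (measurableSet_le (measurable_coord hz.fst hd) hθ)
      (.node hd hθ ihl hr) (.node hd hθ hl ihr)
  | ite hs _ _ hf hg =>
    convert MeasTree.ite hs hf hg using 2 with ω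
    split_ifs with h <;> simp only [h, if_true, if_false]

theorem MeasTree.leafAt {T : Ω → Tree m D C 𝒮} (hT : MeasTree T)
    {x : Ω → Feat D} (hx : Measurable x) : MeasLeaf fun ω => (T ω).leafAt (x ω) := by
  classical
  induction hT with
  | leaf hL => exact hL
  | node hd hθ _ _ hl hr =>
    exact MeasLeaf.ite (measurableSet_le (measurable_coord hx hd) hθ) hl hr
  | ite hs _ _ hf hg =>
    convert MeasLeaf.ite hs hf hg using 2 with ω
    split_ifs with h <;> simp only [h, if_true, if_false]

theorem MeasTree.treeAt (Q : Params m D C 𝒮) {d₀ : Ω → Finset (Fin D)}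
    {z : ℕ → Ω → Feat D × Fin C} {u : ℕ → Ω → Draw D} (hd : Measurable d₀)
    (hz : ∀ t, Measurable (z t)) (hu : ∀ t, Measurable (u t)) (t : ℕ) :
    MeasTree fun ω => treeAt Q (d₀ ω) (fun s => z s ω) (fun s => u s ω) t := by
  induction t with
  | zero =>
    exact .leaf (.newLeaf _ measurable_const hd (fun _ => measurable_const) measurable_const)
  | succ t ih => exact ih.step Q (hz t) (hu t)

/-- A random set of feature vectors that is jointly measurable. -/
def MeasCell (A : Ω → Set (Feat D)) : Prop := MeasurableSet {q : Ω × Feat D | q.2 ∈ A q.1}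

theorem MeasCell.inter {A B : Ω → Set (Feat D)} (hA : MeasCell A) (hB : MeasCell B) :
    MeasCell fun ω => A ω ∩ B ω :=
  MeasurableSet.inter hA hB

theorem MeasCell.const {B : Set (Feat D)} (hB : MeasurableSet B) : MeasCell fun _ : Ω => B :=
  measurable_snd hB

theorem MeasCell.le {d : Ω → Fin D} {θ : Ω → ℝ} (hd : Measurable d) (hθ : Measurable θ) :
    MeasCell fun ω => {x : Feat D | x (d ω) ≤ θ ω} :=
  measurableSet_le (measurable_coord measurable_snd (hd.comp measurable_fst))
    (hθ.comp measurable_fst)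

theorem MeasCell.gt {d : Ω → Fin D} {θ : Ω → ℝ} (hd : Measurable d) (hθ : Measurable θ) :
    MeasCell fun ω => {x : Feat D | θ ω < x (d ω)} :=
  measurableSet_lt (hθ.comp measurable_fst)
    (measurable_coord measurable_snd (hd.comp measurable_fst))

theorem MeasCell.measurable_measure {A : Ω → Set (Feat D)} (hA : MeasCell A)
    (ν : Measure (Feat D)) [SFinite ν] : Measurable fun ω => ν (A ω) :=
  measurable_measure_prodMk_left hA

theorem MeasCell.measurable_lintegral {A : Ω → Set (Feat D)} (hA : MeasCell A)
    (ν : Measure (Feat D)) [SFinite ν] {f : Ω × Feat D → ℝ≥0∞} (hf : Measurable f) :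
    Measurable fun ω => ∫⁻ x in A ω, f (ω, x) ∂ν := by
  have h : ∀ ω, ∫⁻ x in A ω, f (ω, x) ∂ν
      = ∫⁻ x, {q : Ω × Feat D | q.2 ∈ A q.1}.indicator f (ω, x) ∂ν := by
    intro ω
    exact (lintegral_indicator (measurable_prodMk_left hA) _).symm
  simp only [h]
  exact (hf.indicator hA).lintegral_prod_right'

end Measurability

section Total

variable {m D C : ℕ} {𝒮 : Type*}

/-! ### Additive functionals of a tree -/

/-- The sum of `φ` over the leaves and of `ψ` over the inner nodes of a tree with root cell `A`;
both are evaluated at the cell of the node. -/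
noncomputable def Tree.total (ψ : Set (Feat D) → ℝ≥0∞)
    (φ : Set (Feat D) → Leaf m D C 𝒮 → ℝ≥0∞) : Tree m D C 𝒮 → Set (Feat D) → ℝ≥0∞
  | .leaf L, A => φ A L
  | .node d θ l r, A => ψ A + (l.total ψ φ (A ∩ {x | x d ≤ θ}) + r.total ψ φ (A ∩ {x | θ < x d}))

/-- The property `I` holds for all leaves of the tree and their cells, if the root has cell `A`. -/
def Tree.AllLeaves (I : Set (Feat D) → Leaf m D C 𝒮 → Prop) : Tree m D C 𝒮 → Set (Feat D) → Prop
  | .leaf L, A => I A L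
  | .node d θ l r, A => l.AllLeaves I (A ∩ {x | x d ≤ θ}) ∧ r.AllLeaves I (A ∩ {x | θ < x d})

theorem Tree.total_mono {ψ ψ' : Set (Feat D) → ℝ≥0∞} {φ φ' : Set (Feat D) → Leaf m D C 𝒮 → ℝ≥0∞}
    {I : Set (Feat D) → Leaf m D C 𝒮 → Prop} (hψ : ∀ A, ψ A ≤ ψ' A)
    (hφ : ∀ A L, I A L → φ A L ≤ φ' A L) (T : Tree m D C 𝒮) (A : Set (Feat D))
    (hT : T.AllLeaves I A) : T.total ψ φ A ≤ T.total ψ' φ' A := by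
  induction T generalizing A with
  | leaf L => exact hφ A L hT
  | node d θ l r hl hr => exact add_le_add (hψ A) (add_le_add (hl _ hT.1) (hr _ hT.2))

theorem Tree.total_add (ψ ψ' : Set (Feat D) → ℝ≥0∞) (φ φ' : Set (Feat D) → Leaf m D C 𝒮 → ℝ≥0∞)
    (T : Tree m D C 𝒮) (A : Set (Feat D)) :
    T.total (fun A => ψ A + ψ' A) (fun A L => φ A L + φ' A L) A
      = T.total ψ φ A + T.total ψ' φ' A := by
  induction T generalizing A with
  | leaf L => rfl
  | node d θ l r hl hr => simp only [Tree.total, hl, hr]; ring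

theorem Tree.total_const_mul (c : ℝ≥0∞) (ψ : Set (Feat D) → ℝ≥0∞)
    (φ : Set (Feat D) → Leaf m D C 𝒮 → ℝ≥0∞) (T : Tree m D C 𝒮) (A : Set (Feat D)) :
    T.total (fun A => c * ψ A) (fun A L => c * φ A L) A = c * T.total ψ φ A := by
  induction T generalizing A with
  | leaf L => rfl
  | node d θ l r hl hr => simp only [Tree.total, hl, hr]; ring

theorem Tree.AllLeaves.mono {I J : Set (Feat D) → Leaf m D C 𝒮 → Prop} (h : ∀ A L, I A L → J A L)
    {T : Tree m D C 𝒮} {A : Set (Feat D)} (hT : T.AllLeaves I A) : T.AllLeaves J A := by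
  induction T generalizing A with
  | leaf L => exact h A L hT
  | node d θ l r hl hr => exact ⟨hl hT.1, hr hT.2⟩

theorem Tree.allLeaves_of_forall {I : Set (Feat D) → Leaf m D C 𝒮 → Prop} (h : ∀ A L, I A L)
    (T : Tree m D C 𝒮) (A : Set (Feat D)) : T.AllLeaves I A := by
  induction T generalizing A with
  | leaf L => exact h A L
  | node d θ l r hl hr => exact ⟨hl _, hr _⟩

theorem inter_le_union_inter_gt (A : Set (Feat D)) (d : Fin D) (θ : ℝ) :
    A = (A ∩ {x | x d ≤ θ}) ∪ (A ∩ {x | θ < x d}) := by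
  rw [← Set.inter_union_distrib_left]
  exact (Set.inter_eq_left.2 fun x _ => le_or_gt (x d) θ).symm

theorem disjoint_inter_le_inter_gt (A : Set (Feat D)) (d : Fin D) (θ : ℝ) :
    Disjoint (A ∩ {x | x d ≤ θ}) (A ∩ {x | θ < x d}) :=
  Set.disjoint_left.2 fun x h h' => absurd (show x d ≤ θ from h.2) (not_le.2 h'.2)

theorem measurableSet_coord_le (d : Fin D) (θ : ℝ) : MeasurableSet {x : Feat D | x d ≤ θ} :=
  measurableSet_le (measurable_coord_const d) measurable_const

theorem measurableSet_coord_gt (d : Fin D) (θ : ℝ) : MeasurableSet {x : Feat D | θ < x d} :=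
  measurableSet_lt measurable_const (measurable_coord_const d)

/-- The integral of a function of a point and its leaf is an additive functional of the tree. -/
theorem Tree.setLIntegral_eq_total (ν : Measure (Feat D)) (g : Leaf m D C 𝒮 → Feat D → ℝ≥0∞)
    (T : Tree m D C 𝒮) {A : Set (Feat D)} (hA : MeasurableSet A) :
    ∫⁻ x in A, g (T.leafAt x) x ∂ν = T.total (fun _ => 0) (fun A L => ∫⁻ x in A, g L x ∂ν) A := by
  induction T generalizing A with
  | leaf L => rfl
  | node d θ l r hl hr =>
    have h₁ := hA.inter (measurableSet_coord_le d θ)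
    have h₂ := hA.inter (measurableSet_coord_gt d θ)
    simp only [Tree.total, zero_add]
    conv_lhs => rw [inter_le_union_inter_gt A d θ]
    rw [lintegral_union h₂ (disjoint_inter_le_inter_gt A d θ), ← hl h₁, ← hr h₂]
    congr 1
    · refine setLIntegral_congr_fun h₁ fun x hx => ?_
      have : x d ≤ θ := hx.2
      simp [Tree.leafAt, this]
    · refine setLIntegral_congr_fun h₂ fun x hx => ?_
      have : ¬ x d ≤ θ := not_le.2 hx.2
      simp [Tree.leafAt, this]

variable [MeasurableSpace 𝒮] {Ω : Type*} [MeasurableSpace Ω]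

/-- A function of a leaf and its cell that is measurable along measurable families. -/
def MeasPot (Ω : Type*) [MeasurableSpace Ω] (φ : Set (Feat D) → Leaf m D C 𝒮 → ℝ≥0∞) : Prop :=
  ∀ (L : Ω → Leaf m D C 𝒮) (A : Ω → Set (Feat D)), MeasLeaf L → MeasCell A →
    Measurable fun ω => φ (A ω) (L ω)

theorem MeasTree.measurable_total {ψ : Set (Feat D) → ℝ≥0∞}
    {φ : Set (Feat D) → Leaf m D C 𝒮 → ℝ≥0∞}
    (hψ : ∀ A : Ω → Set (Feat D), MeasCell A → Measurable fun ω => ψ (A ω)) (hφ : MeasPot Ω φ)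
    {T : Ω → Tree m D C 𝒮} (hT : MeasTree T) {A : Ω → Set (Feat D)} (hA : MeasCell A) :
    Measurable fun ω => (T ω).total ψ φ (A ω) := by
  induction hT generalizing A with
  | leaf hL => exact hφ _ _ hL hA
  | node hd hθ _ _ hl hr =>
    exact (hψ A hA).add ((hl (hA.inter (.le hd hθ))).add (hr (hA.inter (.gt hd hθ))))
  | @ite s _ f g hs _ _ hf hg =>
    have h : (fun ω => Tree.total ψ φ (if s ω then f ω else g ω) (A ω))
        = fun ω => if s ω then Tree.total ψ φ (f ω) (A ω) else Tree.total ψ φ (g ω) (A ω) := by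
      funext ω
      split_ifs <;> rfl
    rw [h]
    exact Measurable.ite hs (hf hA) (hg hA)

end Total

/-! ### The law of the data and of the random choices of one tree -/

instance (D : ℕ) (rate : ℝ≥0) : IsProbabilityMeasure (dimsLaw D rate) := by
  unfold dimsLaw
  exact isProbabilityMeasure_bind measurable_from_nat.aemeasurable
    (Eventually.of_forall fun k => inferInstance)

instance (D : ℕ) (p : unitInterval) (rate : ℝ≥0) : IsProbabilityMeasure (drawLaw D p rate) := by
  unfold drawLaw; infer_instance

/-- What one tree observes at one time step: the data point and its own random choices. -/
abbrev Obs (D C : ℕ) : Type := (Feat D × Fin C) × Draw D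

/-- The law of an observation of one time step. -/
noncomputable abbrev obsLaw {D C : ℕ} (P : Measure (Feat D × Fin C)) (p : unitInterval)
    (rate : ℝ≥0) : Measure (Obs D C) := P.prod (drawLaw D p rate)

/-- All that one tree observes: the root dimensions and the sequence of observations. -/
abbrev Hist (D C : ℕ) : Type := Finset (Fin D) × (ℕ → Obs D C)

/-- The law of all that one tree observes. -/
noncomputable def histLaw {D C : ℕ} (P : Measure (Feat D × Fin C)) [IsProbabilityMeasure P]
    (p : unitInterval) (rate : ℝ≥0) : Measure (Hist D C) :=
  (dimsLaw D rate).prod (Measure.infinitePi fun _ : ℕ => obsLaw P p rate)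

instance {D C : ℕ} (P : Measure (Feat D × Fin C)) [IsProbabilityMeasure P]
    (p : unitInterval) (rate : ℝ≥0) : IsProbabilityMeasure (histLaw P p rate) := by
  unfold histLaw; infer_instance

/-- The tree at time `t` as a function of the observations. -/
noncomputable def histTree {m D C : ℕ} {𝒮 : Type*} [MeasurableSpace 𝒮] (Q : Params m D C 𝒮)
    (h : Hist D C) (t : ℕ) : Tree m D C 𝒮 :=
  treeAt Q h.1 (fun s => (h.2 s).1) (fun s => (h.2 s).2) t

/-- The observation of time `t` is replaced by `e`. -/
def Hist.update {D C : ℕ} (h : Hist D C) (t : ℕ) (e : Obs D C) : Hist D C :=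
  (h.1, Function.update h.2 t e)

/-- Replacing one term of an i.i.d. sequence by an independent copy does not change the law of the
sequence. This expresses that the next observation is independent of the past. -/
theorem measurePreserving_update_infinitePi {E : Type*} [MeasurableSpace E] (κ : Measure E)
    [IsProbabilityMeasure κ] (t : ℕ) :
    MeasurePreserving (fun q : (ℕ → E) × E => Function.update q.1 t q.2)
      ((Measure.infinitePi fun _ : ℕ => κ).prod κ) (Measure.infinitePi fun _ : ℕ => κ) := by
  have hm : Measurable fun q : (ℕ → E) × E => Function.update q.1 t q.2 := by
    refine measurable_pi_lambda _ fun s => ?_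
    by_cases hs : s = t
    · subst hs; simpa using measurable_snd
    · simpa [Function.update_of_ne hs] using measurable_fst.eval (a := s)
  refine ⟨hm, Measure.eq_infinitePi _ fun s B hB => ?_⟩
  rw [Measure.map_apply hm (MeasurableSet.pi s.countable_toSet fun i _ => hB i)]
  by_cases ht : t ∈ s
  · have : (fun q : (ℕ → E) × E => Function.update q.1 t q.2) ⁻¹' ((s : Set ℕ).pi B)
        = (((s.erase t : Finset ℕ) : Set ℕ).pi B) ×ˢ (B t) := by
      ext q
      simp only [Set.mem_preimage, Set.mem_pi, Set.mem_prod, Finset.coe_erase, Finset.mem_coe,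
        Set.mem_sdiff, Set.mem_singleton_iff]
      constructor
      · refine fun h => ⟨fun i hi => ?_, by simpa using h t ht⟩
        simpa [Function.update_of_ne hi.2] using h i hi.1
      · rintro ⟨h1, h2⟩ i hi
        by_cases hit : i = t
        · subst hit; simpa using h2
        · simpa [Function.update_of_ne hit] using h1 i ⟨hi, hit⟩
    rw [this, Measure.prod_prod, Measure.infinitePi_pi _ fun i _ => hB i,
      Finset.prod_erase_mul _ _ ht]
  · have : (fun q : (ℕ → E) × E => Function.update q.1 t q.2) ⁻¹' ((s : Set ℕ).pi B)
        = ((s : Set ℕ).pi B) ×ˢ Set.univ := by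
      ext q
      simp only [Set.mem_preimage, Set.mem_pi, Set.mem_prod, Finset.mem_coe, Set.mem_univ,
        and_true]
      refine forall₂_congr fun i hi => ?_
      rw [Function.update_of_ne (fun h : i = t => ht (h ▸ hi))]
    rw [this, Measure.prod_prod, Measure.infinitePi_pi _ fun i _ => hB i, measure_univ, mul_one]

section

variable {m D C : ℕ} {𝒮 : Type*} [MeasurableSpace 𝒮] (Q : Params m D C 𝒮)

theorem histTree_measTree {Ω : Type*} [MeasurableSpace Ω] {h : Ω → Hist D C} (hh : Measurable h)
    (t : ℕ) : MeasTree fun ω => histTree Q (h ω) t :=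
  MeasTree.treeAt Q hh.fst (fun s => ((measurable_pi_apply s).comp hh.snd).fst)
    (fun s => ((measurable_pi_apply s).comp hh.snd).snd) t

theorem histTree_succ (h : Hist D C) (t : ℕ) :
    histTree Q h (t + 1) = (histTree Q h t).step Q (h.2 t).1 (h.2 t).2 := rfl

theorem histTree_update (h : Hist D C) (e : Obs D C) {s t : ℕ} (hst : s ≤ t) :
    histTree Q (h.update t e) s = histTree Q h s := by
  induction s with
  | zero => rfl
  | succ s ih =>
    rw [histTree_succ, histTree_succ, ih (by omega)]
    simp only [Hist.update]
    rw [Function.update_of_ne (by omega : s ≠ t)]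

theorem histTree_update_succ (h : Hist D C) (e : Obs D C) (t : ℕ) :
    histTree Q (h.update t e) (t + 1) = (histTree Q h t).step Q e.1 e.2 := by
  rw [histTree_succ, histTree_update Q h e le_rfl]
  simp [Hist.update]

variable (P : Measure (Feat D × Fin C)) [IsProbabilityMeasure P] (p : unitInterval) (rate : ℝ≥0)

theorem measurePreserving_hist_update (t : ℕ) :
    MeasurePreserving (fun q : Hist D C × Obs D C => q.1.update t q.2)
      ((histLaw P p rate).prod (obsLaw P p rate)) (histLaw P p rate) := by
  have h₁ := measurePreserving_prodAssoc (dimsLaw D rate)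
    (Measure.infinitePi fun _ : ℕ => obsLaw P p rate) (obsLaw P p rate)
  have h₂ := (MeasurePreserving.id (dimsLaw D rate)).prod
    (measurePreserving_update_infinitePi (obsLaw P p rate) t)
  exact h₂.comp h₁

/-- The observation of time `t` can be integrated out first. -/
theorem lintegral_histLaw_update (t : ℕ) {f : Hist D C → ℝ≥0∞} (hf : Measurable f) :
    ∫⁻ h, f h ∂histLaw P p rate
      = ∫⁻ h, ∫⁻ e, f (h.update t e) ∂obsLaw P p rate ∂histLaw P p rate := by
  have h := measurePreserving_hist_update P p rate t
  rw [← h.lintegral_comp hf]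
  exact lintegral_prod _ (hf.comp h.measurable).aemeasurable

/-! ### Supermartingales of the growing tree -/

theorem Tree.AllLeaves.step {I : Set (Feat D) → Leaf m D C 𝒮 → Prop}
    (hI : ∀ A L z u, MeasurableSet A → I A L → z.1 ∈ A → (L.step Q z u).AllLeaves I A)
    {T : Tree m D C 𝒮} {A : Set (Feat D)} (hA : MeasurableSet A) (hT : T.AllLeaves I A)
    {z : Feat D × Fin C} (hz : z.1 ∈ A) (u : Draw D) : (T.step Q z u).AllLeaves I A := by
  induction T generalizing A with
  | leaf L => exact hI A L z u hA hT hz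
  | node d θ l r hl hr =>
    simp only [Tree.step]
    split_ifs with h
    · exact ⟨hl (hA.inter (measurableSet_coord_le d θ)) hT.1 ⟨hz, h⟩, hT.2⟩
    · exact ⟨hT.1, hr (hA.inter (measurableSet_coord_gt d θ)) hT.2 ⟨hz, not_le.1 h⟩⟩

theorem histTree_allLeaves {I : Set (Feat D) → Leaf m D C 𝒮 → Prop}
    (hI0 : ∀ d₀, I Set.univ (newLeaf Q.rule 0 d₀ (fun _ => 0) Q.rule.init))
    (hI : ∀ A L z u, MeasurableSet A → I A L → z.1 ∈ A → (L.step Q z u).AllLeaves I A)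
    (h : Hist D C) (t : ℕ) : (histTree Q h t).AllLeaves I Set.univ := by
  induction t with
  | zero => exact hI0 _
  | succ t ih => exact ih.step Q hI MeasurableSet.univ (Set.mem_univ _) _

/-- The event that the data point of an observation falls in `A`. -/
def obsIn (C : ℕ) {D : ℕ} (A : Set (Feat D)) : Set (Obs D C) := {e | e.1.1 ∈ A}

theorem measurableSet_obsIn {A : Set (Feat D)} (hA : MeasurableSet A) :
    MeasurableSet (obsIn C A) :=
  (measurable_fst.comp measurable_fst) hA

theorem obsLaw_obsIn {A : Set (Feat D)} (hA : MeasurableSet A) :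
    obsLaw P p rate (obsIn C A) = P.fst A := by
  have : obsIn C A = (Prod.fst ⁻¹' A : Set (Feat D × Fin C)) ×ˢ (Set.univ : Set (Draw D)) := by
    ext e; simp [obsIn]
  rw [this, Measure.prod_prod, measure_univ, mul_one, Measure.fst_apply hA]

/-- If one step does not increase the expected contribution of any leaf, then it does not
increase the expected value of an additive functional. -/
theorem Tree.setLIntegral_step_le {ψ : Set (Feat D) → ℝ≥0∞}
    {φ : Set (Feat D) → Leaf m D C 𝒮 → ℝ≥0∞} {I : Set (Feat D) → Leaf m D C 𝒮 → Prop}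
    (hleaf : ∀ A L, MeasurableSet A → I A L →
      ∫⁻ e in obsIn C A, (L.step Q e.1 e.2).total ψ φ A ∂obsLaw P p rate ≤ P.fst A * φ A L)
    (T : Tree m D C 𝒮) {A : Set (Feat D)} (hA : MeasurableSet A) (hT : T.AllLeaves I A) :
    ∫⁻ e in obsIn C A, (T.step Q e.1 e.2).total ψ φ A ∂obsLaw P p rate
      ≤ P.fst A * T.total ψ φ A := by
  induction T generalizing A with
  | leaf L => exact hleaf A L hA hT
  | node d θ l r hl hr =>
    have h₁ := hA.inter (measurableSet_coord_le d θ)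
    have h₂ := hA.inter (measurableSet_coord_gt d θ)
    set A₁ := A ∩ {x | x d ≤ θ} with hA₁
    set A₂ := A ∩ {x | θ < x d} with hA₂
    have hd : Disjoint A₁ A₂ := disjoint_inter_le_inter_gt A d θ
    have hu : obsIn C A = obsIn C A₁ ∪ obsIn C A₂ := by
      ext e
      have := Set.ext_iff.1 (inter_le_union_inter_gt A d θ) e.1.1
      simpa [obsIn, A₁, A₂] using this
    have hd' : Disjoint (obsIn C A₁) (obsIn C A₂) :=
      Set.disjoint_left.2 fun e h h' => Set.disjoint_left.1 hd h h'
    have hmass : P.fst A = P.fst A₁ + P.fst A₂ := by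
      rw [← measure_union hd h₂, ← inter_le_union_inter_gt A d θ]
    have e₁ : ∫⁻ e in obsIn C A₁, ((Tree.node d θ l r).step Q e.1 e.2).total ψ φ A ∂obsLaw P p rate
        = ∫⁻ e in obsIn C A₁, (l.step Q e.1 e.2).total ψ φ A₁ ∂obsLaw P p rate
          + P.fst A₁ * (ψ A + r.total ψ φ A₂) := by
      rw [← obsLaw_obsIn P p rate h₁, mul_comm, ← setLIntegral_const,
        ← lintegral_add_right _ measurable_const]
      refine setLIntegral_congr_fun (measurableSet_obsIn h₁) fun e he => ?_
      have : e.1.1 d ≤ θ := he.2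
      simp only [Tree.step, this, if_true, Tree.total]
      ring
    have e₂ : ∫⁻ e in obsIn C A₂, ((Tree.node d θ l r).step Q e.1 e.2).total ψ φ A ∂obsLaw P p rate
        = ∫⁻ e in obsIn C A₂, (r.step Q e.1 e.2).total ψ φ A₂ ∂obsLaw P p rate
          + P.fst A₂ * (ψ A + l.total ψ φ A₁) := by
      rw [← obsLaw_obsIn P p rate h₂, mul_comm, ← setLIntegral_const,
        ← lintegral_add_right _ measurable_const]
      refine setLIntegral_congr_fun (measurableSet_obsIn h₂) fun e he => ?_
      have : ¬ e.1.1 d ≤ θ := not_le.2 he.2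
      simp only [Tree.step, this, if_false, Tree.total]
      ring
    rw [hu, lintegral_union (measurableSet_obsIn h₂) hd', e₁, e₂, hmass]
    calc _ ≤ (P.fst A₁ * l.total ψ φ A₁ + P.fst A₁ * (ψ A + r.total ψ φ A₂))
          + (P.fst A₂ * r.total ψ φ A₂ + P.fst A₂ * (ψ A + l.total ψ φ A₁)) := by
          gcongr
          · exact hl h₁ hT.1
          · exact hr h₂ hT.2
      _ = _ := by simp only [Tree.total, ← hA₁, ← hA₂]; ring

/-- An additive functional whose expected value does not increase in one step is bounded in
mean by its initial value at all times. -/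
theorem lintegral_total_le {ψ : Set (Feat D) → ℝ≥0∞}
    {φ : Set (Feat D) → Leaf m D C 𝒮 → ℝ≥0∞} {I : Set (Feat D) → Leaf m D C 𝒮 → Prop}
    (hI0 : ∀ d₀, I Set.univ (newLeaf Q.rule 0 d₀ (fun _ => 0) Q.rule.init))
    (hI : ∀ A L z u, MeasurableSet A → I A L → z.1 ∈ A → (L.step Q z u).AllLeaves I A)
    (hψ : ∀ A : Hist D C → Set (Feat D), MeasCell A → Measurable fun ω => ψ (A ω))
    (hφ : MeasPot (Hist D C) φ)
    (hleaf : ∀ A L, MeasurableSet A → I A L →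
      ∫⁻ e in obsIn C A, (L.step Q e.1 e.2).total ψ φ A ∂obsLaw P p rate ≤ P.fst A * φ A L)
    (t : ℕ) :
    ∫⁻ h, (histTree Q h t).total ψ φ Set.univ ∂histLaw P p rate
      ≤ ∫⁻ d₀, φ Set.univ (newLeaf Q.rule 0 d₀ (fun _ => 0) Q.rule.init) ∂dimsLaw D rate := by
  have hmeas : ∀ t, Measurable fun h : Hist D C => (histTree Q h t).total ψ φ Set.univ := fun t =>
    (histTree_measTree Q measurable_id t).measurable_total hψ hφ (.const MeasurableSet.univ)
  induction t with
  | zero =>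
    have hm : Measurable fun d₀ : Finset (Fin D) =>
      φ Set.univ (newLeaf Q.rule 0 d₀ (fun _ => 0) Q.rule.init) := Measurable.of_discrete
    have := (measurePreserving_fst (μ := dimsLaw D rate)
      (ν := Measure.infinitePi fun _ : ℕ => obsLaw P p rate)).lintegral_comp hm
    rw [← this]
    exact le_of_eq rfl
  | succ t ih =>
    rw [lintegral_histLaw_update P p rate t (hmeas (t + 1))]
    refine le_trans (lintegral_mono fun h => ?_) ih
    have h1 := Tree.setLIntegral_step_le Q P p rate hleaf (histTree Q h t) MeasurableSet.univ
      (histTree_allLeaves Q hI0 hI h t)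
    have h2 : obsIn C (Set.univ : Set (Feat D)) = Set.univ := by ext; simp [obsIn]
    rw [h2, Measure.restrict_univ, measure_univ, one_mul] at h1
    simpa only [histTree_update_succ] using h1

/-- Criterion for an additive functional not to increase in mean at a leaf: it suffices to
consider separately an estimation point, a structure point that leads to no split, and
a split. -/
theorem Leaf.setLIntegral_step_le {ψ : Set (Feat D) → ℝ≥0∞}
    {φ : Set (Feat D) → Leaf m D C 𝒮 → ℝ≥0∞} (hφ : MeasPot (Feat D × Fin C) φ)
    {A : Set (Feat D)} (hA : MeasurableSet A) {L : Leaf m D C 𝒮}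
    (hest : ∫⁻ z in Prod.fst ⁻¹' A, φ A (L.addEstimation z) ∂P ≤ P.fst A * φ A L)
    (hstr : ∫⁻ z in Prod.fst ⁻¹' A, φ A ((L.addCandidate z.1).addStructure Q.rule z) ∂P
      ≤ P.fst A * φ A L)
    (hsplit : ∀ z : Feat D × Fin C, z.1 ∈ A → ∀ L', L' = (L.addCandidate z.1).addStructure Q.rule z →
      ∀ S, S ∈ L'.validSplits Q →
      ∫⁻ dl, ∫⁻ dr, (ψ A +
        (φ (A ∩ {x | x S.2 ≤ L'.threshold S}) (newLeaf Q.rule (L'.depth + 1) dl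
          (L'.candEst S false) (L'.candStat S false))
        + φ (A ∩ {x | L'.threshold S < x S.2}) (newLeaf Q.rule (L'.depth + 1) dr
          (L'.candEst S true) (L'.candStat S true)))) ∂dimsLaw D rate ∂dimsLaw D rate
        ≤ φ A L') :
    ∫⁻ e in obsIn C A, (L.step Q e.1 e.2).total ψ φ A ∂obsLaw P p rate ≤ P.fst A * φ A L := by
  classical
  have hA' : MeasurableSet (Prod.fst ⁻¹' A : Set (Feat D × Fin C)) := measurable_fst hA
  have hset : obsIn C A = (Prod.fst ⁻¹' A : Set (Feat D × Fin C)) ×ˢ (Set.univ : Set (Draw D)) := by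
    ext e; simp [obsIn]
  set a : ℝ≥0∞ := bernoulliMeasure true false p {true}
  set b : ℝ≥0∞ := bernoulliMeasure true false p {false}
  have hab : a + b = 1 := by
    rw [← measure_univ (μ := bernoulliMeasure true false p),
      ← measure_union (by simp) (measurableSet_singleton _)]
    congr 1
    ext x; cases x <;> simp
  have hdraw : ∀ z : Feat D × Fin C, z.1 ∈ A →
      ∫⁻ u, (L.step Q z u).total ψ φ A ∂drawLaw D p rate
        ≤ a * φ A (L.addEstimation z)
          + b * φ A ((L.addCandidate z.1).addStructure Q.rule z) := by
    intro z hz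
    set L' := (L.addCandidate z.1).addStructure Q.rule z with hL'
    refine (lintegral_prod_le _).trans ?_
    have hb : ∀ f : Bool → ℝ≥0∞, ∫⁻ x, f x ∂bernoulliMeasure true false p
        = a * f true + b * f false := by
      intro f
      rw [lintegral_fintype]
      simp only [Fintype.univ_bool, Finset.sum_insert, Finset.mem_singleton, Bool.true_eq_false,
        not_false_eq_true, Finset.sum_singleton, a, b]
      ring
    rw [hb]
    refine add_le_add (mul_le_mul_right ?_ _) (mul_le_mul_right ?_ _)
    · simp only [Leaf.step, if_true, Tree.total, lintegral_const, measure_univ, mul_one]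
      exact le_rfl
    · simp only [Leaf.step, Bool.false_eq_true, if_false, ← hL']
      refine (lintegral_prod_le _).trans ?_
      by_cases hs : L'.Splits Q
      · have hmem : L'.chosen Q ∈ L'.validSplits Q := Q.rule.best_mem _ _ _ hs.1
        simp only [Leaf.trySplit, hs, if_true, Tree.total]
        exact hsplit z hz L' rfl _ hmem
      · simp only [Leaf.trySplit, hs, if_false, Tree.total, lintegral_const, measure_univ, mul_one]
        exact le_rfl
  have hm : Measurable fun z : Feat D × Fin C => a * φ A (L.addEstimation z) := by
    refine Measurable.const_mul (hφ _ _ (MeasLeaf.addEstimation ?_ measurable_id) (.const hA)) _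
    constructor <;> intros <;> exact measurable_const
  have hbtop : b ≠ ∞ := measure_ne_top _ _
  have hatop : a ≠ ∞ := measure_ne_top _ _
  calc ∫⁻ e in obsIn C A, (L.step Q e.1 e.2).total ψ φ A ∂obsLaw P p rate
      ≤ ∫⁻ z in Prod.fst ⁻¹' A, ∫⁻ u, (L.step Q z u).total ψ φ A ∂drawLaw D p rate ∂P := by
        rw [hset, obsLaw, ← Measure.prod_restrict, Measure.restrict_univ]
        exact lintegral_prod_le _
    _ ≤ ∫⁻ z in Prod.fst ⁻¹' A, (a * φ A (L.addEstimation z)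
          + b * φ A ((L.addCandidate z.1).addStructure Q.rule z)) ∂P :=
        setLIntegral_mono' hA' fun z hz => hdraw z hz
    _ = a * ∫⁻ z in Prod.fst ⁻¹' A, φ A (L.addEstimation z) ∂P
        + b * ∫⁻ z in Prod.fst ⁻¹' A, φ A ((L.addCandidate z.1).addStructure Q.rule z) ∂P := by
        rw [lintegral_add_left hm, lintegral_const_mul' _ _ hatop, lintegral_const_mul' _ _ hbtop]
    _ ≤ a * (P.fst A * φ A L) + b * (P.fst A * φ A L) := by gcongr
    _ = P.fst A * φ A L := by rw [← add_mul, hab, one_mul]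

/-! ### Invariants of the leaves -/

/-- The interior of the set has full measure in it. All cells of a tree have this property. If it
has positive mass, such a set contains a set of positive mass from a countable topological basis;
so countably many events suffice to ensure that all cells of positive mass keep receiving
points. -/
def NiceCell (ν : Measure (Feat D)) (A : Set (Feat D)) : Prop :=
  MeasurableSet A ∧ ν (A \ interior A) = 0

/-- Bookkeeping invariants of a leaf: the histograms of candidate splits that have not been created
are empty, and a leaf of depth `d + 1` has received at least `α d` estimation points. -/
structure Leaf.Wf (L : Leaf m D C 𝒮) : Prop where
  candEst_eq_zero : ∀ S b, ¬ L.IsCand S → L.candEst S b = 0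
  le_numEst : ∀ d, L.depth = d + 1 → Q.α d ≤ L.numEst

/-- The invariant of all leaves and their cells. -/
def LeafInv (ν : Measure (Feat D)) (A : Set (Feat D)) (L : Leaf m D C 𝒮) : Prop :=
  NiceCell ν A ∧ L.Wf Q

theorem NiceCell.inter_le {ν : Measure (Feat D)} (hν : ∀ d θ, ν {x : Feat D | x d = θ} = 0)
    {A : Set (Feat D)} (hA : NiceCell ν A) (d : Fin D) (θ : ℝ) :
    NiceCell ν (A ∩ {x | x d ≤ θ}) := by
  refine ⟨hA.1.inter (measurableSet_coord_le d θ), measure_mono_null (fun x hx => ?_)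
    (measure_union_null hA.2 (hν d θ))⟩
  by_contra h
  have h1 : x ∈ interior A := by
    by_contra h'
    exact h (Or.inl ⟨hx.1.1, h'⟩)
  have h2 : x d < θ := lt_of_le_of_ne hx.1.2 fun h' => h (Or.inr h')
  refine hx.2 (mem_interior.2 ⟨interior A ∩ {x | x d < θ}, fun y hy => ?_, ?_, h1, h2⟩)
  · exact ⟨interior_subset hy.1, le_of_lt (show y d < θ from hy.2)⟩
  · exact isOpen_interior.inter (isOpen_lt (by fun_prop) continuous_const)

theorem NiceCell.inter_gt {ν : Measure (Feat D)} {A : Set (Feat D)} (hA : NiceCell ν A) (d : Fin D)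
    (θ : ℝ) : NiceCell ν (A ∩ {x | θ < x d}) := by
  refine ⟨hA.1.inter (measurableSet_coord_gt d θ), measure_mono_null (fun x hx => ?_) hA.2⟩
  refine ⟨hx.1.1, fun h1 => ?_⟩
  refine hx.2 (mem_interior.2 ⟨interior A ∩ {x | θ < x d}, fun y hy => ?_, ?_, h1, hx.1.2⟩)
  · exact ⟨interior_subset hy.1, hy.2⟩
  · exact isOpen_interior.inter (isOpen_lt continuous_const (by fun_prop))

theorem sum_addLabel (h : Fin C → ℕ) (y : Fin C) : ∑ k, addLabel h y k = ∑ k, h k + 1 := by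
  have : ∀ k, addLabel h y k = h k + if k = y then 1 else 0 := by
    intro k; unfold addLabel; split_ifs <;> rfl
  simp [this, Finset.sum_add_distrib]

variable {Q}

theorem Leaf.addCandidate_depth (L : Leaf m D C 𝒮) (x : Feat D) :
    (L.addCandidate x).depth = L.depth := by unfold Leaf.addCandidate; split_ifs <;> rfl

theorem Leaf.addCandidate_dims (L : Leaf m D C 𝒮) (x : Feat D) :
    (L.addCandidate x).dims = L.dims := by unfold Leaf.addCandidate; split_ifs <;> rfl

theorem Leaf.addCandidate_est (L : Leaf m D C 𝒮) (x : Feat D) :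
    (L.addCandidate x).est = L.est := by unfold Leaf.addCandidate; split_ifs <;> rfl

theorem Leaf.addCandidate_candEst (L : Leaf m D C 𝒮) (x : Feat D) :
    (L.addCandidate x).candEst = L.candEst := by unfold Leaf.addCandidate; split_ifs <;> rfl

theorem Leaf.IsCand.addCandidate {L : Leaf m D C 𝒮} {S : Cand m D} (h : L.IsCand S) (x : Feat D) :
    (L.addCandidate x).IsCand S := by
  unfold Leaf.addCandidate
  split_ifs
  · exact ⟨Nat.lt_succ_of_lt h.1, h.2⟩
  · exact h

theorem Leaf.addCandidate_pt (L : Leaf m D C 𝒮) (x : Feat D) {i : Fin m} (hi : (i : ℕ) < L.num) :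
    (L.addCandidate x).pt i = L.pt i := by
  unfold Leaf.addCandidate
  split_ifs
  · simp [hi.ne]
  · rfl

theorem Leaf.Wf.addEstimation {L : Leaf m D C 𝒮} (hL : L.Wf Q) (z : Feat D × Fin C) :
    (L.addEstimation z).Wf Q where
  candEst_eq_zero S b h := by
    have h' : ¬ L.IsCand S := h
    simp only [Leaf.addEstimation, Leaf.InChild, h', false_and, if_false]
    exact hL.candEst_eq_zero S b h'
  le_numEst d hd := by
    refine (hL.le_numEst d hd).trans ?_
    simp only [Leaf.numEst, Leaf.addEstimation, sum_addLabel]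
    exact_mod_cast Nat.le_succ _

theorem Leaf.Wf.addStructure {L : Leaf m D C 𝒮} (hL : L.Wf Q) (z : Feat D × Fin C) :
    ((L.addCandidate z.1).addStructure Q.rule z).Wf Q where
  candEst_eq_zero S b h := by
    have h' : ¬ L.IsCand S := fun hc => h (hc.addCandidate z.1)
    simp only [Leaf.addStructure, Leaf.addCandidate_candEst]
    exact hL.candEst_eq_zero S b h'
  le_numEst d hd := by
    simp only [Leaf.addStructure, Leaf.addCandidate_depth] at hd
    simpa only [Leaf.numEst, Leaf.addStructure, Leaf.addCandidate_est] using hL.le_numEst d hd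

theorem Leaf.Wf.newLeaf (R : SplitRule m D C 𝒮) (d : ℕ) (dims : Finset (Fin D)) (est : Fin C → ℕ)
    (stat : 𝒮) (h : Q.α d ≤ ((∑ k, est k : ℕ) : ℝ)) : (newLeaf R (d + 1) dims est stat).Wf Q where
  candEst_eq_zero _ _ _ := rfl
  le_numEst d' hd := by
    have : d' = d := by simpa [OnlineForest.newLeaf] using hd.symm
    rw [this]
    exact h

theorem LeafInv.root {ν : Measure (Feat D)} (d₀ : Finset (Fin D)) :
    LeafInv Q ν Set.univ (OnlineForest.newLeaf Q.rule 0 d₀ (fun _ => 0) Q.rule.init) :=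
  ⟨⟨MeasurableSet.univ, by simp⟩, ⟨fun _ _ _ => rfl, fun d hd => by simp [newLeaf] at hd⟩⟩

theorem LeafInv.step {ν : Measure (Feat D)} (hν : ∀ d θ, ν {x : Feat D | x d = θ} = 0)
    (A : Set (Feat D)) (L : Leaf m D C 𝒮) (z : Feat D × Fin C) (u : Draw D)
    (_ : MeasurableSet A) (h : LeafInv Q ν A L) (_ : z.1 ∈ A) :
    (L.step Q z u).AllLeaves (LeafInv Q ν) A := by
  unfold Leaf.step
  split_ifs
  · exact ⟨h.1, h.2.addEstimation z⟩
  · set L' := (L.addCandidate z.1).addStructure Q.rule z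
    unfold Leaf.trySplit
    split_ifs with hs
    · have hmem : L'.chosen Q ∈ L'.validSplits Q := Q.rule.best_mem _ _ _ hs.1
      simp only [Leaf.validSplits, Finset.mem_filter] at hmem
      exact ⟨⟨h.1.inter_le hν _ _, .newLeaf _ _ _ _ _ (hmem.2.2 false)⟩,
        ⟨h.1.inter_gt _ _, .newLeaf _ _ _ _ _ (hmem.2.2 true)⟩⟩
    · exact ⟨h.1, h.2.addStructure z⟩

theorem LeafInv.allLeaves {ν : Measure (Feat D)} (hν : ∀ d θ, ν {x : Feat D | x d = θ} = 0)
    (h : Hist D C) (t : ℕ) : (histTree Q h t).AllLeaves (LeafInv Q ν) Set.univ :=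
  histTree_allLeaves Q LeafInv.root (LeafInv.step hν) h t

end

/-! ### The law of the candidate dimensions -/

theorem dimsLaw_singleton_ne_zero {D : ℕ} (rate : ℝ≥0) (i : Fin D) :
    dimsLaw D rate {{i}} ≠ 0 := by
  intro h
  rw [dimsLaw, Measure.bind_apply (measurableSet_singleton _)
    measurable_from_nat.aemeasurable, lintegral_eq_zero_iff measurable_from_nat] at h
  have h0 : poissonMeasure rate {0} = 0 := by
    refine measure_mono_null (fun k hk => ?_) h
    rw [Set.mem_singleton_iff] at hk
    subst hk
    have hi : ({i} : Finset (Fin D)) ∈ Finset.powersetCard (min (1 + 0) D) Finset.univ := by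
      have : 0 < D := i.pos
      simp [Finset.mem_powersetCard]
      omega
    simp only [Set.mem_compl_iff, Set.mem_ofPred_eq, Pi.zero_apply]
    rw [PMF.toMeasure_apply_singleton _ _ (measurableSet_singleton _),
      PMF.uniformOfFinset_apply_of_mem _ hi]
    simp
  have h1 : 0 < poissonMeasure rate {0} := by
    rw [poissonMeasure_singleton]
    simp [Real.exp_pos]
  exact h1.ne' h0

theorem dimsLaw_empty {D : ℕ} (hD : 0 < D) (rate : ℝ≥0) : dimsLaw D rate {∅} = 0 := by
  rw [dimsLaw, Measure.bind_apply (measurableSet_singleton _)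
    measurable_from_nat.aemeasurable]
  refine (lintegral_congr fun k => ?_).trans lintegral_zero
  rw [PMF.toMeasure_apply_singleton _ _ (measurableSet_singleton _),
    PMF.uniformOfFinset_apply_of_notMem]
  simp [Finset.mem_powersetCard]
  omega

/-! ### Impurity of a set in a cell -/

/-- Half of the harmonic mean of two nonnegative numbers. -/
noncomputable def harm (x y : ℝ) : ℝ := x * y / (x + y)

theorem harm_comm (x y : ℝ) : harm x y = harm y x := by
  unfold harm; rw [mul_comm, add_comm]

theorem harm_nonneg {x y : ℝ} (hx : 0 ≤ x) (hy : 0 ≤ y) : 0 ≤ harm x y := by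
  unfold harm; positivity

theorem harm_le_left {x y : ℝ} (hx : 0 ≤ x) (hy : 0 ≤ y) : harm x y ≤ x := by
  unfold harm
  rcases (add_nonneg hx hy).eq_or_lt with h | h
  · rw [← h]; simpa using hx
  · rw [div_le_iff₀ h]; nlinarith

/-- Superadditivity of the harmonic mean; refining a partition therefore does not increase
the impurity. -/
theorem harm_add_le {x₁ y₁ x₂ y₂ : ℝ} (hx₁ : 0 ≤ x₁) (hy₁ : 0 ≤ y₁) (hx₂ : 0 ≤ x₂) (hy₂ : 0 ≤ y₂) :
    harm x₁ y₁ + harm x₂ y₂ ≤ harm (x₁ + x₂) (y₁ + y₂) := by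
  unfold harm
  rcases (add_nonneg hx₁ hy₁).eq_or_lt with h | h
  · have h1 : x₁ = 0 := by linarith
    have h2 : y₁ = 0 := by linarith
    simp [h1, h2]
  rcases (add_nonneg hx₂ hy₂).eq_or_lt with h' | h'
  · have h1 : x₂ = 0 := by linarith
    have h2 : y₂ = 0 := by linarith
    simp [h1, h2]
  rw [div_add_div _ _ h.ne' h'.ne', div_le_div_iff₀ (by positivity) (by linarith)]
  nlinarith [sq_nonneg (x₁ * y₂ - x₂ * y₁)]

/-- Cutting off a pure part that contains at least a quarter of the mass decreases the
impurity by a definite amount. -/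
theorem harm_cut_le {x y₁ y₂ : ℝ} (hx : 0 ≤ x) (hy₁ : 0 ≤ y₁) (hy₂ : 0 ≤ y₂)
    (h : x + y₁ + y₂ ≤ 4 * y₂) :
    harm x y₁ ≤ harm x (y₁ + y₂) - 1 / 4 * (harm x (y₁ + y₂) ^ 2 / (x + y₁ + y₂)) := by
  rcases hx.eq_or_lt with h0 | hx'
  · subst h0; simp [harm]
  have ha : 0 < x + y₁ + y₂ := by linarith
  have hxy : 0 < x + y₁ := by linarith
  have e : harm x (y₁ + y₂) - harm x y₁ = x ^ 2 * y₂ / ((x + y₁ + y₂) * (x + y₁)) := by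
    unfold harm
    rw [← add_assoc, div_sub_div _ _ ha.ne' hxy.ne']
    congr 1
    ring
  have h1 : harm x (y₁ + y₂) ^ 2 ≤ x ^ 2 :=
    pow_le_pow_left₀ (harm_nonneg hx (by linarith)) (harm_le_left hx (by linarith)) 2
  have h2 : 1 / 4 * (x ^ 2 / (x + y₁ + y₂)) ≤ x ^ 2 * y₂ / ((x + y₁ + y₂) * (x + y₁)) := by
    rw [← mul_div_assoc, div_le_div_iff₀ ha (by positivity)]
    have : 0 ≤ x ^ 2 * (x + y₁ + y₂) := by positivity
    nlinarith
  have h3 : 1 / 4 * (harm x (y₁ + y₂) ^ 2 / (x + y₁ + y₂)) ≤ 1 / 4 * (x ^ 2 / (x + y₁ + y₂)) := by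
    gcongr
  linarith

section Impurity

variable {D : ℕ}

/-- The impurity of the set `B` in the cell `A`: the `ν`-mass of `A` times the conditional variance
of the indicator function of `B`. -/
noncomputable def impurity (ν : Measure (Feat D)) (B A : Set (Feat D)) : ℝ :=
  harm (ν.real (A ∩ B)) (ν.real (A \ B))

/-- The lower bound (up to a factor `1/4`) for the decrease of the impurity at a good split. -/
noncomputable def impurityDrop (ν : Measure (Feat D)) (B A : Set (Feat D)) : ℝ :=
  impurity ν B A ^ 2 / ν.real A

variable (ν : Measure (Feat D)) [IsFiniteMeasure ν] {B : Set (Feat D)}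

theorem impurity_nonneg (B A : Set (Feat D)) : 0 ≤ impurity ν B A :=
  harm_nonneg measureReal_nonneg measureReal_nonneg

theorem impurityDrop_nonneg (B A : Set (Feat D)) : 0 ≤ impurityDrop ν B A := by
  unfold impurityDrop; positivity

theorem impurity_le (B A : Set (Feat D)) : impurity ν B A ≤ ν.real A :=
  (harm_le_left measureReal_nonneg measureReal_nonneg).trans
    (measureReal_mono Set.inter_subset_left)

theorem impurityDrop_le (B A : Set (Feat D)) : impurityDrop ν B A ≤ impurity ν B A := by
  unfold impurityDrop
  rcases (measureReal_nonneg (μ := ν) (s := A)).eq_or_lt with h | h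
  · rw [← h]; simpa using impurity_nonneg ν B A
  · rw [div_le_iff₀ h, sq]
    exact mul_le_mul_of_nonneg_left (impurity_le ν B A) (impurity_nonneg ν B A)

/-- The impurity is controlled by the drop at a good split unless it is small relative to the mass
of the cell. -/
theorem impurity_le_add_drop (B A : Set (Feat D)) {δ : ℝ} (hδ : 0 < δ) :
    impurity ν B A ≤ δ * ν.real A + δ⁻¹ * impurityDrop ν B A := by
  unfold impurityDrop
  rcases (measureReal_nonneg (μ := ν) (s := A)).eq_or_lt with h | h
  · have := impurity_le ν B A
    rw [← h] at this ⊢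
    simpa using this
  · set v := impurity ν B A
    set a := ν.real A
    have e : δ * a + δ⁻¹ * (v ^ 2 / a) - v = ((δ * a - v) ^ 2 + δ * a * v) / (δ * a) := by
      field_simp
      ring
    have : 0 ≤ ((δ * a - v) ^ 2 + δ * a * v) / (δ * a) := by
      have := impurity_nonneg ν B A
      positivity
    linarith

theorem measureReal_split (A : Set (Feat D)) (d : Fin D) (θ : ℝ) :
    ν.real A = ν.real (A ∩ {x | x d ≤ θ}) + ν.real (A ∩ {x | θ < x d}) := by
  have : A ∩ {x | θ < x d} = A \ {x | x d ≤ θ} := by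
    ext x; simp
  rw [this, measureReal_inter_add_sdiff (measurableSet_coord_le d θ)]

theorem measureReal_inter_split (A B : Set (Feat D)) (d : Fin D) (θ : ℝ) :
    ν.real (A ∩ B) = ν.real (A ∩ {x | x d ≤ θ} ∩ B) + ν.real (A ∩ {x | θ < x d} ∩ B) := by
  rw [measureReal_split ν (A ∩ B) d θ, Set.inter_right_comm, Set.inter_right_comm A B]

theorem measureReal_diff_split (A B : Set (Feat D)) (d : Fin D) (θ : ℝ) :
    ν.real (A \ B) = ν.real ((A ∩ {x | x d ≤ θ}) \ B) + ν.real ((A ∩ {x | θ < x d}) \ B) := by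
  simp only [Set.sdiff_eq]
  exact measureReal_inter_split ν A Bᶜ d θ

theorem impurity_split_le (B A : Set (Feat D)) (d : Fin D) (θ : ℝ) :
    impurity ν B (A ∩ {x | x d ≤ θ}) + impurity ν B (A ∩ {x | θ < x d}) ≤ impurity ν B A := by
  unfold impurity
  rw [measureReal_inter_split ν A B d θ, measureReal_diff_split ν A B d θ]
  exact harm_add_le measureReal_nonneg measureReal_nonneg measureReal_nonneg measureReal_nonneg

/-- Both sides of the cut of the cell `A` at the `i`-th coordinate of `x` contain at least a quarter
of the mass of `A`. -/
def GoodPt (A : Set (Feat D)) (i : Fin D) (x : Feat D) : Prop :=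
  ν A ≤ 4 * ν (A ∩ {y | y i ≤ x i}) ∧ ν A ≤ 4 * ν (A ∩ {y | x i < y i})

/-- At a good split the impurity of a half space in the direction of the split decreases. -/
theorem impurity_good_split_le {A : Set (Feat D)} {i : Fin D} {x : Feat D}
    (h : GoodPt ν A i x) (b : ℝ) :
    impurity ν {y | y i ≤ b} (A ∩ {y | y i ≤ x i}) + impurity ν {y | y i ≤ b} (A ∩ {y | x i < y i})
      ≤ impurity ν {y | y i ≤ b} A - 1 / 4 * impurityDrop ν {y | y i ≤ b} A := by
  have hB : MeasurableSet {y : Feat D | y i ≤ b} := measurableSet_coord_le i b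
  have h1 : ν.real A ≤ 4 * ν.real (A ∩ {y | y i ≤ x i}) := by
    have := ENNReal.toReal_mono (by finiteness) h.1
    simpa [Measure.real] using this
  have h2 : ν.real A ≤ 4 * ν.real (A ∩ {y | x i < y i}) := by
    have := ENNReal.toReal_mono (by finiteness) h.2
    simpa [Measure.real] using this
  have e : ∀ A : Set (Feat D), ν.real A = ν.real (A ∩ {y | y i ≤ b}) + ν.real (A \ {y | y i ≤ b}) :=
    fun A => (measureReal_inter_add_sdiff hB).symm
  unfold impurityDrop impurity
  rw [measureReal_inter_split ν A _ i (x i), measureReal_diff_split ν A _ i (x i)]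
  rw [e A, measureReal_inter_split ν A _ i (x i), measureReal_diff_split ν A _ i (x i)] at h1 h2
  rw [e (A ∩ {y | y i ≤ x i})] at h1
  rw [e (A ∩ {y | x i < y i})] at h2
  rw [e A, measureReal_inter_split ν A _ i (x i), measureReal_diff_split ν A _ i (x i)]
  rcases le_or_gt (x i) b with hxb | hxb
  -- The left child lies in the half space: a pure part of at least a quarter is cut off.
  · have z : (A ∩ {y | y i ≤ x i}) \ {y | y i ≤ b} = ∅ := by
      ext y
      simp only [Set.mem_sdiff, Set.mem_inter_iff, Set.mem_ofPred_eq, Set.mem_empty_iff_false,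
        iff_false, not_and, not_not]
      exact fun hy => hy.2.trans hxb
    rw [z] at h1 h2 ⊢
    simp only [measureReal_empty, zero_add, add_zero] at h1 h2 ⊢
    set u := ν.real ((A ∩ {y | x i < y i}) \ {y | y i ≤ b})
    set v := ν.real (A ∩ {y | x i < y i} ∩ {y | y i ≤ b})
    set w := ν.real (A ∩ {y | y i ≤ x i} ∩ {y | y i ≤ b})
    have := harm_cut_le (x := u) (y₁ := v) (y₂ := w)
      measureReal_nonneg measureReal_nonneg measureReal_nonneg (by linarith)
    have e0 : harm w 0 = 0 := by simp [harm]
    rw [e0, zero_add, harm_comm, harm_comm (w + v), add_comm w v, add_comm _ u, ← add_assoc]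
    exact this
  -- The right child lies outside the half space: again the part cut off is pure.
  · have z : (A ∩ {y | x i < y i}) ∩ {y | y i ≤ b} = ∅ := by
      ext y
      simp only [Set.mem_inter_iff, Set.mem_ofPred_eq, Set.mem_empty_iff_false,
        iff_false, not_and, not_le]
      exact fun hy => hxb.trans hy.2
    rw [z] at h1 h2 ⊢
    simp only [measureReal_empty, zero_add, add_zero] at h1 h2 ⊢
    have := harm_cut_le (x := ν.real (A ∩ {y | y i ≤ x i} ∩ {y | y i ≤ b}))
      (y₁ := ν.real ((A ∩ {y | y i ≤ x i}) \ {y | y i ≤ b}))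
      (y₂ := ν.real ((A ∩ {y | x i < y i}) \ {y | y i ≤ b}))
      measureReal_nonneg measureReal_nonneg measureReal_nonneg (by linarith)
    have e0 : harm 0 (ν.real ((A ∩ {y | x i < y i}) \ {y | y i ≤ b})) = 0 := by simp [harm]
    rw [e0, add_zero, ← add_assoc]
    exact this

/-- Points at which the distribution function of `σ` is less than `c` have total mass at most `c`:
a compact set of such points lies to the left of its largest element. -/
theorem measure_setOf_Iic_lt_le (σ : Measure ℝ) [IsFiniteMeasure σ] (c : ℝ≥0∞) :
    σ {s | σ (Set.Iic s) < c} ≤ c := by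
  have hm : MeasurableSet {s | σ (Set.Iic s) < c} :=
    measurableSet_lt (Monotone.measurable fun s t h => measure_mono (Set.Iic_subset_Iic.2 h))
      measurable_const
  rw [hm.measure_eq_iSup_isCompact σ]
  refine iSup_le fun K => iSup_le fun hK => iSup_le fun hc => ?_
  rcases K.eq_empty_or_nonempty with rfl | hne
  · simp
  obtain ⟨s, hs, hmax⟩ := hc.exists_isMaxOn hne continuousOn_id
  have h1 : σ (Set.Iic s) < c := hK hs
  exact (measure_mono fun y hy => hmax hy).trans h1.le

theorem measure_setOf_Ioi_lt_le (σ : Measure ℝ) [IsFiniteMeasure σ] (hσ : ∀ s, σ {s} = 0)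
    (c : ℝ≥0∞) : σ {s | σ (Set.Ioi s) < c} ≤ c := by
  have hm : MeasurableSet {s | σ (Set.Ioi s) < c} :=
    measurableSet_lt (Antitone.measurable fun s t h => measure_mono (Set.Ioi_subset_Ioi h))
      measurable_const
  rw [hm.measure_eq_iSup_isCompact σ]
  refine iSup_le fun K => iSup_le fun hK => iSup_le fun hc => ?_
  rcases K.eq_empty_or_nonempty with rfl | hne
  · simp
  obtain ⟨s, hs, hmin⟩ := hc.exists_isMinOn hne continuousOn_id
  have h1 : σ (Set.Ioi s) < c := hK hs
  have h2 : K ⊆ Set.Ioi s ∪ {s} := fun y hy => by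
    rcases (show s ≤ y from hmin hy).eq_or_lt with h | h
    · exact Or.inr h.symm
    · exact Or.inl h
  calc σ K ≤ σ (Set.Ioi s) + σ {s} := (measure_mono h2).trans (measure_union_le _ _)
    _ ≤ c := by rw [hσ, add_zero]; exact h1.le

theorem measurableSet_goodPt {A : Set (Feat D)} (hA : MeasurableSet A) (i : Fin D) :
    MeasurableSet {x | GoodPt ν A i x} := by
  have h1 : MeasCell fun x : Feat D => A ∩ {y : Feat D | y i ≤ x i} :=
    (MeasCell.const hA).inter (.le measurable_const (measurable_coord_const i))
  have h2 : MeasCell fun x : Feat D => A ∩ {y : Feat D | x i < y i} :=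
    (MeasCell.const hA).inter (.gt measurable_const (measurable_coord_const i))
  exact (measurableSet_le measurable_const ((h1.measurable_measure ν).const_mul 4)).inter
    (measurableSet_le measurable_const ((h2.measurable_measure ν).const_mul 4))

/-- A random point of a cell gives a good split with probability at least one half. -/
theorem measure_le_two_mul_goodPt (hν : ∀ d θ, ν {x : Feat D | x d = θ} = 0)
    {A : Set (Feat D)} (hA : MeasurableSet A) (i : Fin D) :
    ν A ≤ 2 * ν (A ∩ {x | GoodPt ν A i x}) := by
  set σ : Measure ℝ := (ν.restrict A).map fun x : Feat D => x i with hσ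
  have hc := measurable_coord_const (D := D) i
  have hIic : ∀ s, σ (Set.Iic s) = ν (A ∩ {y | y i ≤ s}) := fun s => by
    rw [hσ, Measure.map_apply hc measurableSet_Iic, Measure.restrict_apply (hc measurableSet_Iic),
      Set.inter_comm]
    rfl
  have hIoi : ∀ s, σ (Set.Ioi s) = ν (A ∩ {y | s < y i}) := fun s => by
    rw [hσ, Measure.map_apply hc measurableSet_Ioi, Measure.restrict_apply (hc measurableSet_Ioi),
      Set.inter_comm]
    rfl
  have hat : ∀ s, σ {s} = 0 := fun s => by
    rw [hσ, Measure.map_apply hc (measurableSet_singleton s)]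
    exact measure_mono_null (fun x hx => hx)
      (Measure.absolutelyContinuous_of_le Measure.restrict_le_self (hν i s))
  have key : ∀ E : Set ℝ, MeasurableSet E → σ E = ν (A ∩ {x | x i ∈ E}) := fun E hE => by
    rw [hσ, Measure.map_apply hc hE, Measure.restrict_apply (hc hE), Set.inter_comm]
    rfl
  set E₁ := {s | σ (Set.Iic s) < ν A / 4}
  set E₂ := {s | σ (Set.Ioi s) < ν A / 4}
  have hE₁ : MeasurableSet E₁ :=
    measurableSet_lt (Monotone.measurable fun s t h => measure_mono (Set.Iic_subset_Iic.2 h))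
      measurable_const
  have hE₂ : MeasurableSet E₂ :=
    measurableSet_lt (Antitone.measurable fun s t h => measure_mono (Set.Ioi_subset_Ioi h))
      measurable_const
  have hcover : A ⊆ (A ∩ {x | GoodPt ν A i x}) ∪ ((A ∩ {x | x i ∈ E₁}) ∪ (A ∩ {x | x i ∈ E₂})) := by
    intro x hx
    by_cases h : GoodPt ν A i x
    · exact Or.inl ⟨hx, h⟩
    · refine Or.inr ?_
      rw [GoodPt, not_and_or, not_le, not_le, ← hIic, ← hIoi] at h
      have conv : ∀ a : ℝ≥0∞, 4 * a < ν A → a < ν A / 4 := fun a ha => by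
        rw [ENNReal.lt_div_iff_mul_lt (by simp) (by simp), mul_comm]; exact ha
      rcases h with h | h
      · exact Or.inl ⟨hx, conv _ h⟩
      · exact Or.inr ⟨hx, conv _ h⟩
  have h1 : ν A ≤ ν (A ∩ {x | GoodPt ν A i x}) + (ν A / 4 + ν A / 4) := by
    refine (measure_mono hcover).trans ((measure_union_le _ _).trans ?_)
    gcongr
    refine (measure_union_le _ _).trans (add_le_add ?_ ?_)
    · rw [← key E₁ hE₁]; exact measure_setOf_Iic_lt_le σ _
    · rw [← key E₂ hE₂]; exact measure_setOf_Ioi_lt_le σ hat _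
  have hfin : ν A ≠ ∞ := measure_ne_top _ _
  have hfin' : ν (A ∩ {x | GoodPt ν A i x}) ≠ ∞ := measure_ne_top _ _
  rw [← ENNReal.ofReal_toReal hfin, ← ENNReal.ofReal_toReal hfin'] at h1 ⊢
  rw [show (4 : ℝ≥0∞) = ENNReal.ofReal 4 by simp, ← ENNReal.ofReal_div_of_pos (by norm_num),
    ← ENNReal.ofReal_add (by positivity) (by positivity),
    ← ENNReal.ofReal_add (by positivity) (by positivity),
    ENNReal.ofReal_le_ofReal_iff (by positivity)] at h1
  have h2 : ∀ a : ℝ, (2 : ℝ≥0∞) * ENNReal.ofReal a = ENNReal.ofReal (2 * a) := fun a => by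
    rw [ENNReal.ofReal_mul (by norm_num), ENNReal.ofReal_ofNat]
  rw [h2]
  exact ENNReal.ofReal_le_ofReal (by linarith)

end Impurity

section Shape

variable {m D C : ℕ} {𝒮 : Type*} [MeasurableSpace 𝒮] (ν : Measure (Feat D)) [IsFiniteMeasure ν]

/-! ### Every coordinate direction is resolved -/

/-- The leaf can only be split in direction `i`, and its candidate points give good splits. -/
def Leaf.IsGood (i : Fin D) (A : Set (Feat D)) (L : Leaf m D C 𝒮) : Prop :=
  L.dims = {i} ∧ ∀ j : Fin m, (j : ℕ) < L.num → GoodPt ν A i (L.pt j)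

open Classical in
/-- A lower bound for the probability that the leaf has all its `m` candidate points, and all of
them are good. -/
noncomputable def Leaf.goodProb (i : Fin D) (A : Set (Feat D)) (L : Leaf m D C 𝒮) : ℝ :=
  if L.IsGood ν i A then (1 / 2) ^ (m - L.num) else 0

/-- The probability bound for a good split of a new leaf. -/
noncomputable def goodRate (m : ℕ) {D : ℕ} (rate : ℝ≥0) (i : Fin D) : ℝ :=
  (dimsLaw D rate).real {{i}} * (1 / 2) ^ m

/-- The contribution of a leaf to the shape potential: the impurity of `B` in its cell, corrected by
a term that compares the prospects of a good split with those at the creation of the leaf. -/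
noncomputable def shapePot (i : Fin D) (B : Set (Feat D)) (c : ℝ) (A : Set (Feat D))
    (L : Leaf m D C 𝒮) : ℝ≥0∞ :=
  ENNReal.ofReal (impurity ν B A + 1 / 4 * (impurityDrop ν B A * (c - L.goodProb ν i A)))

/-- The contribution of an inner node to the shape potential. -/
noncomputable def shapeNode (B : Set (Feat D)) (c : ℝ) (A : Set (Feat D)) : ℝ≥0∞ :=
  ENNReal.ofReal (1 / 4 * (impurityDrop ν B A * c))

theorem goodRate_pos (m : ℕ) (rate : ℝ≥0) (i : Fin D) : 0 < goodRate m rate i := by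
  unfold goodRate
  have : 0 < (dimsLaw D rate).real {{i}} :=
    ENNReal.toReal_pos (dimsLaw_singleton_ne_zero rate i) (measure_ne_top _ _)
  positivity

variable {ν}

theorem Leaf.goodProb_le_one (i : Fin D) (A : Set (Feat D)) (L : Leaf m D C 𝒮) :
    L.goodProb ν i A ≤ 1 := by
  unfold Leaf.goodProb
  split_ifs
  · exact pow_le_one₀ (by norm_num) (by norm_num)
  · norm_num

theorem shapePot_arg_nonneg (i : Fin D) (B : Set (Feat D)) {c : ℝ} (hc : 0 ≤ c) (A : Set (Feat D))
    {g : ℝ} (hg : g ≤ 1) :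
    0 ≤ impurity ν B A + 1 / 4 * (impurityDrop ν B A * (c - g)) := by
  have h1 := impurityDrop_le ν B A
  have h2 := impurityDrop_nonneg ν B A
  nlinarith [mul_nonneg h2 hc, mul_nonneg h2 (sub_nonneg.2 hg), impurity_nonneg ν B A]

variable (ν)

theorem measurable_impurity {Ω : Type*} [MeasurableSpace Ω] {B : Set (Feat D)}
    (hB : MeasurableSet B) {A : Ω → Set (Feat D)} (hA : MeasCell A) :
    Measurable fun ω => impurity ν B (A ω) := by
  have h1 : Measurable fun ω => ν.real (A ω ∩ B) :=
    ((hA.inter (.const hB)).measurable_measure ν).ennreal_toReal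
  have h2 : Measurable fun ω => ν.real (A ω \ B) :=
    ((hA.inter (.const hB.compl)).measurable_measure ν).ennreal_toReal
  exact (h1.mul h2).div (h1.add h2)

theorem measurable_impurityDrop {Ω : Type*} [MeasurableSpace Ω] {B : Set (Feat D)}
    (hB : MeasurableSet B) {A : Ω → Set (Feat D)} (hA : MeasCell A) :
    Measurable fun ω => impurityDrop ν B (A ω) :=
  ((measurable_impurity ν hB hA).pow_const 2).div (hA.measurable_measure ν).ennreal_toReal

theorem measurable_goodProb {Ω : Type*} [MeasurableSpace Ω] (i : Fin D)
    {A : Ω → Set (Feat D)} (hA : MeasCell A) {L : Ω → Leaf m D C 𝒮} (hL : MeasLeaf L) :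
    Measurable fun ω => (L ω).goodProb ν i (A ω) := by
  refine Measurable.ite ?_ ?_ measurable_const
  · have hdims : MeasurableSet {ω | (L ω).dims = {i}} :=
      hL.dims (measurableSet_singleton ({i} : Finset (Fin D)))
    refine hdims.inter ?_
    refine MeasurableSet.congr (MeasurableSet.iInter (ι := Fin m) fun j => ?_)
      (Set.ofPred_forall _).symm
    have hj : Measurable fun ω => (L ω).pt j i := measurable_coord (hL.pt j) measurable_const
    have h1 := (hA.inter (.le (measurable_const (a := i)) hj)).measurable_measure ν
    have h2 := (hA.inter (.gt (measurable_const (a := i)) hj)).measurable_measure ν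
    have h3 := hA.measurable_measure ν
    refine MeasurableSet.congr (((measurableSet_lt (measurable_const (a := (j : ℕ))) hL.num).compl).union
      ((measurableSet_le h3 (h1.const_mul 4)).inter (measurableSet_le h3 (h2.const_mul 4)))) ?_
    ext ω
    simp only [Set.mem_union, Set.mem_compl_iff, Set.mem_inter_iff, Set.mem_ofPred_eq, GoodPt]
    tauto
  · exact (measurable_from_nat (f := fun n => ((1 : ℝ) / 2) ^ (m - n))).comp hL.num

theorem measPot_shapePot {Ω : Type*} [MeasurableSpace Ω] (i : Fin D) {B : Set (Feat D)}
    (hB : MeasurableSet B) (c : ℝ) :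
    MeasPot Ω (shapePot ν i B c : Set (Feat D) → Leaf m D C 𝒮 → ℝ≥0∞) := fun _ _ hL hA =>
  ((measurable_impurity ν hB hA).add (((measurable_impurityDrop ν hB hA).mul
    (measurable_const.sub (measurable_goodProb ν i hA hL))).const_mul _)).ennreal_ofReal

theorem measurable_shapeNode {Ω : Type*} [MeasurableSpace Ω] {B : Set (Feat D)}
    (hB : MeasurableSet B) (c : ℝ) {A : Ω → Set (Feat D)} (hA : MeasCell A) :
    Measurable fun ω => shapeNode ν B c (A ω) :=
  (((measurable_impurityDrop ν hB hA).mul_const c).const_mul _).ennreal_ofReal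

/-- The mean contribution of a new leaf is the impurity in its cell. -/
theorem lintegral_shapePot_newLeaf (R : SplitRule m D C 𝒮) (rate : ℝ≥0) (i : Fin D)
    (B A : Set (Feat D)) (d : ℕ) (est : Fin C → ℕ) (stat : 𝒮) :
    ∫⁻ dims, shapePot ν i B (goodRate m rate i) A (newLeaf R d dims est stat) ∂dimsLaw D rate
      = ENNReal.ofReal (impurity ν B A) := by
  classical
  set c := goodRate m rate i with hc
  have hg : ∀ dims, (newLeaf R d dims est stat).goodProb ν i A
      = ({{i}} : Set (Finset (Fin D))).indicator (fun _ => ((1 : ℝ) / 2) ^ m) dims := by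
    intro dims
    have : (newLeaf R d dims est stat).IsGood ν i A ↔ dims ∈ ({{i}} : Set (Finset (Fin D))) := by
      simp [Leaf.IsGood, newLeaf]
    simp only [Leaf.goodProb, this, Set.indicator_apply]
    simp [newLeaf]
  unfold shapePot
  rw [← ofReal_integral_eq_lintegral_ofReal .of_finite
    (ae_of_all _ fun dims => shapePot_arg_nonneg i B (goodRate_pos m rate i).le A
      (Leaf.goodProb_le_one i A _))]
  congr 1
  rw [integral_add (integrable_const _) .of_finite, integral_const_mul, integral_const_mul,
    integral_sub (integrable_const _) .of_finite]
  simp only [hg]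
  rw [integral_indicator (measurableSet_singleton _)]
  simp [goodRate, Measure.real]

/-- The shape potential does not increase in mean at a leaf. A new candidate point doubles the
probability `goodProb` if it is good, which has probability at least one half, and sets it to zero
otherwise. At a split the term with `c` becomes the contribution of the new inner node, and the new
leaves contribute their impurity in mean, since `c` is the mean of `goodProb` for a new leaf; the
term with `goodProb`, which is at most `1`, is made up for by the decrease of the impurity. -/
theorem shapePot_leaf_le (P : Measure (Feat D × Fin C)) [IsProbabilityMeasure P]
    (hν : ∀ d θ, P.fst {x : Feat D | x d = θ} = 0) (p : unitInterval) (rate : ℝ≥0)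
    (Q : Params m D C 𝒮) (i : Fin D) (b : ℝ) (A : Set (Feat D)) (L : Leaf m D C 𝒮)
    (hA : MeasurableSet A) :
    ∫⁻ e in obsIn C A, (L.step Q e.1 e.2).total
        (shapeNode P.fst {x | x i ≤ b} (goodRate m rate i))
        (shapePot P.fst i {x | x i ≤ b} (goodRate m rate i)) A ∂obsLaw P p rate
      ≤ P.fst A * shapePot P.fst i {x | x i ≤ b} (goodRate m rate i) A L := by
  set B : Set (Feat D) := {x | x i ≤ b} with hBdef
  have hB : MeasurableSet B := measurableSet_coord_le i b
  set c := goodRate m rate i with hc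
  have hc0 : 0 ≤ c := (goodRate_pos m rate i).le
  set ν := P.fst with hνdef
  have hPA : P (Prod.fst ⁻¹' A) = ν A := (Measure.fst_apply hA).symm
  set V := impurity ν B A with hV
  set w := impurityDrop ν B A with hw
  have hw0 : 0 ≤ w := impurityDrop_nonneg ν B A
  refine Leaf.setLIntegral_step_le Q P p rate (measPot_shapePot ν i hB c) hA ?_ ?_ ?_
  · have : ∀ z, shapePot ν i B c A (L.addEstimation z) = shapePot ν i B c A L := fun z => rfl
    simp only [this, setLIntegral_const, hPA]
    rw [mul_comm]
  · have hstr : ∀ z : Feat D × Fin C, shapePot ν i B c A ((L.addCandidate z.1).addStructure Q.rule z)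
        = shapePot ν i B c A (L.addCandidate z.1) := fun z => rfl
    simp only [hstr]
    -- After `m` structure points no candidates are added.
    by_cases hnum : L.num < m
    swap
    · have : ∀ x, L.addCandidate x = L := fun x => by simp [Leaf.addCandidate, hnum]
      simp only [this, setLIntegral_const, hPA]
      rw [mul_comm]
    have hpt : ∀ x (j : Fin m), (j : ℕ) < L.num → (L.addCandidate x).pt j = L.pt j :=
      fun x j hj => L.addCandidate_pt x hj
    have hnum' : ∀ x, (L.addCandidate x).num = L.num + 1 := fun x => by
      simp [Leaf.addCandidate, hnum]
    have hlast : ∀ x, (L.addCandidate x).pt ⟨L.num, hnum⟩ = x := fun x => by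
      simp [Leaf.addCandidate, hnum]
    have hiff : ∀ x, (L.addCandidate x).IsGood ν i A ↔ L.IsGood ν i A ∧ GoodPt ν A i x := by
      intro x
      simp only [Leaf.IsGood, L.addCandidate_dims, hnum']
      constructor
      · rintro ⟨h1, h2⟩
        refine ⟨⟨h1, fun j hj => ?_⟩, ?_⟩
        · rw [← hpt x j hj]; exact h2 j (by omega)
        · have := h2 ⟨L.num, hnum⟩ (by simp)
          rwa [hlast] at this
      · rintro ⟨⟨h1, h2⟩, h3⟩
        refine ⟨h1, fun j hj => ?_⟩
        by_cases hj' : (j : ℕ) < L.num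
        · rw [hpt x j hj']; exact h2 j hj'
        · have : j = ⟨L.num, hnum⟩ := Fin.ext (by simp; omega)
          rw [this, hlast]; exact h3
    -- A leaf that is not good remains so.
    by_cases hgood : L.IsGood ν i A
    swap
    · have : ∀ x, shapePot ν i B c A (L.addCandidate x) = shapePot ν i B c A L := fun x => by
        simp [shapePot, Leaf.goodProb, hiff, hgood]
      simp only [this, setLIntegral_const, hPA]
      rw [mul_comm]
    set g : ℝ := (1 / 2) ^ (m - L.num) with hg
    have hg2 : (1 / 2 : ℝ) ^ (m - (L.num + 1)) = 2 * g := by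
      have : m - L.num = (m - (L.num + 1)) + 1 := by omega
      rw [hg, this, pow_succ]; ring
    have hg2le : 2 * g ≤ 1 := by rw [← hg2]; exact pow_le_one₀ (by norm_num) (by norm_num)
    have hg0 : 0 ≤ g := by positivity
    set K₁ : ℝ := V + 1 / 4 * (w * (c - 2 * g)) with hK₁
    set K₂ : ℝ := V + 1 / 4 * (w * c) with hK₂
    have hK₁0 : 0 ≤ K₁ := shapePot_arg_nonneg i B hc0 A hg2le
    have hK₂0 : 0 ≤ K₂ := by have := impurity_nonneg ν B A; positivity
    set G : Set (Feat D) := {x | GoodPt ν A i x} with hG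
    have hGm : MeasurableSet G := measurableSet_goodPt ν hA i
    have hval₁ : ∀ z : Feat D × Fin C, z.1 ∈ G →
        shapePot ν i B c A (L.addCandidate z.1) = ENNReal.ofReal K₁ := fun z hz => by
      have : (L.addCandidate z.1).IsGood ν i A := (hiff _).2 ⟨hgood, hz⟩
      simp only [shapePot, Leaf.goodProb, this, if_true, hnum', hg2]
      rfl
    have hval₂ : ∀ z : Feat D × Fin C, z.1 ∉ G →
        shapePot ν i B c A (L.addCandidate z.1) = ENNReal.ofReal K₂ := fun z hz => by
      have : ¬ (L.addCandidate z.1).IsGood ν i A := fun h => hz ((hiff _).1 h).2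
      simp only [shapePot, Leaf.goodProb, this, if_false, sub_zero]
      rfl
    have hsplit : (Prod.fst ⁻¹' A : Set (Feat D × Fin C))
        = (Prod.fst ⁻¹' (A ∩ G)) ∪ (Prod.fst ⁻¹' (A \ G)) := by
      rw [← Set.preimage_union, Set.inter_union_sdiff]
    have hdisj : Disjoint (Prod.fst ⁻¹' (A ∩ G) : Set (Feat D × Fin C)) (Prod.fst ⁻¹' (A \ G)) :=
      Disjoint.preimage _ (Set.disjoint_left.2 fun x h h' => h'.2 h.2)
    have hm₁ := hA.inter hGm
    have hm₂ := hA.diff hGm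
    rw [hsplit, lintegral_union (measurable_fst hm₂) hdisj,
      setLIntegral_congr_fun (measurable_fst hm₁) (fun z hz => hval₁ z hz.2),
      setLIntegral_congr_fun (measurable_fst hm₂) (fun z hz => hval₂ z hz.2),
      setLIntegral_const, setLIntegral_const, ← Measure.fst_apply hm₁, ← Measure.fst_apply hm₂,
      ← hνdef]
    have hpot : shapePot ν i B c A L = ENNReal.ofReal (V + 1 / 4 * (w * (c - g))) := by
      simp only [shapePot, Leaf.goodProb, hgood, if_true]
      rfl
    rw [hpot, ← ofReal_measureReal (μ := ν) (s := A), ← ofReal_measureReal (μ := ν) (s := A ∩ G),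
      ← ofReal_measureReal (μ := ν) (s := A \ G), ← ENNReal.ofReal_mul hK₁0,
      ← ENNReal.ofReal_mul hK₂0, ← ENNReal.ofReal_mul measureReal_nonneg,
      ← ENNReal.ofReal_add (by positivity) (by positivity)]
    refine ENNReal.ofReal_le_ofReal ?_
    have e1 : ν.real A = ν.real (A ∩ G) + ν.real (A \ G) := (measureReal_inter_add_sdiff hGm).symm
    have e2 : ν.real A ≤ 2 * ν.real (A ∩ G) := by
      have := ENNReal.toReal_mono (by finiteness) (measure_le_two_mul_goodPt ν hν hA i)
      simpa [Measure.real] using this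
    have e3 : ν.real (A \ G) ≤ ν.real (A ∩ G) := by linarith
    rw [e1, hK₁, hK₂]
    nlinarith [mul_nonneg (mul_nonneg hw0 hg0) (sub_nonneg.2 e3)]
  · intro z hz L' hL' S hS
    simp only [Leaf.validSplits, Finset.mem_filter] at hS
    set A₁ := A ∩ {x | x S.2 ≤ L'.threshold S} with hA₁
    set A₂ := A ∩ {x | L'.threshold S < x S.2} with hA₂
    have hint : ∫⁻ dl, ∫⁻ dr, (shapeNode ν B c A +
        (shapePot ν i B c A₁ (newLeaf Q.rule (L'.depth + 1) dl
          (L'.candEst S false) (L'.candStat S false))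
        + shapePot ν i B c A₂ (newLeaf Q.rule (L'.depth + 1) dr
          (L'.candEst S true) (L'.candStat S true)))) ∂dimsLaw D rate ∂dimsLaw D rate
        = shapeNode ν B c A + (ENNReal.ofReal (impurity ν B A₁)
          + ENNReal.ofReal (impurity ν B A₂)) := by
      have h1 : ∀ dl, ∫⁻ dr, (shapeNode ν B c A +
          (shapePot ν i B c A₁ (newLeaf Q.rule (L'.depth + 1) dl
            (L'.candEst S false) (L'.candStat S false))
          + shapePot ν i B c A₂ (newLeaf Q.rule (L'.depth + 1) dr
            (L'.candEst S true) (L'.candStat S true)))) ∂dimsLaw D rate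
          = shapeNode ν B c A + (shapePot ν i B c A₁ (newLeaf Q.rule (L'.depth + 1) dl
            (L'.candEst S false) (L'.candStat S false)) + ENNReal.ofReal (impurity ν B A₂)) := by
        intro dl
        rw [lintegral_add_left measurable_const, lintegral_add_left measurable_const,
          lintegral_shapePot_newLeaf]
        simp
      simp only [h1]
      rw [lintegral_add_left measurable_const, lintegral_add_right _ measurable_const,
        lintegral_shapePot_newLeaf]
      simp
    rw [hint]
    unfold shapeNode shapePot
    have hn1 := impurity_nonneg ν B A₁
    have hn2 := impurity_nonneg ν B A₂
    rw [← ENNReal.ofReal_add hn1 hn2,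
      ← ENNReal.ofReal_add (by positivity) (by positivity)]
    refine ENNReal.ofReal_le_ofReal ?_
    by_cases hgood : L'.IsGood ν i A
    -- Whichever candidate split of a good leaf is chosen, it is a good one.
    · have hi : S.2 = i := by
        have := hS.2.1.2
        rw [hgood.1, Finset.mem_singleton] at this
        exact this
      have hgp : GoodPt ν A i (L'.pt S.1) := hgood.2 S.1 hS.2.1.1
      have h1 := impurity_good_split_le ν hgp b
      have h2 : impurity ν B A₁ + impurity ν B A₂ ≤ V - 1 / 4 * w := by
        simp only [hA₁, hA₂, Leaf.threshold, hi]
        exact h1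
      have h3 : L'.goodProb ν i A ≤ 1 := Leaf.goodProb_le_one i A L'
      change 1 / 4 * (w * c) + _ ≤ V + 1 / 4 * (w * (c - _))
      nlinarith [mul_nonneg hw0 (sub_nonneg.2 h3)]
    · have h1 := impurity_split_le ν B A S.2 (L'.threshold S)
      have h3 : L'.goodProb ν i A = 0 := by simp [Leaf.goodProb, hgood]
      rw [h3, sub_zero, add_comm]
      gcongr

/-- The expected total decrease of impurity at the inner nodes is bounded, uniformly in time. -/
theorem lintegral_total_impurityDrop_le (P : Measure (Feat D × Fin C)) [IsProbabilityMeasure P]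
    (hν : ∀ d θ, P.fst {x : Feat D | x d = θ} = 0) (p : unitInterval) (rate : ℝ≥0)
    (Q : Params m D C 𝒮) (i : Fin D) (b : ℝ) (t : ℕ) :
    ∫⁻ h, (histTree Q h t).total (shapeNode P.fst {x | x i ≤ b} (goodRate m rate i))
      (fun _ _ => 0) Set.univ ∂histLaw P p rate ≤ 1 := by
  have hB : MeasurableSet {x : Feat D | x i ≤ b} := measurableSet_coord_le i b
  have h := lintegral_total_le Q P p rate (I := fun _ _ => True) (fun _ => trivial)
    (fun _ _ _ _ _ _ _ => Tree.allLeaves_of_forall (fun _ _ => trivial) _ _)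
    (fun A hA => measurable_shapeNode P.fst hB (goodRate m rate i) hA)
    (measPot_shapePot P.fst i hB _)
    (fun A L hA _ => shapePot_leaf_le P hν p rate Q i b A L hA) t
  rw [lintegral_shapePot_newLeaf] at h
  refine le_trans (lintegral_mono fun h => ?_) (h.trans ?_)
  · exact Tree.total_mono (I := fun _ _ => True) (fun _ => le_rfl) (fun _ _ _ => zero_le) _ _
      (Tree.allLeaves_of_forall (fun _ _ => trivial) _ _)
  · rw [ENNReal.ofReal_le_one]
    refine (impurity_le P.fst _ _).trans ?_
    exact measureReal_le_one

end Shape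

section Purity

variable {m D C : ℕ} {𝒮 : Type*} [MeasurableSpace 𝒮]

/-! ### The cells become pure for half spaces -/

/-- The depths recorded in the leaves are the true depths, if the root has depth `k`. -/
def Tree.DepthsFrom : ℕ → Tree m D C 𝒮 → Prop
  | k, .leaf L => L.depth = k
  | k, .node _ _ l r => l.DepthsFrom (k + 1) ∧ r.DepthsFrom (k + 1)

theorem Leaf.addStructure_depth (R : SplitRule m D C 𝒮) (L : Leaf m D C 𝒮) (z : Feat D × Fin C) :
    ((L.addCandidate z.1).addStructure R z).depth = L.depth :=
  L.addCandidate_depth z.1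

theorem Tree.DepthsFrom.step (Q : Params m D C 𝒮) (z : Feat D × Fin C) (u : Draw D)
    {T : Tree m D C 𝒮} {k : ℕ} (hT : T.DepthsFrom k) : (T.step Q z u).DepthsFrom k := by
  induction T generalizing k with
  | leaf L =>
    have hT' : L.depth = k := hT
    simp only [Tree.step, Leaf.step]
    split_ifs
    · exact hT
    · unfold Leaf.trySplit
      split_ifs
      · simp only [Tree.DepthsFrom, newLeaf, Leaf.addStructure_depth, hT', and_self]
      · simp only [Tree.DepthsFrom, Leaf.addStructure_depth, hT']
  | node d θ l r hl hr =>
    simp only [Tree.step]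
    split_ifs
    · exact ⟨hl hT.1, hT.2⟩
    · exact ⟨hT.1, hr hT.2⟩

theorem histTree_depthsFrom (Q : Params m D C 𝒮) (h : Hist D C) (t : ℕ) :
    (histTree Q h t).DepthsFrom 0 := by
  induction t with
  | zero => rfl
  | succ t ih => exact ih.step Q _ _

/-- The mass of the cell if the leaf has depth less than `N`, and `0` otherwise. -/
noncomputable def massBelow (ν : Measure (Feat D)) (N : ℕ) (A : Set (Feat D))
    (L : Leaf m D C 𝒮) : ℝ≥0∞ := if L.depth < N then ν A else 0

/-- The impurity of the cell of a leaf as an additive functional. -/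
noncomputable def leafImpurity (ν : Measure (Feat D)) (B A : Set (Feat D)) (_ : Leaf m D C 𝒮) :
    ℝ≥0∞ := ENNReal.ofReal (impurity ν B A)

theorem measPot_massBelow {Ω : Type*} [MeasurableSpace Ω] (ν : Measure (Feat D)) [SFinite ν]
    (N : ℕ) : MeasPot Ω (massBelow ν N : Set (Feat D) → Leaf m D C 𝒮 → ℝ≥0∞) := fun _ _ hL hA =>
  Measurable.ite (measurableSet_lt hL.depth measurable_const) (hA.measurable_measure ν)
    measurable_const

theorem measPot_leafImpurity {Ω : Type*} [MeasurableSpace Ω] (ν : Measure (Feat D))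
    [IsFiniteMeasure ν] {B : Set (Feat D)} (hB : MeasurableSet B) :
    MeasPot Ω (leafImpurity ν B : Set (Feat D) → Leaf m D C 𝒮 → ℝ≥0∞) := fun _ _ _ hA =>
  (measurable_impurity ν hB hA).ennreal_ofReal

theorem measure_split (ν : Measure (Feat D)) (A : Set (Feat D)) (d : Fin D) (θ : ℝ) :
    ν A = ν (A ∩ {x | x d ≤ θ}) + ν (A ∩ {x | θ < x d}) := by
  have : A ∩ {x | θ < x d} = A \ {x | x d ≤ θ} := by
    ext x; simp
  rw [this, measure_inter_add_sdiff _ (measurableSet_coord_le d θ)]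

theorem total_leafImpurity_le (ν : Measure (Feat D)) [IsFiniteMeasure ν] (B : Set (Feat D))
    (T : Tree m D C 𝒮) (A : Set (Feat D)) :
    T.total (fun _ => 0) (leafImpurity ν B) A ≤ ENNReal.ofReal (impurity ν B A) := by
  induction T generalizing A with
  | leaf L => exact le_rfl
  | node d θ l r hl hr =>
    simp only [Tree.total, zero_add]
    refine (add_le_add (hl _) (hr _)).trans ?_
    rw [← ENNReal.ofReal_add (impurity_nonneg ν B _) (impurity_nonneg ν B _)]
    exact ENNReal.ofReal_le_ofReal (impurity_split_le ν B A d θ)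

/-- A leaf of depth at least `N` has `N` ancestors, each at least as impure as the leaves below it;
their impurities are controlled by the decreases of impurity along the tree. -/
theorem mul_total_leafImpurity_le (ν : Measure (Feat D)) [IsFiniteMeasure ν] (B : Set (Feat D))
    {δ : ℝ} (hδ : 0 < δ) (N : ℕ) {k : ℕ} {T : Tree m D C 𝒮} (hT : T.DepthsFrom k)
    (A : Set (Feat D)) :
    ((N - k : ℕ) : ℝ≥0∞) * T.total (fun _ => 0) (leafImpurity ν B) A
      ≤ ((N - k : ℕ) : ℝ≥0∞) * T.total (fun _ => 0) (massBelow ν N) A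
        + (((N - k : ℕ) : ℝ≥0∞) * (ENNReal.ofReal δ * ν A)
        + ENNReal.ofReal δ⁻¹ *
          T.total (fun A => ENNReal.ofReal (impurityDrop ν B A)) (fun _ _ => 0) A) := by
  induction T generalizing A k with
  | leaf L =>
    have hk : L.depth = k := hT
    rcases le_or_gt N k with h | h
    · simp [Nat.sub_eq_zero_of_le h]
    · refine le_add_right (mul_le_mul_right ?_ _)
      simp only [Tree.total, leafImpurity, massBelow, hk, h, if_true]
      rw [← ofReal_measureReal]
      exact ENNReal.ofReal_le_ofReal (impurity_le ν B A)
  | node d θ l r hl hr =>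
    rcases le_or_gt N k with h | h
    · simp [Nat.sub_eq_zero_of_le h]
    have hNk : ((N - k : ℕ) : ℝ≥0∞) = ((N - (k + 1) : ℕ) : ℝ≥0∞) + 1 := by
      rw [show N - k = (N - (k + 1)) + 1 by omega]
      push_cast
      rfl
    have h1 := hl hT.1 (A ∩ {x | x d ≤ θ})
    have h2 := hr hT.2 (A ∩ {x | θ < x d})
    have h3 := total_leafImpurity_le ν B (.node d θ l r : Tree m D C 𝒮) A
    have h4 : ENNReal.ofReal (impurity ν B A) ≤ ENNReal.ofReal δ * ν A
        + ENNReal.ofReal δ⁻¹ * ENNReal.ofReal (impurityDrop ν B A) := by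
      rw [← ofReal_measureReal (μ := ν) (s := A), ← ENNReal.ofReal_mul hδ.le,
        ← ENNReal.ofReal_mul (by positivity), ← ENNReal.ofReal_add (by positivity)
          (mul_nonneg (by positivity) (impurityDrop_nonneg ν B A))]
      exact ENNReal.ofReal_le_ofReal (impurity_le_add_drop ν B A hδ)
    have h5 := measure_split ν A d θ
    rw [hNk]
    set n : ℝ≥0∞ := ((N - (k + 1) : ℕ) : ℝ≥0∞)
    rw [add_mul, one_mul, add_mul n, one_mul, add_mul n, one_mul]
    refine (add_le_add_right (h3.trans h4) _).trans ?_
    simp only [Tree.total, zero_add, mul_add] at h1 h2 ⊢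
    rw [show n * (ENNReal.ofReal δ * ν A) = n * (ENNReal.ofReal δ * ν (A ∩ {x | x d ≤ θ}))
      + n * (ENNReal.ofReal δ * ν (A ∩ {x | θ < x d})) by rw [h5]; ring]
    refine (add_le_add_left (add_le_add h1 h2) _).trans ?_
    set a := n * Tree.total (fun _ => 0) (massBelow ν N) l (A ∩ {x | x d ≤ θ})
    set b := n * Tree.total (fun _ => 0) (massBelow ν N) r (A ∩ {x | θ < x d})
    have h6 : a + b ≤ a + b + (Tree.total (fun _ => 0) (massBelow ν N) l (A ∩ {x | x d ≤ θ})
      + Tree.total (fun _ => 0) (massBelow ν N) r (A ∩ {x | θ < x d})) := le_self_add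
    refine le_trans (le_of_eq ?_) (add_le_add_left h6 _)
    ring

variable (P : Measure (Feat D × Fin C)) [IsProbabilityMeasure P] (p : unitInterval) (rate : ℝ≥0)
  (Q : Params m D C 𝒮)

/-- The expected mass of the leaves of depth less than `N`. -/
noncomputable def shallowMass (N t : ℕ) : ℝ≥0∞ :=
  ∫⁻ h, (histTree Q h t).total (fun _ => 0) (massBelow P.fst N) Set.univ ∂histLaw P p rate

/-- The expected impurity of the leaves. -/
noncomputable def meanImpurity (B : Set (Feat D)) (t : ℕ) : ℝ≥0∞ :=
  ∫⁻ h, (histTree Q h t).total (fun _ => 0) (leafImpurity P.fst B) Set.univ ∂histLaw P p rate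

/-- Half spaces become pure. At depth `N` the mean impurity is at most `δ`, plus the mass of the
leaves above depth `N`, plus a bounded total drop divided by `δ N`. -/
theorem tendsto_meanImpurity_halfSpace
    (hν : ∀ d θ, P.fst {x : Feat D | x d = θ} = 0)
    (hdepth : ∀ N, Tendsto (shallowMass P p rate Q N) atTop (𝓝 0)) (i : Fin D) (b : ℝ) :
    Tendsto (meanImpurity P p rate Q {x | x i ≤ b}) atTop (𝓝 0) := by
  set B : Set (Feat D) := {x | x i ≤ b} with hBdef
  have hB : MeasurableSet B := measurableSet_coord_le i b
  set c := goodRate m rate i with hc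
  have hc0 : 0 < c := goodRate_pos m rate i
  set K : ℝ≥0∞ := ENNReal.ofReal (4 / c) with hK
  have hdrop : ∀ t, ∫⁻ h, (histTree Q h t).total
      (fun A => ENNReal.ofReal (impurityDrop P.fst B A)) (fun _ _ => 0) Set.univ ∂histLaw P p rate
        ≤ K := by
    intro t
    have h1 := lintegral_total_impurityDrop_le P hν p rate Q i b t
    have h2 : ∀ h, (histTree Q h t).total (fun A => ENNReal.ofReal (impurityDrop P.fst B A))
        (fun _ _ => 0) Set.univ
        = K * (histTree Q h t).total (shapeNode P.fst B c) (fun _ _ => 0) Set.univ := by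
      intro h
      rw [← Tree.total_const_mul]
      simp only [mul_zero]
      congr 1
      funext A
      rw [shapeNode, hK, ← ENNReal.ofReal_mul (by positivity)]
      congr 1
      field_simp
    simp only [h2]
    rw [lintegral_const_mul' _ _ ENNReal.ofReal_ne_top]
    exact (mul_le_mul_right h1 _).trans (by rw [mul_one])
  have hmain : ∀ (δ : ℝ), 0 < δ → ∀ N t : ℕ, (N : ℝ≥0∞) * meanImpurity P p rate Q B t
      ≤ N * shallowMass P p rate Q N t + (N * ENNReal.ofReal δ + ENNReal.ofReal δ⁻¹ * K) := by
    intro δ hδ N t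
    have hm1 : Measurable fun h : Hist D C =>
        (histTree Q h t).total (fun _ => 0) (massBelow P.fst N) Set.univ :=
      (histTree_measTree Q measurable_id t).measurable_total (fun _ _ => measurable_const)
        (measPot_massBelow P.fst N) (.const MeasurableSet.univ)
    unfold meanImpurity shallowMass
    rw [← lintegral_const_mul' _ _ (by simp), ← lintegral_const_mul' _ _ (by simp)]
    refine (lintegral_mono fun h => mul_total_leafImpurity_le P.fst B hδ N
      (histTree_depthsFrom Q h t) Set.univ).trans ?_
    simp only [Nat.sub_zero, measure_univ, mul_one]
    rw [lintegral_add_left (hm1.const_mul _), lintegral_add_left measurable_const,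
      lintegral_const, measure_univ, mul_one, lintegral_const_mul' _ _ ENNReal.ofReal_ne_top]
    gcongr
    exact hdrop t
  rw [ENNReal.tendsto_nhds_zero]
  intro ε hε
  obtain ⟨ε', hε', hεε'⟩ : ∃ r : ℝ, 0 < r ∧ ENNReal.ofReal r ≤ ε := by
    rcases eq_or_ne ε ∞ with rfl | h
    · exact ⟨1, one_pos, le_top⟩
    · exact ⟨ε.toReal, ENNReal.toReal_pos hε.ne' h, by rw [ENNReal.ofReal_toReal h]⟩
  set δ := ε' / 3 with hδ
  have hδ0 : 0 < δ := by positivity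
  -- For this `N` the bound `δ⁻¹ * K` for the drops, divided by `N`, is at most `δ`.
  obtain ⟨N, hN⟩ := exists_nat_gt (δ⁻¹ * (4 / c) / δ)
  have hN0 : 0 < N := by
    have : (0 : ℝ) < N := lt_of_le_of_lt (by positivity) hN
    exact_mod_cast this
  filter_upwards [(ENNReal.tendsto_nhds_zero.1 (hdepth N)) (ENNReal.ofReal δ) (by simpa using hδ0)]
    with t ht
  have h1 := hmain δ hδ0 N t
  have h2 : ENNReal.ofReal δ⁻¹ * K ≤ N * ENNReal.ofReal δ := by
    rw [hK, ← ENNReal.ofReal_mul (by positivity), ← ENNReal.ofReal_natCast,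
      ← ENNReal.ofReal_mul (by positivity)]
    refine ENNReal.ofReal_le_ofReal ?_
    rw [div_lt_iff₀ hδ0] at hN
    exact hN.le
  have h3 : (N : ℝ≥0∞) * meanImpurity P p rate Q B t ≤ N * ENNReal.ofReal ε' := by
    refine h1.trans ((add_le_add (mul_le_mul_right ht _) (add_le_add le_rfl h2)).trans
      (le_of_eq ?_))
    rw [← mul_add, ← mul_add, ← ENNReal.ofReal_add hδ0.le hδ0.le,
      ← ENNReal.ofReal_add hδ0.le (by positivity)]
    congr 2
    rw [hδ]; ring
  exact ((ENNReal.mul_le_mul_iff_right (by exact_mod_cast hN0.ne') (by simp)).1 h3).trans hεε'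

end Purity

section Estimation

variable {m D C : ℕ} {𝒮 : Type*} [MeasurableSpace 𝒮]

/-! ### Class frequencies concentrate in all cells of large depth -/

/-- The measure `A ↦ P(X ∈ A, Y = k)`. -/
noncomputable def classMass (P : Measure (Feat D × Fin C)) (k : Fin C) : Measure (Feat D) :=
  (P.restrict (Prod.snd ⁻¹' {k})).fst

/-- The conditional probability `P(Y = k | X ∈ A)`. -/
noncomputable def classFrac (P : Measure (Feat D × Fin C)) (k : Fin C) (A : Set (Feat D)) : ℝ :=
  (classMass P k).real A / P.fst.real A

/-- The exponential weight of a class histogram with respect to the class probability `q`. -/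
noncomputable def expWeight (s q : ℝ) (k : Fin C) (h : Fin C → ℕ) : ℝ≥0∞ :=
  ENNReal.ofReal (Real.exp (s * ((h k : ℝ) - q * ((∑ j, h j : ℕ) : ℝ))
    - s ^ 2 * ((∑ j, h j : ℕ) : ℝ)))

theorem classMass_apply (P : Measure (Feat D × Fin C)) (k : Fin C) {A : Set (Feat D)}
    (hA : MeasurableSet A) :
    classMass P k A = P (Prod.fst ⁻¹' A ∩ Prod.snd ⁻¹' {k}) := by
  rw [classMass, Measure.fst_apply hA, Measure.restrict_apply (measurable_fst hA)]

instance (P : Measure (Feat D × Fin C)) [IsFiniteMeasure P] (k : Fin C) :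
    IsFiniteMeasure (classMass P k) := by
  unfold classMass; infer_instance

theorem classMass_le (P : Measure (Feat D × Fin C)) (k : Fin C) : classMass P k ≤ P.fst :=
  Measure.map_mono_of_aemeasurable Measure.restrict_le_self measurable_fst.aemeasurable

theorem classFrac_nonneg (P : Measure (Feat D × Fin C)) (k : Fin C) (A : Set (Feat D)) :
    0 ≤ classFrac P k A := by
  unfold classFrac; positivity

theorem classFrac_le_one (P : Measure (Feat D × Fin C)) [IsFiniteMeasure P] (k : Fin C)
    (A : Set (Feat D)) : classFrac P k A ≤ 1 := by
  unfold classFrac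
  exact div_le_one_of_le₀ (ENNReal.toReal_mono (measure_ne_top _ _) (classMass_le P k A))
    measureReal_nonneg

/-- The moment generating function bound for a centered Bernoulli variable. -/
theorem bernoulli_exp_le {q s : ℝ} (hq0 : 0 ≤ q) (hq1 : q ≤ 1) (hs : |s| ≤ 1) :
    q * Real.exp (s * (1 - q) - s ^ 2) + (1 - q) * Real.exp (s * (0 - q) - s ^ 2) ≤ 1 := by
  have key : ∀ x : ℝ, |x| ≤ 1 → Real.exp x ≤ 1 + x + x ^ 2 := fun x hx => by
    have := (abs_le.1 (Real.abs_exp_sub_one_sub_id_le hx)).2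
    linarith
  have h1 := key (s * (1 - q)) (by
    rw [abs_mul]
    exact mul_le_one₀ hs (abs_nonneg _) (abs_le.2 ⟨by linarith, by linarith⟩))
  have h2 := key (s * (0 - q)) (by
    rw [abs_mul]
    exact mul_le_one₀ hs (abs_nonneg _) (abs_le.2 ⟨by linarith, by linarith⟩))
  have h3 : 1 + s ^ 2 ≤ Real.exp (s ^ 2) := by linarith [Real.add_one_le_exp (s ^ 2)]
  rw [Real.exp_sub, Real.exp_sub, ← mul_div_assoc, ← mul_div_assoc, ← add_div,
    div_le_one (Real.exp_pos _)]
  refine le_trans ?_ h3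
  have h4 := mul_le_mul_of_nonneg_left h1 hq0
  have h5 := mul_le_mul_of_nonneg_left h2 (sub_nonneg.2 hq1)
  have h6 : q * (1 - q) ≤ 1 := by nlinarith
  nlinarith [sq_nonneg s, mul_le_mul_of_nonneg_left h6 (sq_nonneg s)]

theorem expWeight_addLabel (s q : ℝ) (k y : Fin C) (h : Fin C → ℕ) :
    expWeight s q k (addLabel h y) = expWeight s q k h *
      ENNReal.ofReal (Real.exp (s * ((if y = k then 1 else 0) - q) - s ^ 2)) := by
  unfold expWeight
  rw [← ENNReal.ofReal_mul (Real.exp_pos _).le, ← Real.exp_add, sum_addLabel]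
  congr 2
  unfold addLabel
  split_ifs with h1 h2 h2
  · push_cast; ring
  · exact absurd h1.symm h2
  · exact absurd h2.symm h1
  · push_cast; ring

theorem expWeight_zero (s q : ℝ) (k : Fin C) : expWeight s q k (0 : Fin C → ℕ) = 1 := by
  simp [expWeight]

/-- In mean over a new point in the cell the exponential weight does not increase. -/
theorem setLIntegral_expWeight_le (P : Measure (Feat D × Fin C)) [IsFiniteMeasure P] (k : Fin C)
    {s : ℝ} (hs : |s| ≤ 1) (h : Fin C → ℕ) {A : Set (Feat D)} (hA : MeasurableSet A) :
    ∫⁻ z in Prod.fst ⁻¹' A, expWeight s (classFrac P k A) k (addLabel h z.2) ∂P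
      ≤ P.fst A * expWeight s (classFrac P k A) k h := by
  set q := classFrac P k A with hq
  have hA' : MeasurableSet (Prod.fst ⁻¹' A : Set (Feat D × Fin C)) := measurable_fst hA
  have hk : MeasurableSet (Prod.snd ⁻¹' {k} : Set (Feat D × Fin C)) :=
    measurable_snd (measurableSet_singleton k)
  rcases eq_or_ne (P.fst A) 0 with h0 | h0
  · rw [h0, zero_mul]
    refine le_of_eq (setLIntegral_measure_zero _ _ ?_)
    rwa [← Measure.fst_apply hA]
  simp only [expWeight_addLabel]
  have hfin : expWeight s q k h ≠ ∞ := ENNReal.ofReal_ne_top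
  rw [lintegral_const_mul' _ _ hfin, mul_comm]
  refine mul_le_mul_left ?_ _
  rw [← lintegral_inter_add_sdiff _ _ hk]
  rw [setLIntegral_congr_fun (g := fun _ => ENNReal.ofReal (Real.exp (s * (1 - q) - s ^ 2)))
      (hA'.inter hk) (fun z hz => by
        have : z.2 = k := hz.2
        simp [this]),
    setLIntegral_congr_fun (g := fun _ => ENNReal.ofReal (Real.exp (s * (0 - q) - s ^ 2)))
      (hA'.diff hk) (fun z hz => by
        have : z.2 ≠ k := hz.2
        simp [this]),
    setLIntegral_const, setLIntegral_const, ← classMass_apply P k hA]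
  have ha : 0 < P.fst.real A := ENNReal.toReal_pos h0 (measure_ne_top _ _)
  have e1 : (classMass P k).real A = q * P.fst.real A := by
    rw [hq, classFrac, div_mul_cancel₀ _ ha.ne']
  have e2 : P.real (Prod.fst ⁻¹' A \ Prod.snd ⁻¹' {k}) = (1 - q) * P.fst.real A := by
    have h1 := measureReal_inter_add_sdiff (μ := P) (s := Prod.fst ⁻¹' A) hk
    have h2 : P.real (Prod.fst ⁻¹' A ∩ Prod.snd ⁻¹' {k}) = (classMass P k).real A := by
      simp only [Measure.real, classMass_apply P k hA]
    have h3 : P.real (Prod.fst ⁻¹' A) = P.fst.real A := by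
      simp only [Measure.real, Measure.fst_apply hA]
    rw [h2, h3, e1] at h1
    linarith
  have hq0 : 0 ≤ q := classFrac_nonneg P k A
  have hq1 : q ≤ 1 := classFrac_le_one P k A
  rw [← ofReal_measureReal (μ := classMass P k), ← ofReal_measureReal (μ := P),
    ← ofReal_measureReal (μ := P.fst), e1, e2, ← ENNReal.ofReal_mul (Real.exp_pos _).le,
    ← ENNReal.ofReal_mul (Real.exp_pos _).le, ← ENNReal.ofReal_add (by positivity)
      (mul_nonneg (Real.exp_pos _).le (mul_nonneg (sub_nonneg.2 hq1) ha.le))]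
  refine ENNReal.ofReal_le_ofReal ?_
  have := bernoulli_exp_le hq0 hq1 hs
  nlinarith [mul_le_mul_of_nonneg_right this ha.le]

/-- The cell of the child `b` of the candidate split `S`. -/
def childCell (A : Set (Feat D)) (L : Leaf m D C 𝒮) (S : Cand m D) (b : Bool) : Set (Feat D) :=
  {x | x ∈ A ∧ L.InChild S b x}

theorem childCell_false {A : Set (Feat D)} {L : Leaf m D C 𝒮} {S : Cand m D} (hS : L.IsCand S) :
    childCell A L S false = A ∩ {x | x S.2 ≤ L.threshold S} := by
  ext x; simp [childCell, Leaf.InChild, hS]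

theorem childCell_true {A : Set (Feat D)} {L : Leaf m D C 𝒮} {S : Cand m D} (hS : L.IsCand S) :
    childCell A L S true = A ∩ {x | L.threshold S < x S.2} := by
  ext x; simp [childCell, Leaf.InChild, hS]

theorem MeasCell.childCell {Ω : Type*} [MeasurableSpace Ω] {A : Ω → Set (Feat D)}
    (hA : MeasCell A) {L : Ω → Leaf m D C 𝒮} (hL : MeasLeaf L) (S : Cand m D) (b : Bool) :
    MeasCell fun ω => childCell (A ω) (L ω) S b :=
  MeasurableSet.inter hA
    ((hL.comp measurable_fst).measurableSet_inChild S b measurable_snd)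

open Classical in
/-- The exponential weight of a candidate child; it is `1` if the candidate split has not yet
been created. -/
noncomputable def candWeight (P : Measure (Feat D × Fin C)) (s : ℝ) (k : Fin C) (A : Set (Feat D))
    (L : Leaf m D C 𝒮) (S : Cand m D) (b : Bool) : ℝ≥0∞ :=
  if L.IsCand S then expWeight s (classFrac P k (childCell A L S b)) k (L.candEst S b) else 1

/-- The contribution of a leaf to the estimation potential.  A cell of depth `d` has the factor
`c d`; the last term accounts for the cells of larger depth that are still to come. -/
noncomputable def estPot (P : Measure (Feat D × Fin C)) (s : ℝ) (k : Fin C) (c : ℕ → ℝ≥0∞)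
    (A : Set (Feat D)) (L : Leaf m D C 𝒮) : ℝ≥0∞ :=
  P.fst A * (c L.depth * expWeight s (classFrac P k A) k L.est +
    (c (L.depth + 1) * ∑ S : Cand m D, ∑ b : Bool, candWeight P s k A L S b +
      Fintype.card (Cand m D × Bool) * ∑' j, c (L.depth + 2 + j)))

theorem measurable_expWeight {Ω : Type*} [MeasurableSpace Ω] (s : ℝ) (k : Fin C) {q : Ω → ℝ}
    (hq : Measurable q) {h : Ω → Fin C → ℕ} (hh : ∀ k, Measurable fun ω => h ω k) :
    Measurable fun ω => expWeight s (q ω) k (h ω) := by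
  have h1 : ∀ k, Measurable fun ω => (h ω k : ℝ) := fun k =>
    (measurable_from_nat (f := fun n : ℕ => (n : ℝ))).comp (hh k)
  have h2 : Measurable fun ω => ((∑ j, h ω j : ℕ) : ℝ) :=
    (measurable_from_nat (f := fun n : ℕ => (n : ℝ))).comp
      (Finset.measurable_sum _ fun k _ => hh k)
  exact ((((h1 k).sub (hq.mul h2)).const_mul s).sub (h2.const_mul (s ^ 2))).exp.ennreal_ofReal

theorem measurable_classFrac {Ω : Type*} [MeasurableSpace Ω] (P : Measure (Feat D × Fin C))
    [IsFiniteMeasure P] (k : Fin C) {A : Ω → Set (Feat D)} (hA : MeasCell A) :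
    Measurable fun ω => classFrac P k (A ω) :=
  (hA.measurable_measure (classMass P k)).ennreal_toReal.div
    (hA.measurable_measure P.fst).ennreal_toReal

theorem measPot_candWeight {Ω : Type*} [MeasurableSpace Ω] (P : Measure (Feat D × Fin C))
    [IsFiniteMeasure P] (s : ℝ) (k : Fin C) (S : Cand m D) (b : Bool) :
    MeasPot Ω fun A (L : Leaf m D C 𝒮) => candWeight P s k A L S b := fun _ _ hL hA =>
  Measurable.ite (hL.measurableSet_isCand S) (measurable_expWeight s k
    (measurable_classFrac P k (hA.childCell hL S b)) fun k => hL.candEst S b k) measurable_const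

theorem measPot_estPot {Ω : Type*} [MeasurableSpace Ω] (P : Measure (Feat D × Fin C))
    [IsFiniteMeasure P] (s : ℝ) (k : Fin C) (c : ℕ → ℝ≥0∞) :
    MeasPot Ω (estPot P s k c : Set (Feat D) → Leaf m D C 𝒮 → ℝ≥0∞) := fun L A hL hA => by
  have hd : ∀ f : ℕ → ℝ≥0∞, Measurable fun ω => f (L ω).depth := fun f =>
    (measurable_from_nat (f := f)).comp hL.depth
  refine (hA.measurable_measure P.fst).mul (((hd c).mul (measurable_expWeight s k
    (measurable_classFrac P k hA) fun k => hL.est k)).add (((hd fun d => c (d + 1)).mul ?_).add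
    ((hd fun d => ∑' j, c (d + 2 + j)).const_mul _)))
  exact Finset.measurable_sum _ fun S _ => Finset.measurable_sum _ fun b _ =>
    measPot_candWeight P s k S b L A hL hA

theorem tsum_tail (c : ℕ → ℝ≥0∞) (n : ℕ) : c n + ∑' j, c (n + 1 + j) = ∑' j, c (n + j) := by
  rw [tsum_eq_zero_add' (f := fun j => c (n + j)) ENNReal.summable]
  simp only [add_zero]
  congr 1
  exact tsum_congr fun j => by congr 1; omega

theorem estPot_newLeaf (P : Measure (Feat D × Fin C)) (s : ℝ) (k : Fin C) (c : ℕ → ℝ≥0∞)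
    (A : Set (Feat D)) (R : SplitRule m D C 𝒮) (d : ℕ) (dims : Finset (Fin D)) (est : Fin C → ℕ)
    (stat : 𝒮) :
    estPot P s k c A (newLeaf R d dims est stat)
      = P.fst A * (c d * expWeight s (classFrac P k A) k est
        + Fintype.card (Cand m D × Bool) * ∑' j, c (d + 1 + j)) := by
  have h : ∀ S b, candWeight P s k A (newLeaf R d dims est stat) S b = 1 := fun S b => by
    have : ¬ (newLeaf R d dims est stat).IsCand S := fun h => by
      simpa [newLeaf] using h.1
    simp [candWeight, this]
  have h2 : ∑ S : Cand m D, ∑ b : Bool, candWeight P s k A (newLeaf R d dims est stat) S b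
      = Fintype.card (Cand m D × Bool) := by
    simp [h]
  rw [estPot, h2, ← tsum_tail c (d + 1)]
  simp only [newLeaf]
  ring

theorem setLIntegral_candWeight_le (P : Measure (Feat D × Fin C)) [IsFiniteMeasure P] (k : Fin C)
    {s : ℝ} (hs : |s| ≤ 1) {A : Set (Feat D)} (hA : MeasurableSet A) (L : Leaf m D C 𝒮)
    (S : Cand m D) (b : Bool) :
    ∫⁻ z in Prod.fst ⁻¹' A, candWeight P s k A (L.addEstimation z) S b ∂P
      ≤ P.fst A * candWeight P s k A L S b := by
  classical
  by_cases hS : L.IsCand S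
  swap
  · have h1 : ∀ z, ¬ (L.addEstimation z).IsCand S := fun z => hS
    simp only [candWeight, h1, hS, if_false, setLIntegral_const, mul_one, one_mul,
      Measure.fst_apply hA]
    exact le_rfl
  set A' := childCell A L S b with hA'
  have hA'm : MeasurableSet A' := by
    have hcell : ∀ b, MeasurableSet (childCell A L S b) := fun b => by
      cases b
      · rw [childCell_false hS]; exact hA.inter (measurableSet_coord_le _ _)
      · rw [childCell_true hS]; exact hA.inter (measurableSet_coord_gt _ _)
    exact hcell b
  have hsub : A' ⊆ A := fun x hx => hx.1
  have h1 : ∀ z, (L.addEstimation z).IsCand S := fun z => hS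
  have h2 : ∀ z, childCell A (L.addEstimation z) S b = A' := fun z => rfl
  have h3 : ∀ z : Feat D × Fin C, z.1 ∈ A' →
      (L.addEstimation z).candEst S b = addLabel (L.candEst S b) z.2 := fun z hz => by
    have : L.InChild S b z.1 := hz.2
    simp [Leaf.addEstimation, this]
  have h4 : ∀ z : Feat D × Fin C, z.1 ∈ A \ A' →
      (L.addEstimation z).candEst S b = L.candEst S b := fun z hz => by
    have : ¬ L.InChild S b z.1 := fun h => hz.2 ⟨hz.1, h⟩
    simp [Leaf.addEstimation, this]
  simp only [candWeight, h1, hS, if_true, h2]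
  set q := classFrac P k A' with hq
  have hmA' : MeasurableSet (Prod.fst ⁻¹' A' : Set (Feat D × Fin C)) := measurable_fst hA'm
  have hmA : MeasurableSet (Prod.fst ⁻¹' A : Set (Feat D × Fin C)) := measurable_fst hA
  rw [← lintegral_inter_add_sdiff _ _ hmA', ← Set.preimage_inter, ← Set.preimage_sdiff,
    Set.inter_eq_right.2 hsub,
    setLIntegral_congr_fun hmA' (g := fun z => expWeight s q k (addLabel (L.candEst S b) z.2))
      (fun z hz => by simp only [h3 z hz]),
    setLIntegral_congr_fun (measurable_fst (hA.diff hA'm))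
      (g := fun z => expWeight s q k (L.candEst S b)) (fun z hz => by simp only [h4 z hz]),
    setLIntegral_const, ← Measure.fst_apply (hA.diff hA'm)]
  refine (add_le_add_left (setLIntegral_expWeight_le P k hs (L.candEst S b) hA'm) _).trans ?_
  rw [mul_comm (expWeight _ _ _ _) (P.fst (A \ A')), ← add_mul]
  refine mul_le_mul_left (le_of_eq ?_) _
  have := measure_inter_add_sdiff (μ := P.fst) A hA'm
  rwa [Set.inter_eq_right.2 hsub] at this

theorem candWeight_addCandidate (P : Measure (Feat D × Fin C)) (Q : Params m D C 𝒮) (k : Fin C)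
    (s : ℝ) (A : Set (Feat D)) {L : Leaf m D C 𝒮} (hL : L.Wf Q) (x : Feat D) (S : Cand m D)
    (b : Bool) : candWeight P s k A (L.addCandidate x) S b = candWeight P s k A L S b := by
  by_cases hS : L.IsCand S
  · have h1 : (L.addCandidate x).IsCand S := hS.addCandidate x
    have h2 : childCell A (L.addCandidate x) S b = childCell A L S b := by
      have : (L.addCandidate x).threshold S = L.threshold S := by
        simp only [Leaf.threshold, L.addCandidate_pt x hS.1]
      simp only [childCell, Leaf.InChild, this, h1, hS]
    simp only [candWeight, h1, hS, if_true, h2, Leaf.addCandidate_candEst]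
  · have h1 : (L.addCandidate x).candEst S b = 0 := by
      rw [Leaf.addCandidate_candEst]
      exact hL.candEst_eq_zero S b hS
    simp only [candWeight, hS, if_false, h1, expWeight_zero, ite_self]

/-- The estimation potential does not increase in mean at a leaf. The exponential weights of the
leaf and of all its candidate children are supermartingales; candidates start with an empty
histogram and hence with the weight `1` that was set aside for them; at a split the term for the cells
of larger depth provides the weights of the new candidates. -/
theorem estPot_leaf_le (P : Measure (Feat D × Fin C)) [IsProbabilityMeasure P] (p : unitInterval)
    (rate : ℝ≥0) (Q : Params m D C 𝒮) (k : Fin C) {s : ℝ} (hs : |s| ≤ 1) {c : ℕ → ℝ≥0∞}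
    (hc : ∀ d, c d ≠ ∞) (A : Set (Feat D)) (L : Leaf m D C 𝒮) (hA : MeasurableSet A)
    (hL : L.Wf Q) :
    ∫⁻ e in obsIn C A, (L.step Q e.1 e.2).total (fun _ => 0) (estPot P s k c) A ∂obsLaw P p rate
      ≤ P.fst A * estPot P s k c A L := by
  have hPA : P (Prod.fst ⁻¹' A) = P.fst A := (Measure.fst_apply hA).symm
  refine Leaf.setLIntegral_step_le Q P p rate (measPot_estPot P s k c) hA ?_ ?_ ?_
  · have hmL : MeasLeaf fun z : Feat D × Fin C => L.addEstimation z := by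
      refine MeasLeaf.addEstimation ?_ measurable_id
      constructor <;> intros <;> exact measurable_const
    have hmA : MeasCell fun _ : Feat D × Fin C => A := .const hA
    have hm1 : Measurable fun z : Feat D × Fin C =>
        c L.depth * expWeight s (classFrac P k A) k (L.addEstimation z).est :=
      (measurable_expWeight s k measurable_const fun k => hmL.est k).const_mul _
    have hm2 : ∀ S b, Measurable fun z : Feat D × Fin C =>
        candWeight P s k A (L.addEstimation z) S b := fun S b =>
      measPot_candWeight P s k S b _ _ hmL hmA
    have hm3 : Measurable fun z : Feat D × Fin C =>
        c (L.depth + 1) * ∑ S : Cand m D, ∑ b : Bool, candWeight P s k A (L.addEstimation z) S b :=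
      (Finset.measurable_sum _ fun S _ => Finset.measurable_sum _ fun b _ => hm2 S b).const_mul _
    change ∫⁻ z in Prod.fst ⁻¹' A, P.fst A *
      (c L.depth * expWeight s (classFrac P k A) k (L.addEstimation z).est +
      (c (L.depth + 1) * ∑ S : Cand m D, ∑ b : Bool, candWeight P s k A (L.addEstimation z) S b +
        Fintype.card (Cand m D × Bool) * ∑' j, c (L.depth + 2 + j))) ∂P ≤ _
    rw [lintegral_const_mul' _ _ (measure_ne_top _ _)]
    refine mul_le_mul_right ?_ _
    rw [lintegral_add_left hm1, lintegral_add_left hm3, setLIntegral_const, hPA,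
      lintegral_const_mul' _ _ (hc _), lintegral_const_mul' _ _ (hc _),
      lintegral_finsetSum _ fun S _ => Finset.measurable_sum _ fun b _ => hm2 S b]
    rw [estPot, mul_add, mul_add]
    refine add_le_add ?_ (add_le_add ?_ (by rw [mul_comm]))
    · rw [mul_left_comm]
      exact mul_le_mul_right (setLIntegral_expWeight_le P k hs L.est hA) _
    · rw [mul_left_comm]
      refine mul_le_mul_right ?_ _
      rw [Finset.mul_sum]
      refine Finset.sum_le_sum fun S _ => ?_
      rw [lintegral_finsetSum _ fun b _ => hm2 S b, Finset.mul_sum]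
      exact Finset.sum_le_sum fun b _ => setLIntegral_candWeight_le P k hs hA L S b
  · have : ∀ z : Feat D × Fin C, estPot P s k c A ((L.addCandidate z.1).addStructure Q.rule z)
        = estPot P s k c A L := fun z => by
      change estPot P s k c A (L.addCandidate z.1) = _
      simp only [estPot, L.addCandidate_depth, L.addCandidate_est,
        candWeight_addCandidate P Q k s A hL]
    simp only [this, setLIntegral_const, hPA]
    rw [mul_comm]
  · intro z hz L' hL' S hS
    simp only [Leaf.validSplits, Finset.mem_filter] at hS
    have hc1 : S ∈ (Finset.univ : Finset (Cand m D)) := Finset.mem_univ _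
    set A₁ := A ∩ {x | x S.2 ≤ L'.threshold S} with hA₁
    set A₂ := A ∩ {x | L'.threshold S < x S.2} with hA₂
    have hw₁ : candWeight P s k A L' S false
        = expWeight s (classFrac P k A₁) k (L'.candEst S false) := by
      simp only [candWeight, hS.2.1, if_true, childCell_false, hA₁]
    have hw₂ : candWeight P s k A L' S true
        = expWeight s (classFrac P k A₂) k (L'.candEst S true) := by
      simp only [candWeight, hS.2.1, if_true, childCell_true, hA₂]
    simp only [estPot_newLeaf, lintegral_const, measure_univ, mul_one, zero_add]
    rw [← hw₁, ← hw₂, show L'.depth + 1 + 1 = L'.depth + 2 by ring]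
    have hmass : P.fst A = P.fst A₁ + P.fst A₂ := measure_split P.fst A S.2 (L'.threshold S)
    have hsum : candWeight P s k A L' S false + candWeight P s k A L' S true
        ≤ ∑ S : Cand m D, ∑ b : Bool, candWeight P s k A L' S b := by
      refine le_trans (le_of_eq ?_) (Finset.single_le_sum (fun _ _ => zero_le) hc1)
      simp [add_comm]
    rw [estPot]
    set W₁ := candWeight P s k A L' S false
    set W₂ := candWeight P s k A L' S true
    set R := (Fintype.card (Cand m D × Bool) : ℝ≥0∞) * ∑' j, c (L'.depth + 2 + j)
    calc P.fst A₁ * (c (L'.depth + 1) * W₁ + R) + P.fst A₂ * (c (L'.depth + 1) * W₂ + R)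
        ≤ P.fst A₁ * (c (L'.depth + 1) * (W₁ + W₂) + R)
          + P.fst A₂ * (c (L'.depth + 1) * (W₁ + W₂) + R) := by
          gcongr
          · exact le_self_add
          · exact le_add_self
      _ = P.fst A * (c (L'.depth + 1) * (W₁ + W₂) + R) := by rw [hmass, add_mul]
      _ ≤ _ := by
          refine mul_le_mul_right (le_trans ?_ le_add_self) _
          gcongr

/-- The expected value of the estimation potential is bounded uniformly in time. -/
theorem lintegral_total_estPot_le (P : Measure (Feat D × Fin C)) [IsProbabilityMeasure P]
    (hν : ∀ d θ, P.fst {x : Feat D | x d = θ} = 0) (p : unitInterval)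
    (rate : ℝ≥0) (Q : Params m D C 𝒮) (k : Fin C) {s : ℝ} (hs : |s| ≤ 1) {c : ℕ → ℝ≥0∞}
    (hc : ∀ d, c d ≠ ∞) (hc0 : c 0 = 0) (t : ℕ) :
    ∫⁻ h, (histTree Q h t).total (fun _ => 0) (estPot P s k c) Set.univ ∂histLaw P p rate
      ≤ Fintype.card (Cand m D × Bool) * ∑' j, c (1 + j) := by
  have h := lintegral_total_le Q P p rate (I := LeafInv Q P.fst) LeafInv.root
    (LeafInv.step hν) (fun _ _ => measurable_const) (measPot_estPot P s k c)
    (fun A L hA hL => estPot_leaf_le P p rate Q k hs hc A L hA hL.2) t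
  refine h.trans (le_of_eq ?_)
  simp only [estPot_newLeaf, hc0, zero_mul, zero_add, measure_univ, one_mul, lintegral_const,
    mul_one]

end Estimation

section EstimationError

variable {m D C : ℕ} {𝒮 : Type*} [MeasurableSpace 𝒮]

/-! ### The error of the class frequencies -/

/-- The factors of the estimation potential: they turn the weights of the leaves of depth greater
than `d₀` into bounds for the probability of a deviation by more than `δ`. -/
noncomputable def estFactor (α : ℕ → ℝ) (δ : ℝ) (d₀ d : ℕ) : ℝ≥0∞ :=
  if d₀ + 1 ≤ d then ENNReal.ofReal (Real.exp (-(δ ^ 2 / 4 * α (d - 1)))) else 0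

/-- In a leaf with a class frequency that is off by more than `δ` one of the two exponential
weights is large. -/
theorem one_le_estFactor_mul {Q : Params m D C 𝒮} {L : Leaf m D C 𝒮} (hL : L.Wf Q) {δ : ℝ}
    (hδ : 0 < δ) {d₀ : ℕ} (hd : d₀ + 1 ≤ L.depth) (k : Fin C) {q : ℝ}
    (hbad : δ < |(L.est k : ℝ) / (L.numEst : ℝ) - q|) :
    1 ≤ estFactor Q.α δ d₀ L.depth * expWeight (δ / 2) q k L.est
      + estFactor Q.α δ d₀ L.depth * expWeight (-(δ / 2)) q k L.est := by
  obtain ⟨d, hd'⟩ : ∃ d, L.depth = d + 1 := ⟨L.depth - 1, by omega⟩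
  have hα : Q.α d ≤ (L.numEst : ℝ) := hL.le_numEst d hd'
  set N : ℝ := (L.numEst : ℝ) with hN
  have hNsum : ((∑ j, L.est j : ℕ) : ℝ) = N := rfl
  set a : ℝ := (L.est k : ℝ) with ha
  have key : ∀ s : ℝ, δ ^ 2 / 4 * Q.α d ≤ s * (a - q * N) - s ^ 2 * N →
      1 ≤ estFactor Q.α δ d₀ L.depth * expWeight s q k L.est := by
    intro s hs
    rw [estFactor, if_pos hd, hd', Nat.add_sub_cancel, expWeight, hNsum,
      ← ENNReal.ofReal_mul (Real.exp_pos _).le, ← Real.exp_add, ENNReal.one_le_ofReal,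
      Real.one_le_exp_iff]
    linarith
  have hN0 : 0 ≤ N := Nat.cast_nonneg _
  rcases hN0.eq_or_lt with h0 | h0
  -- Without estimation points `α d ≤ 0`, and the factor alone is at least `1`.
  · refine le_add_right (key _ ?_)
    have ha0 : a = 0 := by
      have h1 : L.numEst = 0 := by rw [hN] at h0; exact_mod_cast h0.symm
      have h2 : L.est k = 0 := (Finset.sum_eq_zero_iff.1 h1) k (Finset.mem_univ k)
      rw [ha, h2]; simp
    rw [← h0] at hα ⊢
    rw [ha0]
    nlinarith [sq_nonneg δ]
  · have hαN : δ ^ 2 / 4 * Q.α d ≤ δ ^ 2 / 4 * N := by gcongr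
    rcases lt_abs.1 hbad with h | h
    · refine le_add_right (key _ ?_)
      have h1 : δ * N < a - q * N := by
        have := mul_lt_mul_of_pos_right h h0
        rwa [sub_mul, div_mul_cancel₀ _ h0.ne'] at this
      nlinarith
    · refine le_add_left (key _ ?_)
      have h1 : δ * N < -(a - q * N) := by
        have := mul_lt_mul_of_pos_right h h0
        rwa [neg_mul, sub_mul, div_mul_cancel₀ _ h0.ne'] at this
      nlinarith

/-- The `L¹`-distance on the cell `A` between the function `f` and the constant
`P(Y = k | X ∈ A)`. -/
noncomputable def leafBias (P : Measure (Feat D × Fin C)) (k : Fin C) (f : Feat D → ℝ)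
    (A : Set (Feat D)) (_ : Leaf m D C 𝒮) : ℝ≥0∞ :=
  ∫⁻ x in A, ENNReal.ofReal |classFrac P k A - f x| ∂P.fst

/-- The error of a class frequency in a leaf: trivially at most the mass if the leaf has depth at most
`d₀` or the frequency deviates by more than `δ` from the conditional probability, and otherwise at
most `δ` times the mass plus the bias. -/
theorem leaf_error_le (P : Measure (Feat D × Fin C)) [IsProbabilityMeasure P]
    {Q : Params m D C 𝒮} {L : Leaf m D C 𝒮} (hL : L.Wf Q) {δ : ℝ} (hδ : 0 < δ) (d₀ : ℕ) (k : Fin C)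
    {f : Feat D → ℝ} (hf0 : ∀ x, 0 ≤ f x) (hf1 : ∀ x, f x ≤ 1) (A : Set (Feat D)) :
    ∫⁻ x in A, ENNReal.ofReal |(L.est k : ℝ) / (L.numEst : ℝ) - f x| ∂P.fst
      ≤ massBelow P.fst (d₀ + 1) A L + ((estPot P (δ / 2) k (estFactor Q.α δ d₀) A L
        + estPot P (-(δ / 2)) k (estFactor Q.α δ d₀) A L)
        + (ENNReal.ofReal δ * P.fst A + leafBias P k f A L)) := by
  set r : ℝ := (L.est k : ℝ) / (L.numEst : ℝ) with hr
  have hr0 : 0 ≤ r := by positivity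
  have hr1 : r ≤ 1 := by
    refine div_le_one_of_le₀ ?_ (Nat.cast_nonneg _)
    exact_mod_cast Finset.single_le_sum (f := L.est) (fun _ _ => Nat.zero_le _) (Finset.mem_univ k)
  have htriv : ∫⁻ x in A, ENNReal.ofReal |r - f x| ∂P.fst ≤ P.fst A := by
    refine (lintegral_mono fun x => ?_).trans (le_of_eq (setLIntegral_one A))
    rw [ENNReal.ofReal_le_one, abs_le]
    constructor <;> linarith [hf0 x, hf1 x]
  rcases lt_or_ge L.depth (d₀ + 1) with hd | hd
  · refine htriv.trans (le_add_right ?_)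
    rw [massBelow, if_pos hd]
  refine le_add_left ?_
  by_cases hbad : δ < |r - classFrac P k A|
  · refine htriv.trans (le_add_right ?_)
    have h1 := one_le_estFactor_mul hL hδ hd k hbad
    calc P.fst A = P.fst A * 1 := (mul_one _).symm
      _ ≤ P.fst A * (estFactor Q.α δ d₀ L.depth * expWeight (δ / 2) (classFrac P k A) k L.est
          + estFactor Q.α δ d₀ L.depth * expWeight (-(δ / 2)) (classFrac P k A) k L.est) := by
          gcongr
      _ ≤ _ := by
          rw [mul_add]
          unfold estPot
          gcongr <;> exact le_self_add
  · refine le_add_left ?_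
    rw [leafBias, ← setLIntegral_const, ← lintegral_add_left measurable_const]
    refine lintegral_mono fun x => ?_
    rw [← ENNReal.ofReal_add hδ.le (abs_nonneg _)]
    refine ENNReal.ofReal_le_ofReal ?_
    exact (abs_sub_le r (classFrac P k A) (f x)).trans (add_le_add (not_lt.1 hbad) le_rfl)

theorem tsum_estFactor (α : ℕ → ℝ) (δ : ℝ) (d₀ : ℕ) :
    ∑' j, estFactor α δ d₀ (1 + j)
      = ∑' j, ENNReal.ofReal (Real.exp (-(δ ^ 2 / 4 * α (j + d₀)))) := by
  rw [← ENNReal.summable.sum_add_tsum_nat_add' (k := d₀)]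
  rw [Finset.sum_eq_zero, zero_add]
  · refine tsum_congr fun j => ?_
    rw [estFactor, if_pos (by omega), show 1 + (j + d₀) - 1 = j + d₀ by omega]
  · intro j hj
    rw [Finset.mem_range] at hj
    rw [estFactor, if_neg (by omega)]

/-- The thresholds grow faster than linearly, so that the sum over all depths of the
deviation probabilities converges. -/
theorem tendsto_tsum_estFactor {α : ℕ → ℝ}
    (hα : Tendsto (fun d : ℕ => (d : ℝ) / α d) atTop (𝓝 0)) (hα' : Tendsto α atTop atTop)
    {δ : ℝ} (hδ : 0 < δ) :
    Tendsto (fun d₀ => ∑' j, estFactor α δ d₀ (1 + j)) atTop (𝓝 0) := by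
  simp only [tsum_estFactor]
  refine ENNReal.tendsto_sum_nat_add
    (fun j => ENNReal.ofReal (Real.exp (-(δ ^ 2 / 4 * α j)))) ?_
  have hs : Summable fun j => Real.exp (-(δ ^ 2 / 4 * α j)) := by
    refine Summable.of_norm_bounded_eventually_nat (g := fun j : ℕ => Real.exp (-(j : ℝ)))
      Real.summable_exp_neg_nat ?_
    have h1 := hα.eventually (gt_mem_nhds (show (0 : ℝ) < δ ^ 2 / 4 by positivity))
    filter_upwards [h1, hα'.eventually_gt_atTop 0] with j hj hpos
    rw [Real.norm_eq_abs, abs_of_pos (Real.exp_pos _), Real.exp_le_exp, neg_le_neg_iff]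
    rw [div_lt_iff₀ hpos] at hj
    exact hj.le
  exact hs.tsum_ofReal_ne_top

variable (P : Measure (Feat D × Fin C)) [IsProbabilityMeasure P] (p : unitInterval) (rate : ℝ≥0)
  (Q : Params m D C 𝒮)

/-- The expected bias. -/
noncomputable def meanBias (k : Fin C) (f : Feat D → ℝ) (t : ℕ) : ℝ≥0∞ :=
  ∫⁻ h, (histTree Q h t).total (fun _ => 0) (leafBias P k f) Set.univ ∂histLaw P p rate

/-- The expected `L¹`-error of the class frequencies as estimates of `f`. -/
noncomputable def meanError (k : Fin C) (f : Feat D → ℝ) (t : ℕ) : ℝ≥0∞ :=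
  ∫⁻ h, ∫⁻ x, ENNReal.ofReal |(histTree Q h t).posteriorEst x k - f x| ∂P.fst ∂histLaw P p rate

theorem total_measure (ν : Measure (Feat D)) (T : Tree m D C 𝒮) (A : Set (Feat D)) :
    T.total (fun _ => 0) (fun A _ => ν A) A = ν A := by
  induction T generalizing A with
  | leaf L => rfl
  | node d θ l r hl hr => rw [Tree.total, hl, hr, zero_add, ← measure_split]

/-- The mean error is bounded by the mass of shallow leaves, the probability of deviations larger than
`δ` at depths beyond `d₀`, the tolerance `δ`, and the bias. -/
theorem meanError_le (hν : ∀ d θ, P.fst {x : Feat D | x d = θ} = 0) {δ : ℝ} (hδ : 0 < δ)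
    (hδ1 : δ ≤ 1) (d₀ : ℕ) (k : Fin C) {f : Feat D → ℝ} (hf0 : ∀ x, 0 ≤ f x) (hf1 : ∀ x, f x ≤ 1)
    (t : ℕ) :
    meanError P p rate Q k f t ≤ shallowMass P p rate Q (d₀ + 1) t
      + (2 * (Fintype.card (Cand m D × Bool) * ∑' j, estFactor Q.α δ d₀ (1 + j))
      + (ENNReal.ofReal δ + meanBias P p rate Q k f t)) := by
  set c := estFactor Q.α δ d₀ with hc
  have hctop : ∀ d, c d ≠ ∞ := fun d => by
    rw [hc, estFactor]; split_ifs <;> simp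
  have hc0 : c 0 = 0 := by simp [hc, estFactor]
  have hmeas : ∀ φ : Set (Feat D) → Leaf m D C 𝒮 → ℝ≥0∞, MeasPot (Hist D C) φ →
      Measurable fun h : Hist D C => (histTree Q h t).total (fun _ => 0) φ Set.univ := fun φ hφ =>
    (histTree_measTree Q measurable_id t).measurable_total (fun _ _ => measurable_const) hφ
      (.const MeasurableSet.univ)
  have hadd : ∀ (φ φ' : Set (Feat D) → Leaf m D C 𝒮 → ℝ≥0∞) (T : Tree m D C 𝒮),
      T.total (fun _ => 0) (fun A L => φ A L + φ' A L) Set.univ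
        = T.total (fun _ => 0) φ Set.univ + T.total (fun _ => 0) φ' Set.univ := fun φ φ' T => by
    rw [← Tree.total_add]; simp
  have hpoint : ∀ h : Hist D C,
      ∫⁻ x, ENNReal.ofReal |(histTree Q h t).posteriorEst x k - f x| ∂P.fst
        ≤ (histTree Q h t).total (fun _ => 0) (massBelow P.fst (d₀ + 1)) Set.univ
        + (((histTree Q h t).total (fun _ => 0) (estPot P (δ / 2) k c) Set.univ
          + (histTree Q h t).total (fun _ => 0) (estPot P (-(δ / 2)) k c) Set.univ)
        + (ENNReal.ofReal δ
          + (histTree Q h t).total (fun _ => 0) (leafBias P k f) Set.univ)) := by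
    intro h
    have h1 := (histTree Q h t).setLIntegral_eq_total P.fst
      (fun L x => ENNReal.ofReal |(L.est k : ℝ) / (L.numEst : ℝ) - f x|) MeasurableSet.univ
    rw [Measure.restrict_univ] at h1
    refine (le_of_eq h1).trans ?_
    refine (Tree.total_mono (ψ' := fun _ => 0) (fun _ => le_rfl)
      (fun A L hL => leaf_error_le P hL.2 hδ d₀ k hf0 hf1 A) _ _
      (LeafInv.allLeaves (Q := Q) hν h t)).trans (le_of_eq ?_)
    rw [hadd, hadd, hadd, hadd]
    congr 3
    have h2 := Tree.total_const_mul (ENNReal.ofReal δ) (fun _ => 0) (fun A _ => P.fst A)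
      (histTree Q h t) Set.univ
    simp only [mul_zero] at h2
    rw [h2, total_measure, measure_univ, mul_one]
  have hs1 : |δ / 2| ≤ 1 := by rw [abs_of_pos (by positivity)]; linarith
  have hs2 : |-(δ / 2)| ≤ 1 := by rwa [abs_neg]
  refine (lintegral_mono hpoint).trans ?_
  rw [lintegral_add_left (hmeas _ (measPot_massBelow P.fst _)),
    lintegral_add_left (f := fun h => (histTree Q h t).total (fun _ => 0)
      (estPot P (δ / 2) k c) Set.univ + (histTree Q h t).total (fun _ => 0)
      (estPot P (-(δ / 2)) k c) Set.univ)
      ((hmeas _ (measPot_estPot P _ k c)).add (hmeas _ (measPot_estPot P _ k c))),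
    lintegral_add_left (hmeas _ (measPot_estPot P _ k c)), lintegral_add_left measurable_const,
    lintegral_const, measure_univ, mul_one, two_mul]
  have hb1 := lintegral_total_estPot_le P hν p rate Q k hs1 hctop hc0 t
  have hb2 := lintegral_total_estPot_le P hν p rate Q k hs2 hctop hc0 t
  exact add_le_add le_rfl (add_le_add (add_le_add hb1 hb2) le_rfl)

/-- The class frequencies are consistent estimates of `f` in mean, if all leaves become deep and
the bias vanishes. -/
theorem tendsto_meanError (hν : ∀ d θ, P.fst {x : Feat D | x d = θ} = 0)
    (hα : Tendsto (fun d : ℕ => (d : ℝ) / Q.α d) atTop (𝓝 0)) (hα' : Tendsto Q.α atTop atTop)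
    (hdepth : ∀ N, Tendsto (shallowMass P p rate Q N) atTop (𝓝 0))
    (k : Fin C) {f : Feat D → ℝ} (hf0 : ∀ x, 0 ≤ f x) (hf1 : ∀ x, f x ≤ 1)
    (hbias : Tendsto (meanBias P p rate Q k f) atTop (𝓝 0)) :
    Tendsto (meanError P p rate Q k f) atTop (𝓝 0) := by
  rw [ENNReal.tendsto_nhds_zero]
  intro ε hε
  obtain ⟨δ, hδ, hδ1, hδε⟩ : ∃ δ : ℝ, 0 < δ ∧ δ ≤ 1 ∧ ENNReal.ofReal δ ≤ ε / 4 := by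
    rcases eq_or_ne ε ∞ with rfl | h
    · exact ⟨1, one_pos, le_rfl, by simp [ENNReal.top_div]⟩
    · have hpos : 0 < (ε / 4).toReal := ENNReal.toReal_pos
        (ENNReal.div_ne_zero.2 ⟨hε.ne', by simp⟩) (ENNReal.div_ne_top h (by simp))
      refine ⟨min 1 (ε / 4).toReal, lt_min one_pos hpos, min_le_left _ _, ?_⟩
      exact (ENNReal.ofReal_le_ofReal (min_le_right _ _)).trans ENNReal.ofReal_toReal_le
  have hε4 : 0 < ε / 4 := ENNReal.div_pos hε.ne' (by simp)
  have h1 : Tendsto (fun d₀ => 2 * (Fintype.card (Cand m D × Bool) *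
      ∑' j, estFactor Q.α δ d₀ (1 + j))) atTop (𝓝 0) := by
    have := ENNReal.Tendsto.const_mul (a := (2 : ℝ≥0∞)) (ENNReal.Tendsto.const_mul
      (a := (Fintype.card (Cand m D × Bool) : ℝ≥0∞)) (tendsto_tsum_estFactor hα hα' hδ)
      (Or.inr (ENNReal.natCast_ne_top _))) (Or.inr (by simp))
    simpa using this
  obtain ⟨d₀, hd₀⟩ := ((ENNReal.tendsto_nhds_zero.1 h1) _ hε4).exists
  filter_upwards [(ENNReal.tendsto_nhds_zero.1 (hdepth (d₀ + 1))) _ hε4,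
    (ENNReal.tendsto_nhds_zero.1 hbias) _ hε4] with t ht1 ht2
  refine (meanError_le P p rate Q hν hδ hδ1 d₀ k hf0 hf1 t).trans ?_
  refine (add_le_add ht1 (add_le_add hd₀ (add_le_add hδε ht2))).trans (le_of_eq ?_)
  have : ε / 4 + (ε / 4 + (ε / 4 + ε / 4)) = 4 * (ε / 4) := by ring
  rw [this, ENNReal.mul_div_cancel (by simp) (by simp)]

end EstimationError

section Depth

variable {m D C : ℕ} {𝒮 : Type*} [MeasurableSpace 𝒮]

/-! ### No candidate split is degenerate -/

/-- The leaf cannot be relied upon to be split: it has no candidate dimensions, or its cell is not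
null but a child of a candidate split is. -/
def Degenerate (ν : Measure (Feat D)) (A : Set (Feat D)) (L : Leaf m D C 𝒮) : Prop :=
  L.dims = ∅ ∨ (ν A ≠ 0 ∧ ∃ S b, L.IsCand S ∧ ν (childCell A L S b) = 0)

open Classical in
/-- The indicator function of degenerate leaves. -/
noncomputable def degeneratePot (ν : Measure (Feat D)) (A : Set (Feat D)) (L : Leaf m D C 𝒮) :
    ℝ≥0∞ := if Degenerate ν A L then 1 else 0

theorem measPot_degeneratePot {Ω : Type*} [MeasurableSpace Ω] (ν : Measure (Feat D))
    [IsFiniteMeasure ν] :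
    MeasPot Ω (degeneratePot ν : Set (Feat D) → Leaf m D C 𝒮 → ℝ≥0∞) := fun L A hL hA => by
  have h0 : MeasurableSet {ω | (L ω).dims = ∅} :=
    hL.dims (measurableSet_singleton (∅ : Finset (Fin D)))
  have h1 : MeasurableSet {ω | ν (A ω) ≠ 0} :=
    (measurableSet_eq_fun (hA.measurable_measure ν) measurable_const).compl
  have h2 : ∀ S b, MeasurableSet {ω | (L ω).IsCand S ∧ ν (childCell (A ω) (L ω) S b) = 0} :=
    fun S b => (hL.measurableSet_isCand S).inter
      (measurableSet_eq_fun ((hA.childCell hL S b).measurable_measure ν) measurable_const)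
  refine Measurable.ite ?_ measurable_const measurable_const
  refine MeasurableSet.congr (h0.union (h1.inter (MeasurableSet.iUnion fun S =>
    MeasurableSet.iUnion fun b => h2 S b))) ?_
  ext ω
  simp [Degenerate]

/-- Almost every point of a cell has mass on both sides in each coordinate direction. -/
theorem ae_split_ne_zero (ν : Measure (Feat D)) [IsFiniteMeasure ν]
    (hν : ∀ d θ, ν {x : Feat D | x d = θ} = 0) (A : Set (Feat D)) :
    ∀ᵐ x ∂ν.restrict A, ∀ i, ν (A ∩ {y | y i ≤ x i}) ≠ 0 ∧ ν (A ∩ {y | x i < y i}) ≠ 0 := by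
  rw [ae_all_iff]
  intro i
  have hc := measurable_coord_const (D := D) i
  set σ : Measure ℝ := (ν.restrict A).map fun x : Feat D => x i with hσ
  have hIic : ∀ s, σ (Set.Iic s) = ν (A ∩ {y | y i ≤ s}) := fun s => by
    rw [hσ, Measure.map_apply hc measurableSet_Iic, Measure.restrict_apply (hc measurableSet_Iic),
      Set.inter_comm]
    rfl
  have hIoi : ∀ s, σ (Set.Ioi s) = ν (A ∩ {y | s < y i}) := fun s => by
    rw [hσ, Measure.map_apply hc measurableSet_Ioi, Measure.restrict_apply (hc measurableSet_Ioi),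
      Set.inter_comm]
    rfl
  have hat : ∀ s, σ {s} = 0 := fun s => by
    rw [hσ, Measure.map_apply hc (measurableSet_singleton s)]
    exact measure_mono_null (fun x hx => hx)
      (Measure.absolutelyContinuous_of_le Measure.restrict_le_self (hν i s))
  have h1 : ∀ᵐ s ∂σ, σ (Set.Iic s) ≠ 0 := by
    rw [ae_iff]
    refine le_antisymm (le_of_forall_gt_imp_ge_of_dense fun c hc => ?_) zero_le
    refine (measure_mono fun s hs => ?_).trans (measure_setOf_Iic_lt_le σ c)
    have hs' : σ (Set.Iic s) = 0 := not_not.1 hs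
    show σ (Set.Iic s) < c
    rwa [hs']
  have h2 : ∀ᵐ s ∂σ, σ (Set.Ioi s) ≠ 0 := by
    rw [ae_iff]
    refine le_antisymm (le_of_forall_gt_imp_ge_of_dense fun c hc => ?_) zero_le
    refine (measure_mono fun s hs => ?_).trans (measure_setOf_Ioi_lt_le σ hat c)
    have hs' : σ (Set.Ioi s) = 0 := not_not.1 hs
    show σ (Set.Ioi s) < c
    rwa [hs']
  filter_upwards [ae_of_ae_map hc.aemeasurable h1, ae_of_ae_map hc.aemeasurable h2] with x hx1 hx2
  rw [hIic] at hx1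
  rw [hIoi] at hx2
  exact ⟨hx1, hx2⟩

theorem degeneratePot_newLeaf (ν : Measure (Feat D)) (A : Set (Feat D)) (R : SplitRule m D C 𝒮)
    (d : ℕ) (dims : Finset (Fin D)) (est : Fin C → ℕ) (stat : 𝒮) :
    degeneratePot ν A (newLeaf R d dims est stat)
      = ({∅} : Set (Finset (Fin D))).indicator 1 dims := by
  have : Degenerate ν A (newLeaf R d dims est stat) ↔ dims = ∅ := by
    simp [Degenerate, newLeaf, Leaf.IsCand]
  unfold degeneratePot
  by_cases h : dims = ∅
  · rw [if_pos (this.2 h)]; simp [h]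
  · rw [if_neg (fun h' => h (this.1 h'))]; simp [h]

theorem lintegral_degeneratePot_newLeaf (hD : 0 < D) (rate : ℝ≥0) (ν : Measure (Feat D))
    (A : Set (Feat D)) (R : SplitRule m D C 𝒮) (d : ℕ) (est : Fin C → ℕ) (stat : 𝒮) :
    ∫⁻ dims, degeneratePot ν A (newLeaf R d dims est stat) ∂dimsLaw D rate = 0 := by
  simp only [degeneratePot_newLeaf]
  rw [lintegral_indicator_one (measurableSet_singleton _), dimsLaw_empty hD]

theorem not_degenerate_addStructure {ν : Measure (Feat D)} {A : Set (Feat D)} {L : Leaf m D C 𝒮}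
    (hL : ¬ Degenerate ν A L) (R : SplitRule m D C 𝒮) (z : Feat D × Fin C)
    (hz : ∀ i, ν (A ∩ {y | y i ≤ z.1 i}) ≠ 0 ∧ ν (A ∩ {y | z.1 i < y i}) ≠ 0) :
    ¬ Degenerate ν A ((L.addCandidate z.1).addStructure R z) := by
  simp only [Degenerate, not_or, not_and, not_exists] at hL ⊢
  refine ⟨by simpa [Leaf.addStructure, Leaf.addCandidate_dims] using hL.1, fun hA S b hS => ?_⟩
  have hS' : (L.addCandidate z.1).IsCand S := hS
  by_cases hold : L.IsCand S
  · have ht : ((L.addCandidate z.1).addStructure R z).threshold S = L.threshold S := by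
      show (L.addCandidate z.1).pt S.1 S.2 = L.pt S.1 S.2
      rw [L.addCandidate_pt z.1 hold.1]
    have h := hL.2 hA S b hold
    cases b
    · rw [childCell_false hS, ht]; rwa [childCell_false hold] at h
    · rw [childCell_true hS, ht]; rwa [childCell_true hold] at h
  · have hd : S.2 ∈ L.dims := by have := hS'.2; rwa [Leaf.addCandidate_dims] at this
    have hnum : ¬ (S.1 : ℕ) < L.num := fun h => hold ⟨h, hd⟩
    have ht : ((L.addCandidate z.1).addStructure R z).threshold S = z.1 S.2 := by
      show (L.addCandidate z.1).pt S.1 S.2 = z.1 S.2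
      have h1 := hS'.1
      unfold Leaf.addCandidate at h1 ⊢
      split_ifs at h1 ⊢ with h
      · have : (S.1 : ℕ) = L.num := by simp only at h1; omega
        simp [this]
      · exact absurd h1 hnum
    cases b
    · rw [childCell_false hS, ht]; exact (hz S.2).1
    · rw [childCell_true hS, ht]; exact (hz S.2).2

theorem Tree.allLeaves_of_total_eq_zero {φ : Set (Feat D) → Leaf m D C 𝒮 → ℝ≥0∞}
    {T : Tree m D C 𝒮} {A : Set (Feat D)} (h : T.total (fun _ => 0) φ A = 0) :
    T.AllLeaves (fun A L => φ A L = 0) A := by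
  induction T generalizing A with
  | leaf L => exact h
  | node d θ l r hl hr =>
    simp only [Tree.total, zero_add, add_eq_zero] at h
    exact ⟨hl h.1, hr h.2⟩

/-- Almost surely no leaf ever has an empty set of candidate dimensions or, unless its cell is null,
a null candidate child. -/
theorem ae_allLeaves_not_degenerate (P : Measure (Feat D × Fin C)) [IsProbabilityMeasure P]
    (hν : ∀ d θ, P.fst {x : Feat D | x d = θ} = 0) (hD : 0 < D) (p : unitInterval) (rate : ℝ≥0)
    (Q : Params m D C 𝒮) : ∀ᵐ h ∂histLaw P p rate, ∀ t,
      (histTree Q h t).AllLeaves (fun A L => ¬ Degenerate P.fst A L) Set.univ := by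
  rw [ae_all_iff]
  intro t
  have hmeas : Measurable fun h : Hist D C =>
      (histTree Q h t).total (fun _ => 0) (degeneratePot P.fst) Set.univ :=
    (histTree_measTree Q measurable_id t).measurable_total (fun _ _ => measurable_const)
      (measPot_degeneratePot P.fst) (.const MeasurableSet.univ)
  have hint := lintegral_total_le Q P p rate (I := fun _ _ => True) (fun _ => trivial)
    (fun A L z u _ _ _ => Tree.allLeaves_of_forall (fun _ _ => trivial) _ _)
    (ψ := fun _ => 0) (φ := degeneratePot P.fst)
    (fun _ _ => measurable_const) (measPot_degeneratePot P.fst) (fun A L hA _ => ?_) t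
  · rw [lintegral_degeneratePot_newLeaf hD, nonpos_iff_eq_zero,
      lintegral_eq_zero_iff hmeas] at hint
    filter_upwards [hint] with h hh
    refine (Tree.allLeaves_of_total_eq_zero hh).mono fun A L hAL hdeg => ?_
    rw [degeneratePot, if_pos hdeg] at hAL
    exact one_ne_zero hAL
  · have hPA : P (Prod.fst ⁻¹' A) = P.fst A := (Measure.fst_apply hA).symm
    refine Leaf.setLIntegral_step_le Q P p rate (measPot_degeneratePot P.fst) hA ?_ ?_ ?_
    · have : ∀ z, degeneratePot P.fst A (L.addEstimation z) = degeneratePot P.fst A L :=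
        fun z => rfl
      simp only [this, setLIntegral_const, hPA]
      rw [mul_comm]
    · by_cases hdeg : Degenerate P.fst A L
      · rw [degeneratePot, if_pos hdeg, mul_one, ← hPA, ← setLIntegral_one]
        refine lintegral_mono fun z => ?_
        unfold degeneratePot
        split_ifs <;> simp
      · refine le_trans (le_of_eq ?_) zero_le
        have h1 := ae_split_ne_zero P.fst hν A
        have h2 : (P.fst).restrict A = (P.restrict (Prod.fst ⁻¹' A)).map Prod.fst :=
          Measure.restrict_map measurable_fst hA
        rw [h2] at h1
        have h3 := ae_of_ae_map measurable_fst.aemeasurable h1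
        refine (lintegral_congr_ae ?_).trans lintegral_zero
        filter_upwards [h3] with z hz
        rw [degeneratePot, if_neg (not_degenerate_addStructure hdeg Q.rule z hz)]
    · intro z hz L' hL' S hS
      refine le_trans (le_of_eq ?_) zero_le
      simp only [zero_add]
      calc _ = ∫⁻ dl, degeneratePot P.fst (A ∩ {x | x S.2 ≤ L'.threshold S})
              (newLeaf Q.rule (L'.depth + 1) dl (L'.candEst S false) (L'.candStat S false))
              ∂dimsLaw D rate := by
            refine lintegral_congr fun dl => ?_
            rw [lintegral_add_left measurable_const, lintegral_degeneratePot_newLeaf hD]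
            simp
        _ = 0 := lintegral_degeneratePot_newLeaf hD ..

/-! ### The leaf that contains a given point -/

open Classical in
/-- The cell that contains `x`, if `A` is the cell of the root of the tree. -/
noncomputable def Tree.cellAt (x : Feat D) : Tree m D C 𝒮 → Set (Feat D) → Set (Feat D)
  | .leaf _, A => A
  | .node d θ l r, A =>
      if x d ≤ θ then l.cellAt x (A ∩ {y | y d ≤ θ}) else r.cellAt x (A ∩ {y | θ < y d})

theorem Tree.AllLeaves.at {I : Set (Feat D) → Leaf m D C 𝒮 → Prop} {T : Tree m D C 𝒮}
    {A : Set (Feat D)} (hT : T.AllLeaves I A) (x : Feat D) : I (T.cellAt x A) (T.leafAt x) := by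
  induction T generalizing A with
  | leaf L => exact hT
  | node d θ l r hl hr =>
    simp only [Tree.cellAt, Tree.leafAt]
    split_ifs
    · exact hl hT.1
    · exact hr hT.2

theorem Tree.cellAt_subset (x : Feat D) (T : Tree m D C 𝒮) (A : Set (Feat D)) :
    T.cellAt x A ⊆ A := by
  induction T generalizing A with
  | leaf L => exact subset_rfl
  | node d θ l r hl hr =>
    simp only [Tree.cellAt]
    split_ifs
    · exact (hl _).trans Set.inter_subset_left
    · exact (hr _).trans Set.inter_subset_left

theorem Tree.leafAt_step_of_mem (Q : Params m D C 𝒮) (x : Feat D) (z : Feat D × Fin C)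
    (u : Draw D) (T : Tree m D C 𝒮) {A : Set (Feat D)} (hz : z.1 ∈ T.cellAt x A) :
    (T.step Q z u).leafAt x = ((T.leafAt x).step Q z u).leafAt x ∧
      (T.step Q z u).cellAt x A = ((T.leafAt x).step Q z u).cellAt x (T.cellAt x A) := by
  induction T generalizing A with
  | leaf L => exact ⟨rfl, rfl⟩
  | node d θ l r hl hr =>
    simp only [Tree.cellAt] at hz ⊢
    simp only [Tree.step, Tree.leafAt]
    by_cases hx : x d ≤ θ
    · simp only [hx, if_true] at hz ⊢
      have : z.1 d ≤ θ := (Tree.cellAt_subset x l _ hz).2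
      simpa only [this, if_true, Tree.leafAt, Tree.cellAt, hx] using hl hz
    · simp only [hx, if_false] at hz ⊢
      have : ¬ z.1 d ≤ θ := not_le.2 (Tree.cellAt_subset x r _ hz).2
      simpa only [this, if_false, Tree.leafAt, Tree.cellAt, hx] using hr hz

theorem Tree.leafAt_step_of_notMem (Q : Params m D C 𝒮) (x : Feat D) (z : Feat D × Fin C)
    (u : Draw D) (T : Tree m D C 𝒮) {A : Set (Feat D)} (hzA : z.1 ∈ A)
    (hz : z.1 ∉ T.cellAt x A) :
    (T.step Q z u).leafAt x = T.leafAt x ∧ (T.step Q z u).cellAt x A = T.cellAt x A := by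
  induction T generalizing A with
  | leaf L => exact absurd hzA hz
  | node d θ l r hl hr =>
    simp only [Tree.cellAt] at hz
    simp only [Tree.step]
    by_cases hx : x d ≤ θ <;> by_cases hzd : z.1 d ≤ θ <;>
      simp only [hx, hzd, if_true, if_false, Tree.leafAt, Tree.cellAt, and_self] at hz ⊢
    · exact hl ⟨hzA, hzd⟩ hz
    · exact hr ⟨hzA, not_le.1 hzd⟩ hz

/-- Almost no point lies in a null cell, because a tree has finitely many cells. -/
theorem Tree.measure_cellAt_null (ν : Measure (Feat D)) (T : Tree m D C 𝒮) (A : Set (Feat D)) :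
    ν {x | x ∈ A ∧ ν (T.cellAt x A) = 0} = 0 := by
  induction T generalizing A with
  | leaf L =>
    by_cases h : ν A = 0
    · exact measure_mono_null (fun x hx => hx.1) h
    · simp [Tree.cellAt, h]
  | node d θ l r hl hr =>
    refine measure_mono_null (fun x hx => ?_)
      (measure_union_null (hl (A ∩ {y | y d ≤ θ})) (hr (A ∩ {y | θ < y d})))
    obtain ⟨hxA, hx⟩ := hx
    simp only [Tree.cellAt] at hx
    split_ifs at hx with hd
    · exact Or.inl ⟨⟨hxA, hd⟩, hx⟩
    · exact Or.inr ⟨⟨hxA, not_le.1 hd⟩, hx⟩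

theorem Leaf.trySplit_depth_le (Q : Params m D C 𝒮) (L : Leaf m D C 𝒮) (dl dr : Finset (Fin D))
    (x : Feat D) : L.depth ≤ ((L.trySplit Q dl dr).leafAt x).depth := by
  unfold Leaf.trySplit
  split_ifs
  · simp only [Tree.leafAt]
    split_ifs <;> exact Nat.le_succ _
  · exact le_rfl

theorem Leaf.step_depth_le (Q : Params m D C 𝒮) (L : Leaf m D C 𝒮) (z : Feat D × Fin C)
    (u : Draw D) (x : Feat D) : L.depth ≤ ((L.step Q z u).leafAt x).depth := by
  unfold Leaf.step
  split_ifs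
  · exact le_rfl
  · have h := Leaf.trySplit_depth_le Q ((L.addCandidate z.1).addStructure Q.rule z) u.2.1 u.2.2 x
    rwa [Leaf.addStructure_depth] at h

theorem Leaf.trySplit_of_depth_eq (Q : Params m D C 𝒮) (L : Leaf m D C 𝒮)
    (dl dr : Finset (Fin D)) (x : Feat D) (h : ((L.trySplit Q dl dr).leafAt x).depth = L.depth) :
    ¬ L.Splits Q ∧ L.trySplit Q dl dr = .leaf L := by
  unfold Leaf.trySplit at h ⊢
  split_ifs at h ⊢ with hs
  · exfalso
    simp only [Tree.leafAt] at h
    split_ifs at h <;> exact Nat.succ_ne_self _ h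
  · exact ⟨hs, rfl⟩

theorem histTree_depth_monotone (Q : Params m D C 𝒮) (h : Hist D C) (x : Feat D) :
    Monotone fun t => ((histTree Q h t).leafAt x).depth := by
  refine monotone_nat_of_le_succ fun t => ?_
  rw [histTree_succ]
  by_cases hz : (h.2 t).1.1 ∈ (histTree Q h t).cellAt x Set.univ
  · rw [(Tree.leafAt_step_of_mem Q x _ _ _ hz).1]
    exact Leaf.step_depth_le ..
  · rw [(Tree.leafAt_step_of_notMem Q x _ _ _ (Set.mem_univ _) hz).1]

/-! ### A leaf whose cell and candidate children keep receiving points is split -/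

theorem tendsto_atTop_of_frequently_lt {f : ℕ → ℕ} {t₁ : ℕ} (hf : ∀ t, t₁ ≤ t → f t ≤ f (t + 1))
    (hlt : ∃ᶠ t in atTop, t₁ ≤ t → f t < f (t + 1)) : Tendsto f atTop atTop := by
  have hmono : ∀ s t, t₁ ≤ s → s ≤ t → f s ≤ f t := fun s t hs hst =>
    Nat.le_induction le_rfl (fun n hn ih => ih.trans (hf n (hs.trans hn))) t hst
  have hex : ∀ K, ∃ t, t₁ ≤ t ∧ K ≤ f t := by
    intro K
    induction K with
    | zero => exact ⟨t₁, le_rfl, Nat.zero_le _⟩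
    | succ K ih =>
      obtain ⟨t, ht, hK⟩ := ih
      obtain ⟨s, hs, hs'⟩ := (frequently_atTop.1 hlt) t
      have h1 := hs' (ht.trans hs)
      have h2 := hmono t s ht hs
      exact ⟨s + 1, by omega, by omega⟩
  refine tendsto_atTop.2 fun K => ?_
  obtain ⟨t, ht, hK⟩ := hex K
  filter_upwards [eventually_ge_atTop t] with s hs
  exact hK.trans (hmono t s ht hs)

/-- The next state of the leaf `L` with the cell `A` if it is not split. -/
def Leaf.UnsplitStep (Q : Params m D C 𝒮) (A : Set (Feat D)) (L : Leaf m D C 𝒮)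
    (e : Obs D C) (L' : Leaf m D C 𝒮) : Prop :=
  (e.1.1 ∉ A → L' = L) ∧
  (e.1.1 ∈ A → e.2.1 = true → L' = L.addEstimation e.1) ∧
  (e.1.1 ∈ A → e.2.1 = false → L' = (L.addCandidate e.1.1).addStructure Q.rule e.1 ∧ ¬ L'.Splits Q)

theorem Leaf.UnsplitStep.cases {Q : Params m D C 𝒮} {A : Set (Feat D)} {L : Leaf m D C 𝒮}
    {e : Obs D C} {L' : Leaf m D C 𝒮} (h : L.UnsplitStep Q A e L') :
    L' = L ∨ L' = L.addEstimation e.1 ∨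
      L' = (L.addCandidate e.1.1).addStructure Q.rule e.1 := by
  by_cases hA : e.1.1 ∈ A
  · cases hb : e.2.1
    · exact Or.inr (Or.inr (h.2.2 hA hb).1)
    · exact Or.inr (Or.inl (h.2.1 hA hb))
  · exact Or.inl (h.1 hA)

theorem Leaf.UnsplitStep.isCand {Q : Params m D C 𝒮} {A : Set (Feat D)} {L : Leaf m D C 𝒮}
    {e : Obs D C} {L' : Leaf m D C 𝒮} (h : L.UnsplitStep Q A e L') {S : Cand m D}
    (hS : L.IsCand S) : L'.IsCand S ∧ L'.threshold S = L.threshold S := by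
  rcases h.cases with rfl | rfl | rfl
  · exact ⟨hS, rfl⟩
  · exact ⟨hS, rfl⟩
  · refine ⟨hS.addCandidate e.1.1, ?_⟩
    show (L.addCandidate e.1.1).pt S.1 S.2 = L.pt S.1 S.2
    rw [L.addCandidate_pt e.1.1 hS.1]

theorem Leaf.sum_candEst_addEstimation (L : Leaf m D C 𝒮) (z : Feat D × Fin C) (S : Cand m D)
    (b : Bool) : ∑ k, L.candEst S b k ≤ ∑ k, (L.addEstimation z).candEst S b k ∧
      (L.InChild S b z.1 → ∑ k, L.candEst S b k < ∑ k, (L.addEstimation z).candEst S b k) := by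
  simp only [Leaf.addEstimation]
  split_ifs with h
  · rw [sum_addLabel]; exact ⟨Nat.le_succ _, fun _ => Nat.lt_succ_self _⟩
  · exact ⟨le_rfl, fun h' => absurd h' h⟩

theorem Leaf.numEst_addEstimation (L : Leaf m D C 𝒮) (z : Feat D × Fin C) :
    (L.addEstimation z).numEst = L.numEst + 1 :=
  sum_addLabel _ _

theorem Leaf.UnsplitStep.counts_le {Q : Params m D C 𝒮} {A : Set (Feat D)} {L : Leaf m D C 𝒮}
    {e : Obs D C} {L' : Leaf m D C 𝒮} (h : L.UnsplitStep Q A e L') (S : Cand m D) (b : Bool) :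
    ∑ k, L.candEst S b k ≤ ∑ k, L'.candEst S b k ∧ L.numEst ≤ L'.numEst := by
  rcases h.cases with rfl | rfl | rfl
  · exact ⟨le_rfl, le_rfl⟩
  · exact ⟨(L.sum_candEst_addEstimation _ S b).1, by rw [L.numEst_addEstimation]; omega⟩
  · simp [Leaf.addStructure, Leaf.numEst, Leaf.addCandidate_candEst, Leaf.addCandidate_est]

/-- A leaf cannot stay unsplit for ever if its cell has positive mass, the leaf never becomes
degenerate, and every set of positive mass keeps receiving points of both streams. -/
theorem not_forall_unsplitStep (hm : 0 < m) {Q : Params m D C 𝒮} {ν : Measure (Feat D)}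
    (hν : ∀ d θ, ν {x : Feat D | x d = θ} = 0)
    {A : Set (Feat D)} (hA : NiceCell ν A) (hA0 : ν A ≠ 0) {e : ℕ → Obs D C}
    (he : ∀ B, NiceCell ν B → ν B ≠ 0 → ∀ b, ∃ᶠ t in atTop, (e t).1.1 ∈ B ∧ (e t).2.1 = b)
    {L : ℕ → Leaf m D C 𝒮} (hdeg : ∀ t, ¬ Degenerate ν A (L t)) (t₀ : ℕ)
    (hdepth : ∀ t, t₀ ≤ t → (L t).depth = (L t₀).depth)
    (hstep : ∀ t, t₀ ≤ t → (L t).UnsplitStep Q A (e t) (L (t + 1))) : False := by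
  -- The first structure point creates a candidate split `S`, whose children are not null.
  obtain ⟨t₁, ht₁, ht₁A, ht₁b⟩ := (frequently_atTop.1 (he A hA hA0 false)) t₀
  have h1 := ((hstep t₁ ht₁).2.2 ht₁A ht₁b).1
  have hnum : 0 < (L (t₁ + 1)).num := by
    rw [h1]
    show 0 < ((L t₁).addCandidate (e t₁).1.1).num
    unfold Leaf.addCandidate
    split_ifs with h
    · exact Nat.succ_pos _
    · omega
  have hdims : (L (t₁ + 1)).dims.Nonempty :=
    Finset.nonempty_iff_ne_empty.2 fun h => hdeg (t₁ + 1) (Or.inl h)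
  obtain ⟨i, hi⟩ := hdims
  set S : Cand m D := (⟨0, hm⟩, i) with hS
  set θ := (L (t₁ + 1)).threshold S with hθ
  have hcand : ∀ t, t₁ + 1 ≤ t → (L t).IsCand S ∧ (L t).threshold S = θ := by
    intro t ht
    induction t, ht using Nat.le_induction with
    | base => exact ⟨⟨hnum, hi⟩, rfl⟩
    | succ t ht ih =>
      have := (hstep t (by omega)).isCand ih.1
      exact ⟨this.1, this.2.trans ih.2⟩
  have hmass : ∀ b, ν (childCell A (L (t₁ + 1)) S b) ≠ 0 := fun b h0 =>
    hdeg (t₁ + 1) (Or.inr ⟨hA0, S, b, (hcand _ le_rfl).1, h0⟩)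
  have hnice : ∀ b, NiceCell ν (childCell A (L (t₁ + 1)) S b) := fun b => by
    cases b
    · rw [childCell_false (hcand _ le_rfl).1]; exact hA.inter_le hν _ _
    · rw [childCell_true (hcand _ le_rfl).1]; exact hA.inter_gt _ _
  have hchild : ∀ b t x, t₁ + 1 ≤ t → x ∈ childCell A (L (t₁ + 1)) S b →
      (L t).InChild S b x := fun b t x ht hx => by
    refine ⟨(hcand t ht).1, ?_⟩
    rw [(hcand t ht).2]
    exact hx.2.2
  -- The counts of both children and of the leaf itself grow beyond the bounds for a forced split.
  have hcount : ∀ b, Tendsto (fun t => ∑ k, (L t).candEst S b k) atTop atTop := fun b => by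
    refine tendsto_atTop_of_frequently_lt (t₁ := t₁ + 1)
      (fun t ht => ((hstep t (by omega)).counts_le S b).1) ?_
    refine (he _ (hnice b) (hmass b) true).mono fun t ht ht' => ?_
    rw [(hstep t (by omega)).2.1 ht.1.1 ht.2]
    exact ((L t).sum_candEst_addEstimation _ S b).2 (hchild b t _ ht' ht.1)
  have hnumEst : Tendsto (fun t => (L t).numEst) atTop atTop := by
    refine tendsto_atTop_of_frequently_lt (t₁ := t₁ + 1)
      (fun t ht => ((hstep t (by omega)).counts_le S true).2) ?_
    refine (he _ hA hA0 true).mono fun t ht ht' => ?_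
    rw [(hstep t (by omega)).2.1 ht.1 ht.2, Leaf.numEst_addEstimation]
    exact Nat.lt_succ_self _
  have hev : ∀ᶠ t in atTop, t₁ + 1 ≤ t ∧
      (∀ b, Q.α (L t₀).depth ≤ ((∑ k, (L t).candEst S b k : ℕ) : ℝ)) ∧
      Q.β (L t₀).depth ≤ ((L t).numEst : ℝ) := by
    refine (eventually_ge_atTop _).and (Eventually.and ?_ ?_)
    · rw [eventually_all]
      exact fun b => (tendsto_natCast_atTop_atTop.comp (hcount b)).eventually_ge_atTop _
    · exact (tendsto_natCast_atTop_atTop.comp hnumEst).eventually_ge_atTop _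
  -- From then on the next structure point makes the split of the leaf mandatory.
  obtain ⟨t, ⟨htA, htb⟩, ht, hcα, hcβ⟩ := ((he A hA hA0 false).and_eventually hev).exists
  obtain ⟨h2, h3⟩ := (hstep t (by omega)).2.2 htA htb
  have hce : (L (t + 1)).candEst = (L t).candEst := by
    rw [h2]; exact Leaf.addCandidate_candEst _ _
  have hne : (L (t + 1)).numEst = (L t).numEst := by
    rw [h2]
    simp [Leaf.addStructure, Leaf.numEst, Leaf.addCandidate_est]
  refine h3 ⟨⟨S, ?_⟩, Or.inr ?_⟩
  · simp only [Leaf.validSplits, Finset.mem_filter, Finset.mem_univ, true_and]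
    refine ⟨(hcand (t + 1) (by omega)).1, fun b => ?_⟩
    rw [hdepth (t + 1) (by omega), hce]
    exact hcα b
  · rw [hdepth (t + 1) (by omega), hne]
    exact hcβ

/-- If the depth of the leaf at `x` does not change, then the leaf is not split and its cell does
not change. -/
theorem histTree_unsplitStep (Q : Params m D C 𝒮) (h : Hist D C) (x : Feat D) (t : ℕ)
    (hd : ((histTree Q h (t + 1)).leafAt x).depth = ((histTree Q h t).leafAt x).depth) :
    (histTree Q h (t + 1)).cellAt x Set.univ = (histTree Q h t).cellAt x Set.univ ∧
    ((histTree Q h t).leafAt x).UnsplitStep Q ((histTree Q h t).cellAt x Set.univ) (h.2 t)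
      ((histTree Q h (t + 1)).leafAt x) := by
  rw [histTree_succ] at hd ⊢
  by_cases hz : (h.2 t).1.1 ∈ (histTree Q h t).cellAt x Set.univ
  · obtain ⟨h1, h2⟩ := Tree.leafAt_step_of_mem Q x (h.2 t).1 (h.2 t).2 _ hz
    rw [h1] at hd
    rw [h1, h2]
    cases hb : (h.2 t).2.1
    · simp only [Leaf.step, hb, Bool.false_eq_true, if_false] at hd ⊢
      set L' := (((histTree Q h t).leafAt x).addCandidate (h.2 t).1.1).addStructure Q.rule
        (h.2 t).1 with hL'
      obtain ⟨h3, h4⟩ := L'.trySplit_of_depth_eq Q (h.2 t).2.2.1 (h.2 t).2.2.2 x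
        (hd.trans (Leaf.addStructure_depth ..).symm)
      rw [h4]
      exact ⟨rfl, fun hz' => absurd hz hz', fun _ hb' => by simp [hb] at hb',
        fun _ _ => ⟨rfl, h3⟩⟩
    · simp only [Leaf.step, hb, if_true]
      exact ⟨rfl, fun hz' => absurd hz hz', fun _ _ => rfl, fun _ hb' => by simp [hb] at hb'⟩
  · obtain ⟨h1, h2⟩ :=
      Tree.leafAt_step_of_notMem Q x (h.2 t).1 (h.2 t).2 _ (Set.mem_univ _) hz
    rw [h1, h2]
    exact ⟨rfl, fun _ => rfl, fun hz' => absurd hz' hz, fun hz' => absurd hz' hz⟩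

/-- The depth of the leaf at `x` tends to infinity, if the observations are generic and the cell of
`x` never is null. -/
theorem tendsto_depth (hm : 0 < m) {Q : Params m D C 𝒮} {ν : Measure (Feat D)}
    (hν : ∀ d θ, ν {x : Feat D | x d = θ} = 0) {h : Hist D C} {x : Feat D}
    (hh : ∀ B, NiceCell ν B → ν B ≠ 0 → ∀ b, ∃ᶠ t in atTop, (h.2 t).1.1 ∈ B ∧ (h.2 t).2.1 = b)
    (hdeg : ∀ t, (histTree Q h t).AllLeaves (fun A L => ¬ Degenerate ν A L) Set.univ)
    (hx : ∀ t, ν ((histTree Q h t).cellAt x Set.univ) ≠ 0) :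
    Tendsto (fun t => ((histTree Q h t).leafAt x).depth) atTop atTop := by
  have hmono := histTree_depth_monotone Q h x
  refine tendsto_atTop_of_frequently_lt (t₁ := 0) (fun t _ => hmono (Nat.le_succ t)) ?_
  refine frequently_atTop.2 fun t₀ => ?_
  -- Otherwise the leaf at `x` and its cell do not change after time `t₀`.
  by_contra! hcon
  have hsucc : ∀ t, t₀ ≤ t → ((histTree Q h (t + 1)).leafAt x).depth
      = ((histTree Q h t).leafAt x).depth := fun t ht =>
    le_antisymm (hcon t ht).2 (hmono (Nat.le_succ t))
  have hdepth : ∀ t, t₀ ≤ t → ((histTree Q h t).leafAt x).depth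
      = ((histTree Q h t₀).leafAt x).depth := fun t ht =>
    Nat.le_induction rfl (fun n hn ih => (hsucc n hn).trans ih) t ht
  have hcell : ∀ t, t₀ ≤ t → (histTree Q h t).cellAt x Set.univ
      = (histTree Q h t₀).cellAt x Set.univ := fun t ht =>
    Nat.le_induction rfl
      (fun n hn ih => (histTree_unsplitStep Q h x n (hsucc n hn)).1.trans ih) t ht
  refine not_forall_unsplitStep hm (Q := Q) hν (A := (histTree Q h t₀).cellAt x Set.univ)
    ((LeafInv.allLeaves (Q := Q) hν h t₀).at x).1 (hx t₀) (e := fun t => h.2 (t₀ + t))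
    (fun B hB hB0 b => ?_) (L := fun t => (histTree Q h (t₀ + t)).leafAt x) (fun t => ?_) 0
    (fun t _ => hdepth _ (by omega)) (fun t _ => ?_)
  · rw [frequently_atTop]
    intro a
    obtain ⟨s, hs, hs'⟩ := (frequently_atTop.1 (hh B hB hB0 b)) (t₀ + a)
    refine ⟨s - t₀, by omega, ?_⟩
    rwa [show t₀ + (s - t₀) = s by omega]
  · have := (hdeg (t₀ + t)).at x
    rwa [hcell _ (by omega)] at this
  · have := (histTree_unsplitStep Q h x (t₀ + t) (hsucc _ (by omega))).2
    rwa [hcell _ (by omega)] at this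

/-! ### The depth of the leaf at almost every point tends to infinity -/

/-- The second Borel–Cantelli lemma for an i.i.d. sequence. -/
theorem ae_frequently_mem {E : Type*} [MeasurableSpace E] (κ : Measure E) [IsProbabilityMeasure κ]
    {B : Set E} (hB : MeasurableSet B) (hκ : κ B ≠ 0) :
    ∀ᵐ w ∂Measure.infinitePi fun _ : ℕ => κ, ∃ᶠ t in atTop, w t ∈ B := by
  have hlt : κ Bᶜ < 1 := by
    rw [prob_compl_eq_one_sub hB]
    exact ENNReal.sub_lt_self (by simp) (by simp) hκ
  have hnull : ∀ n : ℕ, (Measure.infinitePi fun _ : ℕ => κ) {w | ∀ t, n ≤ t → w t ∉ B} = 0 := by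
    intro n
    have hle : ∀ k : ℕ, (Measure.infinitePi fun _ : ℕ => κ) {w | ∀ t, n ≤ t → w t ∉ B}
        ≤ κ Bᶜ ^ k := fun k => by
      calc _ ≤ (Measure.infinitePi fun _ : ℕ => κ)
            (((Finset.Ico n (n + k) : Finset ℕ) : Set ℕ).pi fun _ => Bᶜ) := by
            refine measure_mono fun w hw t ht => ?_
            have hw' : ∀ t, n ≤ t → w t ∉ B := hw
            exact hw' t (Finset.mem_Ico.1 ht).1
        _ = κ Bᶜ ^ k := by
            rw [Measure.infinitePi_pi _ fun _ _ => hB.compl]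
            simp
    exact le_antisymm (ge_of_tendsto' (ENNReal.tendsto_pow_atTop_nhds_zero_of_lt_one hlt) hle)
      zero_le
  have h := measure_iUnion_null hnull
  refine measure_mono_null (fun w hw => ?_) h
  have hw' : ¬ ∃ᶠ t in atTop, w t ∈ B := hw
  rw [not_frequently, eventually_atTop] at hw'
  obtain ⟨n, hn⟩ := hw'
  exact Set.mem_iUnion.2 ⟨n, fun t ht => hn t ht⟩

theorem drawLaw_stream_ne_zero {p : unitInterval} (hp0 : 0 < p) (hp1 : p < 1) (rate : ℝ≥0)
    (b : Bool) : drawLaw D p rate {u | u.1 = b} ≠ 0 := by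
  have hset : {u : Draw D | u.1 = b} = ({b} : Set Bool) ×ˢ Set.univ := by
    ext u; simp
  rw [hset, drawLaw, Measure.prod_prod, measure_univ, mul_one]
  intro h
  have hp0' : (0 : ℝ) < p := hp0
  have hp1' : (p : ℝ) < 1 := hp1
  cases b
  · have h1 := bernoulliMeasure_real_apply_of_notMem_of_mem (x := true) (y := false) p
      (measurableSet_singleton false) (by simp) (by simp)
    rw [measureReal_def, h, ENNReal.toReal_zero] at h1
    linarith
  · have h1 := bernoulliMeasure_real_apply_of_mem_of_notMem (x := true) (y := false) p
      (measurableSet_singleton true) (by simp) (by simp)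
    rw [measureReal_def, h, ENNReal.toReal_zero] at h1
    linarith

/-- Almost surely every nice set of positive mass receives infinitely many points of each stream. -/
theorem ae_frequently_niceCell (P : Measure (Feat D × Fin C)) [IsProbabilityMeasure P]
    {p : unitInterval} (hp0 : 0 < p) (hp1 : p < 1) (rate : ℝ≥0) :
    ∀ᵐ h ∂histLaw P p rate, ∀ B, NiceCell P.fst B → P.fst B ≠ 0 → ∀ b,
      ∃ᶠ t in atTop, (h.2 t).1.1 ∈ B ∧ (h.2 t).2.1 = b := by
  have hbasis := TopologicalSpace.isBasis_countableBasis (Feat D)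
  have hcount := TopologicalSpace.countable_countableBasis (Feat D)
  have h1 : ∀ᵐ w ∂Measure.infinitePi fun _ : ℕ => obsLaw P p rate,
      ∀ O ∈ TopologicalSpace.countableBasis (Feat D), ∀ b, P.fst O ≠ 0 →
        ∃ᶠ t in atTop, (w t).1.1 ∈ O ∧ (w t).2.1 = b := by
    rw [ae_ball_iff hcount]
    intro O hO
    rw [ae_all_iff]
    intro b
    by_cases hO0 : P.fst O = 0
    · simp [hO0]
    have hOm : MeasurableSet O := (hbasis.isOpen hO).measurableSet
    have hm : MeasurableSet {e : Obs D C | e.1.1 ∈ O ∧ e.2.1 = b} :=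
      (measurable_fst.comp measurable_fst hOm).inter
        ((measurable_fst.comp measurable_snd) (measurableSet_singleton b))
    have hset : {e : Obs D C | e.1.1 ∈ O ∧ e.2.1 = b}
        = (Prod.fst ⁻¹' O : Set (Feat D × Fin C)) ×ˢ {u : Draw D | u.1 = b} := by
      ext e; simp
    refine (ae_frequently_mem (obsLaw P p rate) hm ?_).mono fun w hw _ => hw
    rw [hset, Measure.prod_prod, ← Measure.fst_apply hOm]
    exact mul_ne_zero hO0 (drawLaw_stream_ne_zero hp0 hp1 rate b)
  have h2 := (measurePreserving_snd (μ := dimsLaw D rate)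
    (ν := Measure.infinitePi fun _ : ℕ => obsLaw P p rate)).quasiMeasurePreserving.ae h1
  refine h2.mono fun h hh B hB hB0 b => ?_
  have hint : P.fst (interior B) ≠ 0 := fun h0 => hB0 (measure_mono_null (fun x hx => by
    by_cases hxi : x ∈ interior B
    · exact Or.inl hxi
    · exact Or.inr ⟨hx, hxi⟩) (measure_union_null h0 hB.2))
  obtain ⟨O, hO, hOB, hO0⟩ : ∃ O ∈ TopologicalSpace.countableBasis (Feat D),
      O ⊆ interior B ∧ P.fst O ≠ 0 := by
    by_contra! hcon
    refine hint ?_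
    rw [hbasis.open_eq_sUnion' isOpen_interior]
    exact (measure_sUnion_null_iff (hcount.mono fun O hO => hO.1)).2
      fun O hO => hcon O hO.1 hO.2
  exact (hh O hO b hO0).mono fun t ht => ⟨interior_subset (hOB ht.1), ht.2⟩

/-- All leaves become deep, except for a part of vanishing mass. -/
theorem tendsto_shallowMass (hD : 0 < D) (hm : 0 < m) (P : Measure (Feat D × Fin C))
    [IsProbabilityMeasure P] (hν : ∀ d θ, P.fst {x : Feat D | x d = θ} = 0) {p : unitInterval}
    (hp0 : 0 < p) (hp1 : p < 1) (rate : ℝ≥0) (Q : Params m D C 𝒮) (N : ℕ) :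
    Tendsto (shallowMass P p rate Q N) atTop (𝓝 0) := by
  classical
  set g : Leaf m D C 𝒮 → Feat D → ℝ≥0∞ := fun L _ => if L.depth < N then 1 else 0 with hg
  have hg1 : ∀ L x, g L x ≤ 1 := fun L x => by simp only [hg]; split_ifs <;> simp
  have htotal : ∀ h t, (histTree Q h t).total (fun _ => 0) (massBelow P.fst N) Set.univ
      = ∫⁻ x, g ((histTree Q h t).leafAt x) x ∂P.fst := fun h t => by
    have h1 := (histTree Q h t).setLIntegral_eq_total P.fst g MeasurableSet.univ
    rw [Measure.restrict_univ] at h1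
    rw [h1]
    congr 1
    funext A L
    simp only [hg, massBelow]
    split_ifs <;> simp
  have hmeas : ∀ t, Measurable fun h : Hist D C =>
      (histTree Q h t).total (fun _ => 0) (massBelow P.fst N) Set.univ := fun t =>
    (histTree_measTree Q measurable_id t).measurable_total (fun _ _ => measurable_const)
      (measPot_massBelow P.fst N) (.const MeasurableSet.univ)
  have hmain : ∀ᵐ h ∂histLaw P p rate, Tendsto (fun t => (histTree Q h t).total (fun _ => 0)
      (massBelow P.fst N) Set.univ) atTop (𝓝 0) := by
    filter_upwards [ae_allLeaves_not_degenerate P hν hD p rate Q,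
      ae_frequently_niceCell P hp0 hp1 rate] with h hdeg hfreq
    simp only [htotal]
    have hx : ∀ᵐ x ∂P.fst, ∀ t, P.fst ((histTree Q h t).cellAt x Set.univ) ≠ 0 := by
      rw [ae_all_iff]
      intro t
      refine measure_mono_null (fun x hx => ?_)
        ((histTree Q h t).measure_cellAt_null P.fst Set.univ)
      exact ⟨Set.mem_univ x, not_not.1 hx⟩
    rw [show (0 : ℝ≥0∞) = ∫⁻ _ : Feat D, 0 ∂P.fst by simp]
    refine tendsto_lintegral_of_dominated_convergence (fun _ => 1) (fun t => ?_)
      (fun t => ae_of_all _ fun x => hg1 _ x) (by simp) ?_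
    · exact Measurable.ite (measurableSet_lt
        ((histTree_measTree Q measurable_const t).leafAt measurable_id).depth measurable_const)
        measurable_const measurable_const
    · filter_upwards [hx] with x hx
      have h1 := (tendsto_depth hm (Q := Q) hν hfreq hdeg hx).eventually_ge_atTop N
      refine tendsto_const_nhds.congr' ?_
      filter_upwards [h1] with t ht
      simp only [hg]
      rw [if_neg (not_lt.2 ht)]
  have h2 := tendsto_lintegral_of_dominated_convergence (μ := histLaw P p rate)
    (F := fun t h => (histTree Q h t).total (fun _ => 0) (massBelow P.fst N) Set.univ)
    (f := fun _ => 0) (fun _ => 1) hmeas (fun t => ae_of_all _ fun h => ?_) (by simp) hmain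
  · rw [lintegral_zero] at h2
    exact h2
  · simp only [htotal]
    exact (lintegral_mono fun x => hg1 _ x).trans (by simp)

end Depth

section Bias

/-! ### The cells become pure for every measurable set -/

theorem harm_le_harm_left {x x' y : ℝ} (hx : 0 ≤ x) (hy : 0 ≤ y) (h : x ≤ x') :
    harm x y ≤ harm x' y := by
  have h1 := harm_add_le hx hy (sub_nonneg.2 h) le_rfl
  have h2 : harm (x' - x) 0 = 0 := by simp [harm]
  rw [h2, add_zero, add_zero] at h1
  simpa using h1

theorem harm_add_right_le {x y₁ y₂ : ℝ} (hx : 0 ≤ x) (hy₁ : 0 ≤ y₁) (hy₂ : 0 ≤ y₂) :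
    harm x (y₁ + y₂) ≤ harm x y₁ + harm x y₂ := by
  rcases hx.eq_or_lt with h | h
  · subst h; simp [harm]
  have e : harm x (y₁ + y₂) = x * y₁ / (x + (y₁ + y₂)) + x * y₂ / (x + (y₁ + y₂)) := by
    unfold harm; rw [← add_div]; congr 1; ring
  rw [e]
  unfold harm
  gcongr <;> linarith

section Impurity

variable {D : ℕ} (ν : Measure (Feat D)) [IsFiniteMeasure ν]

theorem impurity_compl (B A : Set (Feat D)) : impurity ν Bᶜ A = impurity ν B A := by
  rw [impurity, impurity, harm_comm, ← Set.sdiff_eq, Set.sdiff_compl]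

theorem impurity_inter_le (B B' A : Set (Feat D)) :
    impurity ν (B ∩ B') A ≤ impurity ν B A + impurity ν B' A := by
  have h1 : ν.real (A \ (B ∩ B')) ≤ ν.real (A \ B) + ν.real (A \ B') := by
    rw [Set.sdiff_inter]; exact measureReal_union_le _ _
  have h0 : ∀ s, 0 ≤ ν.real s := fun s => measureReal_nonneg
  calc impurity ν (B ∩ B') A
      ≤ harm (ν.real (A ∩ (B ∩ B'))) (ν.real (A \ B) + ν.real (A \ B')) := by
        rw [impurity, harm_comm, harm_comm (ν.real (A ∩ (B ∩ B')))]
        exact harm_le_harm_left (h0 _) (h0 _) h1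
    _ ≤ harm (ν.real (A ∩ (B ∩ B'))) (ν.real (A \ B))
        + harm (ν.real (A ∩ (B ∩ B'))) (ν.real (A \ B')) :=
        harm_add_right_le (h0 _) (h0 _) (h0 _)
    _ ≤ _ := add_le_add
        (harm_le_harm_left (h0 _) (h0 _)
          (measureReal_mono (Set.inter_subset_inter_right A Set.inter_subset_left)))
        (harm_le_harm_left (h0 _) (h0 _)
          (measureReal_mono (Set.inter_subset_inter_right A Set.inter_subset_right)))

theorem impurity_le_of_subset {B B' : Set (Feat D)} (h : B ⊆ B') (A : Set (Feat D)) :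
    impurity ν B' A ≤ impurity ν B A + ν.real (A ∩ (B' \ B)) := by
  have h0 : ∀ s, 0 ≤ ν.real s := fun s => measureReal_nonneg
  have h1 : ν.real (A ∩ B') ≤ ν.real (A ∩ B) + ν.real (A ∩ (B' \ B)) := by
    rw [← Set.union_sdiff_cancel h, Set.inter_union_distrib_left, Set.union_sdiff_cancel h]
    exact measureReal_union_le _ _
  have h2 : ν.real (A \ B') ≤ ν.real (A \ B) :=
    measureReal_mono fun x hx => ⟨hx.1, fun hB => hx.2 (h hB)⟩
  calc impurity ν B' A
      ≤ harm (ν.real (A ∩ B) + ν.real (A ∩ (B' \ B))) (ν.real (A \ B')) :=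
        harm_le_harm_left (h0 _) (h0 _) h1
    _ ≤ harm (ν.real (A ∩ B)) (ν.real (A \ B'))
        + harm (ν.real (A ∩ (B' \ B))) (ν.real (A \ B')) := by
        simp only [harm_comm _ (ν.real (A \ B'))]
        exact harm_add_right_le (h0 _) (h0 _) (h0 _)
    _ ≤ _ := by
        refine add_le_add ?_ (harm_le_left (h0 _) (h0 _))
        rw [impurity, harm_comm, harm_comm (ν.real (A ∩ B))]
        exact harm_le_harm_left (h0 _) (h0 _) h2

end Impurity

variable {m D C : ℕ} {𝒮 : Type*} [MeasurableSpace 𝒮]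

section Mean

variable (P : Measure (Feat D × Fin C)) [IsProbabilityMeasure P] (p : unitInterval) (rate : ℝ≥0)
  (Q : Params m D C 𝒮)

/-- The expected value of an additive functional of the leaves at time `t`. -/
noncomputable def meanTotal (φ : Set (Feat D) → Leaf m D C 𝒮 → ℝ≥0∞) (t : ℕ) : ℝ≥0∞ :=
  ∫⁻ h, (histTree Q h t).total (fun _ => 0) φ Set.univ ∂histLaw P p rate

theorem meanTotal_measure (σ : Measure (Feat D)) (t : ℕ) :
    meanTotal P p rate Q (fun A _ => σ A) t = σ Set.univ := by
  simp only [meanTotal, total_measure, lintegral_const, measure_univ, mul_one]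

theorem meanTotal_const_mul {c : ℝ≥0∞} (hc : c ≠ ∞) (φ : Set (Feat D) → Leaf m D C 𝒮 → ℝ≥0∞)
    (t : ℕ) : meanTotal P p rate Q (fun A L => c * φ A L) t = c * meanTotal P p rate Q φ t := by
  have h : ∀ T : Tree m D C 𝒮, T.total (fun _ => 0) (fun A L => c * φ A L) Set.univ
      = c * T.total (fun _ => 0) φ Set.univ := fun T => by
    rw [← Tree.total_const_mul]; simp
  simp only [meanTotal, h]
  rw [lintegral_const_mul' _ _ hc]

variable {P Q}

theorem meanTotal_mono (hν : ∀ d θ, P.fst {x : Feat D | x d = θ} = 0)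
    {φ φ' : Set (Feat D) → Leaf m D C 𝒮 → ℝ≥0∞}
    (h : ∀ A L, MeasurableSet A → φ A L ≤ φ' A L) (t : ℕ) :
    meanTotal P p rate Q φ t ≤ meanTotal P p rate Q φ' t :=
  lintegral_mono fun w => Tree.total_mono (I := LeafInv Q P.fst) (fun _ => le_rfl)
    (fun A L hA => h A L hA.1.1) _ _ (LeafInv.allLeaves hν w t)

theorem meanTotal_le_add (hν : ∀ d θ, P.fst {x : Feat D | x d = θ} = 0)
    {φ φ₁ φ₂ : Set (Feat D) → Leaf m D C 𝒮 → ℝ≥0∞} (hφ₁ : MeasPot (Hist D C) φ₁)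
    (h : ∀ A L, MeasurableSet A → φ A L ≤ φ₁ A L + φ₂ A L) (t : ℕ) :
    meanTotal P p rate Q φ t ≤ meanTotal P p rate Q φ₁ t + meanTotal P p rate Q φ₂ t := by
  refine (meanTotal_mono p rate hν h t).trans (le_of_eq ?_)
  have h1 : ∀ T : Tree m D C 𝒮, T.total (fun _ => 0) (fun A L => φ₁ A L + φ₂ A L) Set.univ
      = T.total (fun _ => 0) φ₁ Set.univ + T.total (fun _ => 0) φ₂ Set.univ := fun T => by
    rw [← Tree.total_add]; simp
  simp only [meanTotal, h1]
  exact lintegral_add_left ((histTree_measTree Q measurable_id t).measurable_total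
    (fun _ _ => measurable_const) hφ₁ (.const MeasurableSet.univ)) _

variable (P Q)

/-- The `σ`-algebra of all sets for which the leaves become pure in mean. -/
@[reducible]
def pureSets (hν : ∀ d θ, P.fst {x : Feat D | x d = θ} = 0) : MeasurableSpace (Feat D) where
  MeasurableSet' B := MeasurableSet B ∧ Tendsto (meanImpurity P p rate Q B) atTop (𝓝 0)
  measurableSet_empty := by
    refine ⟨MeasurableSet.empty, ?_⟩
    have h : ∀ t, meanImpurity P p rate Q ∅ t = 0 := fun t => by
      have h1 := meanTotal_measure P p rate Q (0 : Measure (Feat D)) t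
      have h2 : (leafImpurity P.fst ∅ : Set (Feat D) → Leaf m D C 𝒮 → ℝ≥0∞)
          = fun A _ => (0 : Measure (Feat D)) A := by
        funext A L; simp [leafImpurity, impurity, harm]
      rw [← h2] at h1
      exact h1
    simp only [funext h]
    exact tendsto_const_nhds
  measurableSet_compl B hB := by
    refine ⟨hB.1.compl, ?_⟩
    have h : meanImpurity P p rate Q Bᶜ = meanImpurity P p rate Q B := by
      funext t
      have : (leafImpurity P.fst Bᶜ : Set (Feat D) → Leaf m D C 𝒮 → ℝ≥0∞)
          = leafImpurity P.fst B := by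
        funext A L; simp [leafImpurity, impurity_compl]
      simp only [meanImpurity, this]
    rw [h]
    exact hB.2
  measurableSet_iUnion f hf := by
    have hunion : ∀ B B' : Set (Feat D), MeasurableSet B → MeasurableSet B' →
        Tendsto (meanImpurity P p rate Q B) atTop (𝓝 0) →
        Tendsto (meanImpurity P p rate Q B') atTop (𝓝 0) →
        Tendsto (meanImpurity P p rate Q (B ∪ B')) atTop (𝓝 0) := by
      intro B B' hBm hBm' hB hB'
      have hle : ∀ t, meanImpurity P p rate Q (B ∪ B') t
          ≤ meanImpurity P p rate Q B t + meanImpurity P p rate Q B' t := fun t => by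
        refine meanTotal_le_add p rate hν (measPot_leafImpurity P.fst hBm) (fun A L _ => ?_) t
        rw [leafImpurity, leafImpurity, leafImpurity,
          ← ENNReal.ofReal_add (impurity_nonneg _ _ _) (impurity_nonneg _ _ _)]
        refine ENNReal.ofReal_le_ofReal ?_
        have h1 := impurity_inter_le P.fst Bᶜ B'ᶜ A
        rwa [← Set.compl_union, impurity_compl, impurity_compl, impurity_compl] at h1
      refine tendsto_of_tendsto_of_tendsto_of_le_of_le tendsto_const_nhds ?_
        (fun t => zero_le) hle
      simpa using hB.add hB'
    have hacc : ∀ n, MeasurableSet (Set.accumulate f n) ∧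
        Tendsto (meanImpurity P p rate Q (Set.accumulate f n)) atTop (𝓝 0) := by
      intro n
      induction n with
      | zero => simpa using hf 0
      | succ n ih =>
        rw [Set.accumulate_succ]
        exact ⟨ih.1.union (hf (n + 1)).1, hunion _ _ ih.1 (hf (n + 1)).1 ih.2 (hf (n + 1)).2⟩
    -- A countable union differs from a finite one by a set of small measure, which changes the
    -- impurity by at most that measure.
    have hU : MeasurableSet (⋃ n, f n) := MeasurableSet.iUnion fun n => (hf n).1
    refine ⟨hU, ?_⟩
    have hle : ∀ n t, meanImpurity P p rate Q (⋃ n, f n) t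
        ≤ meanImpurity P p rate Q (Set.accumulate f n) t
          + P.fst ((⋃ n, f n) \ Set.accumulate f n) := fun n t => by
      have h1 := meanTotal_le_add p rate hν (Q := Q) (φ := leafImpurity P.fst (⋃ n, f n))
        (φ₂ := fun A _ => (P.fst.restrict ((⋃ n, f n) \ Set.accumulate f n)) A)
        (measPot_leafImpurity P.fst (hacc n).1) (fun A L hA => ?_) t
      · rw [meanTotal_measure, Measure.restrict_apply_univ] at h1
        exact h1
      · rw [leafImpurity, leafImpurity, Measure.restrict_apply hA, ← ofReal_measureReal,
          ← ENNReal.ofReal_add (impurity_nonneg _ _ _) measureReal_nonneg]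
        exact ENNReal.ofReal_le_ofReal (impurity_le_of_subset P.fst
          (Set.accumulate_subset_iUnion n) A)
    have hlim : Tendsto (fun n => P.fst ((⋃ n, f n) \ Set.accumulate f n)) atTop (𝓝 0) := by
      have h1 := tendsto_measure_iInter_atTop (μ := P.fst)
        (s := fun n => (⋃ n, f n) \ Set.accumulate f n)
        (fun n => (hU.diff (hacc n).1).nullMeasurableSet)
        (fun i j hij => Set.sdiff_subset_sdiff_right (Set.monotone_accumulate hij))
        ⟨0, measure_ne_top _ _⟩
      have h2 : ⋂ n, (⋃ n, f n) \ Set.accumulate f n = ∅ := by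
        rw [← Set.sdiff_iUnion, Set.iUnion_accumulate, Set.sdiff_self]
      rw [h2, measure_empty] at h1
      exact h1
    rw [ENNReal.tendsto_nhds_zero]
    intro ε hε
    have hε2 : 0 < ε / 2 := ENNReal.half_pos hε.ne'
    obtain ⟨n, hn⟩ := ((ENNReal.tendsto_nhds_zero.1 hlim) _ hε2).exists
    filter_upwards [(ENNReal.tendsto_nhds_zero.1 (hacc n).2) _ hε2] with t ht
    exact (hle n t).trans ((add_le_add ht hn).trans (ENNReal.add_halves ε).le)

/-- All Borel sets become pure, since the coordinates are measurable with respect to `pureSets`. -/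
theorem tendsto_meanImpurity (hν : ∀ d θ, P.fst {x : Feat D | x d = θ} = 0)
    (hdepth : ∀ N, Tendsto (shallowMass P p rate Q N) atTop (𝓝 0)) {B : Set (Feat D)}
    (hB : MeasurableSet B) : Tendsto (meanImpurity P p rate Q B) atTop (𝓝 0) := by
  have hcoord : ∀ i : Fin D, @Measurable _ _ (pureSets P p rate Q hν) _ fun x : Feat D => x i := by
    intro i
    refine @measurable_of_Iic ℝ (Feat D) _ _ _ (pureSets P p rate Q hν) _ _ _ _ fun b => ?_
    exact ⟨measurableSet_coord_le i b, tendsto_meanImpurity_halfSpace P p rate Q hν hdepth i b⟩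
  have hfun : @Measurable _ _ (pureSets P p rate Q hν) _ fun (x : Feat D) (i : Fin D) => x i :=
    @measurable_pi_lambda _ _ _ (pureSets P p rate Q hν) _ _ hcoord
  have hid : @Measurable _ _ (pureSets P p rate Q hν) _ fun x : Feat D => x :=
    @Measurable.comp _ _ _ (pureSets P p rate Q hν) _ _ _ _
      (WithLp.measurable_toLp 2 (Fin D → ℝ)) hfun
  exact (hid hB).2

end Mean

/-! ### The bias vanishes -/

/-- The `L¹`-distance on the cell `A` between `f` and its average over `A`. -/
noncomputable def leafOsc (ν : Measure (Feat D)) (f : Feat D → ℝ) (A : Set (Feat D))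
    (_ : Leaf m D C 𝒮) : ℝ≥0∞ :=
  ∫⁻ x in A, ‖(∫ y in A, f y ∂ν) / ν.real A - f x‖ₑ ∂ν

theorem measPot_leafOsc {Ω : Type*} [MeasurableSpace Ω] (ν : Measure (Feat D)) [IsFiniteMeasure ν]
    {f : Feat D → ℝ} (hf : Measurable f) :
    MeasPot Ω (leafOsc ν f : Set (Feat D) → Leaf m D C 𝒮 → ℝ≥0∞) := fun L A _ hA => by
  have h1 : ∀ ω, ∫ y in A ω, f y ∂ν
      = ∫ y, {q : Ω × Feat D | q.2 ∈ A q.1}.indicator (fun q => f q.2) (ω, y) ∂ν := fun ω =>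
    (integral_indicator (measurable_prodMk_left hA)).symm
  have h2 : Measurable fun ω => ∫ y in A ω, f y ∂ν := by
    simp only [h1]
    exact (StronglyMeasurable.integral_prod_right'
      ((hf.comp measurable_snd).indicator hA).stronglyMeasurable).measurable
  have h3 : Measurable fun ω => (∫ y in A ω, f y ∂ν) / ν.real (A ω) :=
    h2.div (hA.measurable_measure ν).ennreal_toReal
  exact hA.measurable_lintegral ν
    (f := fun q => ‖(∫ y in A q.1, f y ∂ν) / ν.real (A q.1) - f q.2‖ₑ)
    ((h3.comp measurable_fst).sub (hf.comp measurable_snd)).enorm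

section Osc

variable (ν : Measure (Feat D)) [IsFiniteMeasure ν]

theorem leafOsc_add_le {f g : Feat D → ℝ} (hf : Integrable f ν) (hg : Integrable g ν)
    (hfm : Measurable f) (A : Set (Feat D)) (L : Leaf m D C 𝒮) :
    leafOsc ν (f + g) A L ≤ leafOsc ν f A L + leafOsc ν g A L := by
  unfold leafOsc
  rw [← lintegral_add_left (hfm.const_sub _).enorm]
  refine lintegral_mono fun x => ?_
  have h : (∫ y in A, (f + g) y ∂ν) / ν.real A - (f + g) x
      = ((∫ y in A, f y ∂ν) / ν.real A - f x) + ((∫ y in A, g y ∂ν) / ν.real A - g x) := by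
    have : ∫ y in A, (f + g) y ∂ν = ∫ y in A, f y ∂ν + ∫ y in A, g y ∂ν :=
      integral_add hf.integrableOn hg.integrableOn
    rw [this, Pi.add_apply]
    ring
  rw [h]
  exact enorm_add_le _ _

theorem leafOsc_le_two_mul (f : Feat D → ℝ) (A : Set (Feat D)) (L : Leaf m D C 𝒮) :
    leafOsc ν f A L ≤ 2 * ∫⁻ x in A, ‖f x‖ₑ ∂ν := by
  unfold leafOsc
  set c := (∫ y in A, f y ∂ν) / ν.real A with hc
  have h1 : ‖c‖ₑ * ν A ≤ ∫⁻ x in A, ‖f x‖ₑ ∂ν := by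
    rcases eq_or_ne (ν A) 0 with h0 | h0
    · simp [h0]
    have hpos : 0 < ν.real A := ENNReal.toReal_pos h0 (measure_ne_top _ _)
    have : ‖c‖ₑ * ν A = ‖∫ y in A, f y ∂ν‖ₑ := by
      rw [← ofReal_measureReal (μ := ν) (s := A), ← Real.enorm_of_nonneg hpos.le, ← enorm_mul, hc,
        div_mul_cancel₀ _ hpos.ne']
    rw [this]
    exact enorm_integral_le_lintegral_enorm _
  calc ∫⁻ x in A, ‖c - f x‖ₑ ∂ν ≤ ∫⁻ x in A, (‖c‖ₑ + ‖f x‖ₑ) ∂ν :=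
        lintegral_mono fun x => enorm_sub_le
    _ = ‖c‖ₑ * ν A + ∫⁻ x in A, ‖f x‖ₑ ∂ν := by
        rw [lintegral_add_left measurable_const, setLIntegral_const]
    _ ≤ _ := by rw [two_mul]; gcongr

/-- The oscillation of an indicator function is twice its impurity. -/
theorem leafOsc_indicator_le {B : Set (Feat D)} (hB : MeasurableSet B) (c : ℝ)
    {A : Set (Feat D)} (hA : MeasurableSet A) (L : Leaf m D C 𝒮) :
    leafOsc ν (B.indicator fun _ => c) A L ≤ 2 * ‖c‖ₑ * leafImpurity ν B A L := by
  rcases eq_or_ne (ν A) 0 with h0 | h0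
  · rw [leafOsc, setLIntegral_measure_zero _ _ h0]; exact zero_le
  have hpos : 0 < ν.real A := ENNReal.toReal_pos h0 (measure_ne_top _ _)
  have hsplit : ν.real (A ∩ B) + ν.real (A \ B) = ν.real A := measureReal_inter_add_sdiff hB
  have hint : ∫ y in A, B.indicator (fun _ => c) y ∂ν = ν.real (A ∩ B) * c := by
    rw [setIntegral_indicator hB, setIntegral_const, smul_eq_mul]
  unfold leafOsc leafImpurity impurity harm
  rw [hint, hsplit]
  set a := ν.real (A ∩ B) with ha
  set b := ν.real (A \ B) with hb
  have ha0 : 0 ≤ a := measureReal_nonneg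
  have hb0 : 0 ≤ b := measureReal_nonneg
  rw [← lintegral_inter_add_sdiff _ _ hB,
    setLIntegral_congr_fun (g := fun _ => ‖a * c / ν.real A - c‖ₑ) (hA.inter hB)
      (fun x hx => by simp [hx.2]),
    setLIntegral_congr_fun (g := fun _ => ‖a * c / ν.real A - 0‖ₑ) (hA.diff hB)
      (fun x hx => by simp [hx.2]),
    setLIntegral_const, setLIntegral_const, ← ofReal_measureReal (μ := ν) (s := A ∩ B),
    ← ofReal_measureReal (μ := ν) (s := A \ B), ← ha, ← hb]
  refine le_of_eq ?_
  rw [← Real.enorm_of_nonneg ha0, ← Real.enorm_of_nonneg hb0, ← enorm_mul, ← enorm_mul,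
    ← Real.enorm_of_nonneg (show 0 ≤ a * b / ν.real A by positivity), mul_assoc, ← enorm_mul,
    two_mul]
  congr 1
  · rw [← enorm_neg]
    congr 1
    rw [← hsplit] at hpos ⊢
    field_simp
    ring
  · congr 1
    rw [sub_zero]
    ring

end Osc

section MeanOsc

variable (P : Measure (Feat D × Fin C)) [IsProbabilityMeasure P] (p : unitInterval) (rate : ℝ≥0)
  (Q : Params m D C 𝒮)

theorem tendsto_meanTotal_leafOsc_simpleFunc (hν : ∀ d θ, P.fst {x : Feat D | x d = θ} = 0)
    (hdepth : ∀ N, Tendsto (shallowMass P p rate Q N) atTop (𝓝 0))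
    (g : SimpleFunc (Feat D) ℝ) :
    Tendsto (meanTotal P p rate Q (leafOsc P.fst g)) atTop (𝓝 0) := by
  classical
  induction g using SimpleFunc.induction with
  | const c hs =>
    rename_i s
    have hcoe : ⇑(SimpleFunc.piecewise s hs (SimpleFunc.const _ c) (SimpleFunc.const _ 0))
        = s.indicator fun _ => c := by
      rw [SimpleFunc.coe_piecewise]
      simp only [SimpleFunc.coe_const]
      exact Set.piecewise_eq_indicator
    rw [hcoe]
    have hc : 2 * ‖c‖ₑ ≠ ∞ := ENNReal.mul_ne_top (by simp) enorm_ne_top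
    have hle : ∀ t, meanTotal P p rate Q (leafOsc P.fst (s.indicator fun _ => c)) t
        ≤ 2 * ‖c‖ₑ * meanImpurity P p rate Q s t := fun t =>
      (meanTotal_mono p rate hν (fun A L hA => leafOsc_indicator_le P.fst hs c hA L) t).trans
        (meanTotal_const_mul P p rate Q hc _ t).le
    refine tendsto_of_tendsto_of_tendsto_of_le_of_le tendsto_const_nhds ?_ (fun t => zero_le) hle
    simpa using ENNReal.Tendsto.const_mul (tendsto_meanImpurity P p rate Q hν hdepth hs)
      (Or.inr hc)
  | @add f g _ hf hg =>
    have hle : ∀ t, meanTotal P p rate Q (leafOsc P.fst (f + g : SimpleFunc (Feat D) ℝ)) t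
        ≤ meanTotal P p rate Q (leafOsc P.fst f) t + meanTotal P p rate Q (leafOsc P.fst g) t :=
      fun t => meanTotal_le_add p rate hν (measPot_leafOsc P.fst f.measurable) (fun A L _ => by
        rw [SimpleFunc.coe_add]
        exact leafOsc_add_le P.fst f.integrable_of_isFiniteMeasure g.integrable_of_isFiniteMeasure
          f.measurable A L) t
    refine tendsto_of_tendsto_of_tendsto_of_le_of_le tendsto_const_nhds ?_ (fun t => zero_le) hle
    simpa using hf.add hg

/-- The oscillation of every integrable function vanishes in mean: simple functions are dense in `L¹`,
and the oscillation is at most twice the `L¹`-norm. -/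
theorem tendsto_meanTotal_leafOsc (hν : ∀ d θ, P.fst {x : Feat D | x d = θ} = 0)
    (hdepth : ∀ N, Tendsto (shallowMass P p rate Q N) atTop (𝓝 0))
    {f : Feat D → ℝ} (hf : Measurable f) (hfi : Integrable f P.fst) :
    Tendsto (meanTotal P p rate Q (leafOsc P.fst f)) atTop (𝓝 0) := by
  rw [ENNReal.tendsto_nhds_zero]
  intro ε hε
  have hε3 : 0 < ε / 3 := ENNReal.div_pos hε.ne' (by simp)
  obtain ⟨n, hn⟩ := ((ENNReal.tendsto_nhds_zero.1
    (SimpleFunc.tendsto_approxOn_range_L1_enorm hf hfi)) _ hε3).exists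
  set g := SimpleFunc.approxOn f hf (Set.range f ∪ {0}) 0 (by simp) n with hg
  have hgi : Integrable g P.fst := g.integrable_of_isFiniteMeasure
  set σ : Measure (Feat D) := P.fst.withDensity fun x => ‖g x - f x‖ₑ with hσ
  filter_upwards [(ENNReal.tendsto_nhds_zero.1
    (tendsto_meanTotal_leafOsc_simpleFunc P p rate Q hν hdepth g)) _ hε3] with t ht
  have h1 := meanTotal_le_add p rate hν (Q := Q) (φ := leafOsc P.fst f) (φ₁ := leafOsc P.fst g)
    (φ₂ := fun A _ => 2 * σ A) (measPot_leafOsc P.fst g.measurable) (fun A L hA => ?_) t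
  · rw [meanTotal_const_mul P p rate Q (by simp), meanTotal_measure, hσ,
      withDensity_apply _ MeasurableSet.univ, Measure.restrict_univ] at h1
    refine h1.trans ((add_le_add ht (mul_le_mul_right hn 2)).trans (le_of_eq ?_))
    have : ε / 3 + 2 * (ε / 3) = 3 * (ε / 3) := by ring
    rw [this, ENNReal.mul_div_cancel (by simp) (by simp)]
  · have h2 := leafOsc_add_le P.fst hgi (hfi.sub hgi) g.measurable A L
    rw [add_sub_cancel] at h2
    refine h2.trans (add_le_add le_rfl ((leafOsc_le_two_mul P.fst _ A L).trans (le_of_eq ?_)))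
    rw [hσ, withDensity_apply _ hA]
    congr 1
    refine lintegral_congr fun x => ?_
    rw [Pi.sub_apply, ← enorm_neg, neg_sub]

variable [NeZero C]

theorem measurable_posterior (k : Fin C) : Measurable fun x => posterior P x k :=
  (Kernel.measurable_coe P.condKernel (measurableSet_singleton k)).ennreal_toReal

theorem posterior_nonneg (x : Feat D) (k : Fin C) : 0 ≤ posterior P x k := measureReal_nonneg

theorem posterior_le_one (x : Feat D) (k : Fin C) : posterior P x k ≤ 1 := measureReal_le_one

theorem integrable_posterior (k : Fin C) : Integrable (fun x => posterior P x k) P.fst :=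
  Integrable.of_bound (measurable_posterior P k).aestronglyMeasurable 1 (ae_of_all _ fun x => by
    rw [Real.norm_of_nonneg (posterior_nonneg P x k)]; exact posterior_le_one P x k)

theorem setLIntegral_posterior (k : Fin C) {A : Set (Feat D)} (hA : MeasurableSet A) :
    ∫⁻ x in A, ENNReal.ofReal (posterior P x k) ∂P.fst = classMass P k A := by
  rw [classMass_apply P k hA]
  have h := Measure.setLIntegral_condKernel_eq_measure_prod (ρ := P) hA (measurableSet_singleton k)
  refine Eq.trans (lintegral_congr fun x => ?_) h
  exact ofReal_measureReal

theorem setIntegral_posterior (k : Fin C) {A : Set (Feat D)} (hA : MeasurableSet A) :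
    ∫ x in A, posterior P x k ∂P.fst = (classMass P k).real A := by
  rw [integral_eq_lintegral_of_nonneg_ae (ae_of_all _ fun x => posterior_nonneg P x k)
    (measurable_posterior P k).aestronglyMeasurable, setLIntegral_posterior P k hA]
  rfl

theorem tendsto_meanBias_posterior (hν : ∀ d θ, P.fst {x : Feat D | x d = θ} = 0)
    (hdepth : ∀ N, Tendsto (shallowMass P p rate Q N) atTop (𝓝 0)) (k : Fin C) :
    Tendsto (meanBias P p rate Q k fun x => posterior P x k) atTop (𝓝 0) := by
  refine tendsto_of_tendsto_of_tendsto_of_le_of_le tendsto_const_nhds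
    (tendsto_meanTotal_leafOsc P p rate Q hν hdepth (measurable_posterior P k)
      (integrable_posterior P k)) (fun t => zero_le) fun t => ?_
  refine meanTotal_mono p rate hν (φ := leafBias P k fun x => posterior P x k)
    (fun A L hA => le_of_eq ?_) t
  unfold leafBias leafOsc classFrac
  rw [setIntegral_posterior P k hA]
  simp only [Real.enorm_eq_ofReal_abs]

end MeanOsc

end Bias

section Risk

/-! ### The excess risk of the forest -/

variable {m D C M : ℕ} {𝒮 : Type*} [MeasurableSpace 𝒮] [NeZero C]

theorem le_argmax (f : Fin C → ℝ) (j : Fin C) : f j ≤ f (argmax f) := by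
  have h := Finset.min'_mem _ (exists_maximizer f)
  exact (Finset.mem_filter.1 h).2 j

theorem argmax_eq_iff (f : Fin C → ℝ) (k : Fin C) :
    argmax f = k ↔ (∀ j, f j ≤ f k) ∧ ∀ i < k, ¬ ∀ j, f j ≤ f i := by
  constructor
  · rintro rfl
    refine ⟨le_argmax f, fun i hi h => ?_⟩
    exact absurd (Finset.min'_le _ i (by simpa using h)) (not_le.2 hi)
  · rintro ⟨h1, h2⟩
    refine le_antisymm (Finset.min'_le _ k (by simpa using h1)) ?_
    by_contra h
    exact h2 _ (not_le.1 h) (le_argmax f)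

theorem measurable_argmax {Ω : Type*} [MeasurableSpace Ω] {f : Ω → Fin C → ℝ}
    (hf : ∀ k, Measurable fun ω => f ω k) : Measurable fun ω => argmax (f ω) := by
  have hmax : ∀ k, MeasurableSet {ω | ∀ j, f ω j ≤ f ω k} := fun k => by
    rw [Set.ofPred_forall]
    exact MeasurableSet.iInter fun j => measurableSet_le (hf j) (hf k)
  refine measurable_to_countable' fun k => ?_
  refine MeasurableSet.congr ((hmax k).inter (MeasurableSet.iInter fun i : {i // i < k} =>
    (hmax i).compl)) ?_
  ext ω
  simp only [Set.mem_preimage, Set.mem_singleton_iff, argmax_eq_iff]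
  simp

theorem measurable_posteriorEst {Ω : Type*} [MeasurableSpace Ω] {T : Ω → Tree m D C 𝒮}
    (hT : MeasTree T) {x : Ω → Feat D} (hx : Measurable x) (k : Fin C) :
    Measurable fun ω => (T ω).posteriorEst (x ω) k := by
  have hL := hT.leafAt hx
  exact ((measurable_from_nat (f := fun n : ℕ => (n : ℝ))).comp (hL.est k)).div
    ((measurable_from_nat (f := fun n : ℕ => (n : ℝ))).comp hL.measurable_numEst)

theorem measurable_forestClassify {Ω : Type*} [MeasurableSpace Ω] {T : Ω → Fin M → Tree m D C 𝒮}
    (hT : ∀ j, MeasTree fun ω => T ω j) {x : Ω → Feat D} (hx : Measurable x) :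
    Measurable fun ω => forestClassify (T ω) (x ω) := by
  have hcl : ∀ j, Measurable fun ω => (T ω j).classify (x ω) := fun j =>
    measurable_argmax fun k => measurable_posteriorEst (hT j) hx k
  refine measurable_argmax fun k => ?_
  simp only [Finset.card_filter, Nat.cast_sum]
  refine Finset.measurable_sum _ fun j _ => ?_
  exact (measurable_from_nat (f := fun n : ℕ => (n : ℝ))).comp
    (Measurable.ite (hcl j (measurableSet_singleton k)) measurable_const measurable_const)

/-- The winner of the vote is the choice of one of the trees. -/
theorem exists_classify_eq_forestClassify (hM : 0 < M) (T : Fin M → Tree m D C 𝒮) (x : Feat D) :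
    ∃ j, (T j).classify x = forestClassify T x := by
  set v : Fin C → ℝ :=
    fun k => ((Finset.univ.filter fun j => (T j).classify x = k).card : ℝ) with hv
  have h1 : v ((T ⟨0, hM⟩).classify x) ≤ v (forestClassify T x) := le_argmax v _
  have h2 : 0 < v ((T ⟨0, hM⟩).classify x) := by
    simp only [hv, Nat.cast_pos]
    exact Finset.card_pos.2 ⟨⟨0, hM⟩, by simp⟩
  have h3 := h2.trans_le h1
  simp only [hv, Nat.cast_pos] at h3
  obtain ⟨j, hj⟩ := Finset.card_pos.1 h3
  exact ⟨j, (Finset.mem_filter.1 hj).2⟩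

/-- Some tree prefers the choice of the forest to any class `b`, so the loss in the posterior is at
most twice the largest estimation error of that tree. -/
theorem posterior_sub_le (hM : 0 < M) (T : Fin M → Tree m D C 𝒮) (x : Feat D) (q : Fin C → ℝ)
    (b : Fin C) : q b - q (forestClassify T x)
      ≤ ∑ j, ∑ k, 2 * |(T j).posteriorEst x k - q k| := by
  obtain ⟨j, hj⟩ := exists_classify_eq_forestClassify hM T x
  set c := forestClassify T x with hc
  have h1 : (T j).posteriorEst x b ≤ (T j).posteriorEst x c := by
    rw [← hj]; exact le_argmax _ b
  have hk : ∀ k, |(T j).posteriorEst x k - q k| ≤ ∑ k, |(T j).posteriorEst x k - q k| := fun k =>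
    Finset.single_le_sum (f := fun k => |(T j).posteriorEst x k - q k|)
      (fun _ _ => abs_nonneg _) (Finset.mem_univ k)
  have h2 : ∑ k, 2 * |(T j).posteriorEst x k - q k|
      ≤ ∑ j, ∑ k, 2 * |(T j).posteriorEst x k - q k| :=
    Finset.single_le_sum (f := fun j => ∑ k, 2 * |(T j).posteriorEst x k - q k|)
      (fun _ _ => Finset.sum_nonneg fun _ _ => by positivity) (Finset.mem_univ j)
  refine le_trans ?_ h2
  rw [← Finset.mul_sum]
  have h3 := (abs_le.1 (hk b)).1
  have h4 := (abs_le.1 (hk c)).2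
  linarith

variable (P : Measure (Feat D × Fin C)) [IsProbabilityMeasure P]

theorem measurable_posterior_comp {g : Feat D → Fin C} (hg : Measurable g) :
    Measurable fun x => posterior P x (g x) := by
  have h : Measurable fun q : Feat D × Fin C => posterior P q.1 q.2 :=
    measurable_from_prod_countable_left fun k => measurable_posterior P k
  exact h.comp (measurable_id.prodMk hg)

theorem integrable_posterior_comp {g : Feat D → Fin C} (hg : Measurable g) :
    Integrable (fun x => posterior P x (g x)) P.fst :=
  Integrable.of_bound (measurable_posterior_comp P hg).aestronglyMeasurable 1
    (ae_of_all _ fun x => by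
      rw [Real.norm_of_nonneg (posterior_nonneg P x _)]; exact posterior_le_one P x _)

theorem measurable_bayesClassifier : Measurable (bayesClassifier P) :=
  measurable_argmax fun k => measurable_posterior P k

theorem risk_eq {g : Feat D → Fin C} (hg : Measurable g) :
    risk P g = 1 - ∫ x, posterior P x (g x) ∂P.fst := by
  have hset : MeasurableSet {z : Feat D × Fin C | g z.1 = z.2} :=
    measurableSet_eq_fun (hg.comp measurable_fst) measurable_snd
  have hcompl : {z : Feat D × Fin C | g z.1 ≠ z.2} = {z | g z.1 = z.2}ᶜ := by ext; simp
  have h1 : P {z | g z.1 = z.2} = ∫⁻ x, ENNReal.ofReal (posterior P x (g x)) ∂P.fst := by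
    have h2 : P {z | g z.1 = z.2} = ∑ k, P (Prod.fst ⁻¹' (g ⁻¹' {k}) ∩ Prod.snd ⁻¹' {k}) := by
      rw [← measure_biUnion_finset]
      · congr 1
        ext z
        simp [eq_comm]
      · intro k _ k' _ hkk'
        refine Set.disjoint_left.2 fun z hz hz' => hkk' ?_
        have e1 : z.2 = k := hz.2
        have e2 : z.2 = k' := hz'.2
        exact e1.symm.trans e2
      · exact fun k _ => (measurable_fst (hg (measurableSet_singleton k))).inter
          (measurable_snd (measurableSet_singleton k))
    have h3 : (Set.univ : Set (Feat D)) = ⋃ k ∈ (Finset.univ : Finset (Fin C)), g ⁻¹' {k} := by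
      ext x; simp
    rw [h2, ← setLIntegral_univ, h3, lintegral_biUnion_finset]
    · refine Finset.sum_congr rfl fun k _ => ?_
      have hgk : MeasurableSet (g ⁻¹' {k}) := hg (measurableSet_singleton k)
      rw [← classMass_apply P k hgk, ← setLIntegral_posterior P k hgk]
      refine setLIntegral_congr_fun hgk fun x hx => ?_
      have : g x = k := hx
      simp only [this]
    · intro k _ k' _ hkk'
      refine Set.disjoint_left.2 fun x hx hx' => hkk' ?_
      have e1 : g x = k := hx
      have e2 : g x = k' := hx'
      exact e1.symm.trans e2
    · exact fun k _ => hg (measurableSet_singleton k)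
  rw [risk, hcompl, measureReal_compl hset, probReal_univ, measureReal_def, h1,
    integral_eq_lintegral_of_nonneg_ae (ae_of_all _ fun x => posterior_nonneg P x _)
      (measurable_posterior_comp P hg).aestronglyMeasurable]

theorem bayesRisk_le_risk {g : Feat D → Fin C} (hg : Measurable g) :
    bayesRisk P ≤ risk P g := by
  rw [bayesRisk, risk_eq P hg, risk_eq P (measurable_bayesClassifier P)]
  exact sub_le_sub_left (integral_mono (integrable_posterior_comp P hg)
    (integrable_posterior_comp P (measurable_bayesClassifier P))
    fun x => le_argmax (posterior P x) _) 1

/-- The excess risk of the forest is bounded by the `L¹`-errors of the posterior estimates of its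
trees. -/
theorem excessRisk_le (hM : 0 < M) (T : Fin M → Tree m D C 𝒮)
    (hT : ∀ j, MeasTree fun _ : Feat D => T j) :
    ENNReal.ofReal (risk P (forestClassify T) - bayesRisk P)
      ≤ ∑ j, ∑ k, 2 * ∫⁻ x, ENNReal.ofReal |(T j).posteriorEst x k - posterior P x k| ∂P.fst := by
  have hg : Measurable (forestClassify T) := measurable_forestClassify hT measurable_id
  have hb := measurable_bayesClassifier P
  have hm : ∀ j k, Measurable fun x =>
      2 * ENNReal.ofReal |(T j).posteriorEst x k - posterior P x k| := fun j k =>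
    ((measurable_posteriorEst (hT j) measurable_id k).sub
      (measurable_posterior P k)).abs.ennreal_ofReal.const_mul 2
  have h1 : risk P (forestClassify T) - bayesRisk P
      = ∫ x, (posterior P x (bayesClassifier P x) - posterior P x (forestClassify T x)) ∂P.fst := by
    rw [bayesRisk, risk_eq P hg, risk_eq P hb, integral_sub (integrable_posterior_comp P hb)
      (integrable_posterior_comp P hg)]
    ring
  have hi : Integrable (fun x => posterior P x (bayesClassifier P x)
      - posterior P x (forestClassify T x)) P.fst :=
    (integrable_posterior_comp P hb).sub (integrable_posterior_comp P hg)
  rw [h1, ofReal_integral_eq_lintegral_ofReal hi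
    (ae_of_all _ fun x => sub_nonneg.2 (le_argmax (posterior P x) _))]
  have h2 : ∀ x, ENNReal.ofReal
      (posterior P x (bayesClassifier P x) - posterior P x (forestClassify T x))
      ≤ ∑ j, ∑ k, 2 * ENNReal.ofReal |(T j).posteriorEst x k - posterior P x k| := fun x => by
    refine (ENNReal.ofReal_le_ofReal (posterior_sub_le hM T x (posterior P x) _)).trans
      (le_of_eq ?_)
    rw [ENNReal.ofReal_sum_of_nonneg fun j _ => Finset.sum_nonneg fun k _ => by positivity]
    refine Finset.sum_congr rfl fun j _ => ?_
    rw [ENNReal.ofReal_sum_of_nonneg fun k _ => by positivity]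
    refine Finset.sum_congr rfl fun k _ => ?_
    rw [ENNReal.ofReal_mul (by norm_num), ENNReal.ofReal_ofNat]
  refine (lintegral_mono h2).trans (le_of_eq ?_)
  rw [lintegral_finsetSum _ fun j _ => Finset.measurable_sum _ fun k _ => hm j k]
  refine Finset.sum_congr rfl fun j _ => ?_
  rw [lintegral_finsetSum _ fun k _ => hm j k]
  exact Finset.sum_congr rfl fun k _ => lintegral_const_mul' _ _ (by simp)

theorem fst_hyperplane (hP : P.fst ≪ (volume : Measure (Feat D))) (d : Fin D) (θ : ℝ) :
    P.fst {x : Feat D | x d = θ} = 0 := by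
  refine hP ?_
  have hm : MeasurableSet {f : Fin D → ℝ | f d = θ} :=
    measurableSet_eq_fun (measurable_pi_apply d) measurable_const
  have h := (PiLp.volume_preserving_ofLp (Fin D)).measure_preimage hm.nullMeasurableSet
  exact h.trans (Measure.pi_hyperplane (fun _ : Fin D => (volume : Measure ℝ)) d θ)

theorem measurable_risk_forest {M : ℕ} (Q : Params m D C 𝒮) (t : ℕ) :
    Measurable fun H : Fin M → Hist D C =>
      risk P (forestClassify fun j => histTree Q (H j) t) := by
  have hf : Measurable fun q : (Fin M → Hist D C) × (Feat D × Fin C) =>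
      forestClassify (fun j => histTree Q (q.1 j) t) q.2.1 :=
    measurable_forestClassify
      (fun j => histTree_measTree Q ((measurable_pi_apply j).comp measurable_fst) t)
      (measurable_fst.comp measurable_snd)
  have hs : MeasurableSet {q : (Fin M → Hist D C) × (Feat D × Fin C) |
      forestClassify (fun j => histTree Q (q.1 j) t) q.2.1 ≠ q.2.2} :=
    (measurableSet_eq_fun hf (measurable_snd.comp measurable_snd)).compl
  exact (measurable_measure_prodMk_left hs).ennreal_toReal

theorem measurable_treeError (Q : Params m D C 𝒮) (k : Fin C) (t : ℕ) :
    Measurable fun h : Hist D C => ∫⁻ x,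
      ENNReal.ofReal |(histTree Q h t).posteriorEst x k - posterior P x k| ∂P.fst := by
  refine Measurable.lintegral_prod_right' (f := fun q : Hist D C × Feat D =>
    ENNReal.ofReal |(histTree Q q.1 t).posteriorEst q.2 k - posterior P q.2 k|) ?_
  exact ((measurable_posteriorEst (histTree_measTree Q measurable_fst t) measurable_snd k).sub
    ((measurable_posterior P k).comp measurable_snd)).abs.ennreal_ofReal

variable {P}

/-- All that one tree observes has the product law. -/
theorem hasLaw_hist {Ω : Type*} [MeasurableSpace Ω] {μ : Measure Ω} [IsProbabilityMeasure μ]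
    {p : unitInterval} {rate : ℝ≥0} {W₀ : Ω → Finset (Fin D)} {W : ℕ → Ω → Obs D C}
    (hroot : HasLaw W₀ (dimsLaw D rate) μ) (hlaw : ∀ t, HasLaw (W t) (obsLaw P p rate) μ)
    (hindep : iIndepFun W μ) (hroot_indep : IndepFun W₀ (fun ω t => W t ω) μ) :
    HasLaw (fun ω => ((W₀ ω, fun t => W t ω) : Hist D C)) (histLaw P p rate) μ := by
  have hW : AEMeasurable (fun ω t => W t ω) μ := aemeasurable_pi_iff.2 fun t => (hlaw t).aemeasurable
  refine ⟨hroot.aemeasurable.prodMk hW, ?_⟩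
  rw [(indepFun_iff_map_prod_eq_prod_map_map hroot.aemeasurable hW).1 hroot_indep,
    (iIndepFun_iff_map_fun_eq_infinitePi_map₀ hW).1 hindep, hroot.map_eq, histLaw]
  congr 2
  funext t
  exact (hlaw t).map_eq

end Risk

end OnlineForest

theorem mainTheorem1
    {Ω : Type*} [MeasurableSpace Ω] (μ : Measure Ω) [IsProbabilityMeasure μ]
    {𝒮 : Type*} [MeasurableSpace 𝒮]
    (D C m M : ℕ) [NeZero C] (hD : 0 < D) (hm : 0 < m) (hM : 0 < M)
    -- the law of `(X, Y)`; the law of `X` has a density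
    (P : Measure (OnlineForest.Feat D × Fin C)) [IsProbabilityMeasure P]
    (hP : P.fst ≪ (volume : Measure (OnlineForest.Feat D)))
    -- the parameters of the algorithm
    (p : unitInterval) (hp0 : 0 < p) (hp1 : p < 1) (rate : ℝ≥0)
    (Q : OnlineForest.Params m D C 𝒮)
    (hα_mono : Monotone Q.α) (hα : Tendsto Q.α atTop atTop)
    (hα_growth : Tendsto (fun d : ℕ => (d : ℝ) / Q.α d) atTop (𝓝 0))
    (hβ : ∀ d, Q.α d ≤ Q.β d)
    -- the data stream, and for each tree `j` its root dimensions and its random choices;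
    -- different trees may depend on each other
    (Z : ℕ → Ω → OnlineForest.Feat D × Fin C)
    (U₀ : Fin M → Ω → Finset (Fin D))
    (U : Fin M → ℕ → Ω → OnlineForest.Draw D)
    (hroot : ∀ j, HasLaw (U₀ j) (OnlineForest.dimsLaw D rate) μ)
    (hlaw : ∀ j t, HasLaw (fun ω => (Z t ω, U j t ω))
      (P.prod (OnlineForest.drawLaw D p rate)) μ)
    (hindep : ∀ j, iIndepFun (fun (t : ℕ) ω => (Z t ω, U j t ω)) μ)
    (hroot_indep : ∀ j, IndepFun (U₀ j) (fun ω (t : ℕ) => (Z t ω, U j t ω)) μ) :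
    (∀ t, Integrable (fun ω => OnlineForest.risk P (OnlineForest.forestClassify fun j =>
        OnlineForest.treeAt Q (U₀ j ω) (fun s => Z s ω) (fun s => U j s ω) t)) μ) ∧
      Tendsto (fun t : ℕ => ∫ ω, OnlineForest.risk P (OnlineForest.forestClassify fun j =>
          OnlineForest.treeAt Q (U₀ j ω) (fun s => Z s ω) (fun s => U j s ω) t) ∂μ)
        atTop (𝓝 (OnlineForest.bayesRisk P)) := by
  open OnlineForest in
  have hν : ∀ d θ, P.fst {x : Feat D | x d = θ} = 0 := fst_hyperplane P hP
  have herr : ∀ k, Tendsto (meanError P p rate Q k fun x => posterior P x k) atTop (𝓝 0) :=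
    fun k => tendsto_meanError P p rate Q hν hα_growth hα
      (tendsto_shallowMass hD hm P hν hp0 hp1 rate Q) k (fun x => posterior_nonneg P x k)
      (fun x => posterior_le_one P x k) (tendsto_meanBias_posterior P p rate Q hν
        (tendsto_shallowMass hD hm P hν hp0 hp1 rate Q) k)
  -- `H j` is all that tree `j` observes; only its marginal law matters.
  set H : Fin M → Ω → Hist D C := fun j ω => (U₀ j ω, fun t => (Z t ω, U j t ω)) with hH
  have hHlaw : ∀ j, HasLaw (H j) (histLaw P p rate) μ := fun j =>
    hasLaw_hist (hroot j) (hlaw j) (hindep j) (hroot_indep j)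
  set R : ℕ → Ω → ℝ := fun t ω => risk P (forestClassify fun j => histTree Q (H j ω) t) with hR
  have hRm : ∀ t, AEMeasurable (R t) μ := fun t =>
    (measurable_risk_forest P Q t).comp_aemeasurable
      (aemeasurable_pi_iff.2 fun j => (hHlaw j).aemeasurable)
  have hRi : ∀ t, Integrable (R t) μ := fun t =>
    Integrable.of_bound (hRm t).aestronglyMeasurable 1 (ae_of_all _ fun ω => by
      have h0 : 0 ≤ R t ω := measureReal_nonneg
      have h1 : R t ω ≤ 1 := measureReal_le_one
      rwa [Real.norm_of_nonneg h0])
  have hT : ∀ t (h : Hist D C), MeasTree fun _ : Feat D => histTree Q h t := fun t h =>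
    histTree_measTree Q measurable_const t
  have hlower : ∀ t ω, bayesRisk P ≤ R t ω := fun t ω =>
    bayesRisk_le_risk P (measurable_forestClassify (fun j => hT t (H j ω)) measurable_id)
  have hupper : ∀ t, ∫⁻ ω, ENNReal.ofReal (R t ω - bayesRisk P) ∂μ
      ≤ ∑ _j : Fin M, ∑ k, 2 * meanError P p rate Q k (fun x => posterior P x k) t := by
    intro t
    refine (lintegral_mono fun ω => excessRisk_le P hM _ fun j => hT t (H j ω)).trans
      (le_of_eq ?_)
    have hm : ∀ j k, AEMeasurable (fun ω => ∫⁻ x, ENNReal.ofReal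
        |(histTree Q (H j ω) t).posteriorEst x k - posterior P x k| ∂P.fst) μ := fun j k =>
      (measurable_treeError P Q k t).comp_aemeasurable (hHlaw j).aemeasurable
    rw [lintegral_finsetSum' _ fun j _ => Finset.aemeasurable_fun_sum _ fun k _ =>
      (hm j k).const_mul 2]
    refine Finset.sum_congr rfl fun j _ => ?_
    rw [lintegral_finsetSum' _ fun k _ => (hm j k).const_mul 2]
    refine Finset.sum_congr rfl fun k _ => ?_
    rw [lintegral_const_mul' _ _ (by simp)]
    congr 1
    exact (hHlaw j).lintegral_comp (measurable_treeError P Q k t).aemeasurable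
  refine ⟨hRi, ?_⟩
  have hlim : Tendsto (fun t => ∫⁻ ω, ENNReal.ofReal (R t ω - bayesRisk P) ∂μ) atTop (𝓝 0) := by
    refine tendsto_of_tendsto_of_tendsto_of_le_of_le tendsto_const_nhds ?_ (fun t => zero_le) hupper
    have h1 := tendsto_finsetSum (Finset.univ : Finset (Fin M)) fun _ _ =>
      tendsto_finsetSum (Finset.univ : Finset (Fin C)) fun k _ =>
        ENNReal.Tendsto.const_mul (a := (2 : ℝ≥0∞)) (herr k) (Or.inr (by simp))
    simpa using h1
  have hexcess : Tendsto (fun t => ∫ ω, (R t ω - bayesRisk P) ∂μ) atTop (𝓝 0) := by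
    have h1 := (ENNReal.tendsto_toReal ENNReal.zero_ne_top).comp hlim
    refine h1.congr fun t => ?_
    exact (integral_eq_lintegral_of_nonneg_ae (ae_of_all _ fun ω => sub_nonneg.2 (hlower t ω))
      ((hRi t).sub (integrable_const _)).aestronglyMeasurable).symm
  have hsum : ∀ t, ∫ ω, (R t ω - bayesRisk P) ∂μ + bayesRisk P = ∫ ω, R t ω ∂μ := fun t => by
    rw [integral_sub (hRi t) (integrable_const _)]
    simp
  have h2 := (hexcess.add_const (bayesRisk P)).congr hsum
  rwa [zero_add] at h2
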